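/- Let $k>1$ be a real number. For a positive integer $n$ put $$R_{HL}(n)=\sum_{\substack{m_1,m_2\ge 1\\ m_1+m_2^2=n}}\Lambda(m_1),$$ where $\Lambda$ is the von Mangoldt function, let $\Gamma$ be the Euler Gamma-function, and for $u>0$ and $\nu\in\mathbb{C}$ with $\Re(\nu)>0$ let $$J_\nu(u)=\frac{(u/2)^\nu}{2\pi i}\int_{(1)}s^{-\nu-1}e^{s}e^{-u^2/(4s)}\,\mathrm{d}s$$ be the Bessel function of complex order $\nu$ (Sonine's representation; the integral is over the vertical line $\Re(s)=1$, and any line $\Re(s)=a$ with $a>0$ gives the same value). Then, for every integer $N\ge 1$, $$\begin{aligned} \sum_{n\le N}R_{HL}(n)\frac{(1-n/N)^k}{\Gamma(k+1)} ={}&\frac{\pi^{1/2}}2\,\frac{N^{3/2}}{\Gamma(k+5/2)}-\frac12\,\frac{N}{\Gamma(k+2)} -\frac{\pi^{1/2}}2\sum_{\rho}\frac{\Gamma(\rho)}{\Gamma(k+3/2+\rho)}N^{1/2+\rho}\\ &+\frac12\sum_{\rho}\frac{\Gamma(\rho)}{\Gamma(k+1+\rho)}N^{\rho} +\frac{N^{3/4-k/2}}{\pi^{k+1}}\sum_{\ell\ge1}\frac{J_{k+3/2}(2\pi\ell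 N^{1/2})}{\ell^{k+3/2}}\\ &-\frac{N^{1/4-k/2}}{\pi^{k}}\sum_{\rho}\Gamma(\rho)\frac{N^{\rho/2}}{\pi^{\rho}}\sum_{\ell\ge1}\frac{J_{k+1/2+\rho}(2\pi\ell N^{1/2})}{\ell^{k+1/2+\rho}} +O_k\bigl(N^{1/2}\bigr), \end{aligned}$$ where $\rho$ runs over the non-trivial zeros of the Riemann zeta-function (the zeros with $0<\Re(\rho)<1$), counted with multiplicity, the implied constant depends only on $k$, and all the series over $\rho$ and over $\ell$ (in the last term: the inner series for every $\rho$, and the outer series of their sums) converge absolutely. -/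

import Mathlib

noncomputable section

/-- The number of representations `n = m₁ + m₂²` with positive integers `m₁`, `m₂`, weighted by
the von Mangoldt function of `m₁`. -/
def hardyLittlewoodR (n : ℕ) : ℝ :=
  ∑ m ∈ Finset.Icc 1 n ×ˢ Finset.Icc 1 n with m.1 + m.2 ^ 2 = n,
    ArithmeticFunction.vonMangoldt m.1

/-- The Cesàro-weighted average of order `k` of `hardyLittlewoodR` up to `N`. -/
def cesaroHL (k : ℝ) (N : ℕ) : ℝ :=
  ∑ n ∈ Finset.Icc 1 N,
    hardyLittlewoodR n * ((1 - (n : ℝ) / (N : ℝ)) ^ k / Real.Gamma (k + 1))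

/-- The non-trivial zeros of the Riemann zeta function: its zeros in the open critical strip. -/
def zetaZeros : Set ℂ :=
  {s : ℂ | riemannZeta s = 0 ∧ 0 < s.re ∧ s.re < 1}

/-- The multiplicity of a zero of the Riemann zeta function. A sum in which `ρ` runs over the
non-trivial zeros counted with multiplicity is a sum over `zetaZeros` in which the term of `ρ`
carries this factor. -/
def zetaMult (ρ : ℂ) : ℕ := analyticOrderNatAt riemannZeta ρ

/-- The Bessel function `J_ν(u)`, for `0 < re ν` and `0 < u`, by Sonine's integral
`(u / 2) ^ ν / (2 π i) ∫ s ^ (-ν - 1) e ^ s e ^ (-u² / (4 s)) ds` over the upward vertical line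
`re s = 1`, parametrized as `s = 1 + i t`, so that `ds = i dt`. (The integral converges
absolutely, and any line `re s = a` with `0 < a` gives the same value.) -/
def besselJ (ν : ℂ) (u : ℝ) : ℂ :=
  ((u : ℂ) / 2) ^ ν / (2 * (Real.pi : ℂ) * Complex.I) *
    ∫ t : ℝ,
      (1 + (t : ℂ) * Complex.I) ^ (-ν - 1) * Complex.exp (1 + (t : ℂ) * Complex.I) *
        Complex.exp (-(u : ℂ) ^ 2 / (4 * (1 + (t : ℂ) * Complex.I))) * Complex.I

/-- The summand `J_ν(2 π ℓ N^{1/2}) / ℓ^ν` of the Bessel series. -/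
def besselTerm (ν : ℂ) (N : ℕ) (ℓ : ℕ+) : ℂ :=
  besselJ ν (2 * Real.pi * ((ℓ : ℕ) : ℝ) * Real.sqrt (N : ℝ)) / ((ℓ : ℕ) : ℂ) ^ ν

/-- The summand `Γ(ρ) / Γ(w + ρ) · N^{w' + ρ}` of the sums over the zeros, with multiplicity. -/
def gammaZeroTerm (w w' : ℂ) (N : ℕ) (ρ : zetaZeros) : ℂ :=
  (zetaMult ρ : ℂ) * (Complex.Gamma ρ / Complex.Gamma (w + ρ) * (N : ℂ) ^ (w' + (ρ : ℂ)))

/-- The summand `Γ(ρ) N^{ρ/2} π^{-ρ} ∑_{ℓ ≥ 1} J_{k+1/2+ρ}(2 π ℓ N^{1/2}) / ℓ^{k+1/2+ρ}` of the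
double series over the zeros and over `ℓ`, with multiplicity. -/
def besselZeroTerm (k : ℝ) (N : ℕ) (ρ : zetaZeros) : ℂ :=
  (zetaMult ρ : ℂ) *
    (Complex.Gamma ρ * ((N : ℂ) ^ ((ρ : ℂ) / 2) / (Real.pi : ℂ) ^ (ρ : ℂ)) *
      ∑' ℓ : ℕ+, besselTerm ((k : ℂ) + 1 / 2 + ρ) N ℓ)

end

/-! Summing over the prime-power variable first turns the Cesàro mean into N^{-k} times the sum over
m ≥ 1 of the Riesz means of Λ of order k at N - m² (`cesaroHL_eq_sum_rieszMean`). The explicit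
formula `exists_rieszMean_error` replaces the Riesz mean at X by X^{k+1}/Γ(k+2) minus the sum over ρ
of Γ(ρ)/Γ(k+1+ρ) X^{k+ρ}, with error O(X^k). Only m < √N matter, so after division by N^k the errors
add up to O(N^{1/2}).

What is left are the sums of (N - m²)_+^a for a = k+1 and a = k+ρ. Poisson summation (`sum_posCpow`)
evaluates each of them exactly: frequency zero gives a multiple of N^{a+1/2}, the point m = 0 gives
-N^a/2, and the other frequencies give Bessel functions of order a+1/2, because Sonine's integral
is, up to constants, the Fourier transform of (1 - x²)_+^a (`integral_exp_mul_posCpow`). Poisson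
summation is applied for each zero separately, so the series over ρ and over ℓ are never
interchanged.

The explicit formula is reached without moving a contour. The entire function (s-1)ζ(s) grows at
most like exp(C(1+|s|)^{3/2}), so its logarithmic derivative has a partial fraction expansion over
the zeros (`hasSum_logDeriv_of_entire`). Divided by s(s+1), this is an identity of Mellin transforms
on Re s = 2. It compares the sum of Λ(n)(x-n) over n ≤ x with a sum over zeros that converges
absolutely, since the sum of m(ρ)/(1+|ρ|)² does. Mellin inversion of the vanishing difference gives
`psiOne_eq`. Integration against (X-t)^{k-2}, integrable because k > 1, then turns every power into
a beta integral and yields the formula for Riesz means. -/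

section Preliminaries

open Complex Metric Set Filter Topology MeasureTheory

/-! ### Zeros and partial fractions of entire functions of order at most 3/2. -/

section EntireFunctions

variable {f : ℂ → ℂ}

lemma analyticOrderAt_ne_top_of_entire (hf : Differentiable ℂ f) (h0 : f 0 ≠ 0) (z : ℂ) :
    analyticOrderAt f z ≠ ⊤ := by
  rw [Ne, AnalyticOnNhd.analyticOrderAt_eq_top_iff_eq_zero z fun w => hf.analyticAt w]
  rintro rfl
  exact h0 rfl

lemma finite_zeros_closedBall (hf : Differentiable ℂ f) (h0 : f 0 ≠ 0) (R : ℝ) :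
    {z : ℂ | f z = 0 ∧ ‖z‖ ≤ R}.Finite := by
  have h := AnalyticOnNhd.preimage_zero_mem_codiscrete (fun w _ => hf.analyticAt w) h0
  rw [mem_codiscrete'] at h
  have hc : IsClosed {z : ℂ | f z = 0} := isClosed_eq hf.continuous continuous_const
  have hd : IsDiscrete {z : ℂ | f z = 0} := by
    convert h.2 using 1
    ext z
    simp
  have hfin := ((isCompact_closedBall (0 : ℂ) R).inter_right hc).finite
    (hd.mono inter_subset_right)
  refine hfin.subset fun z hz => ⟨?_, hz.1⟩
  simpa using hz.2

/-- Division of an entire function by its zeros in a finite set. -/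
lemma exists_entire_factorization (hf : Differentiable ℂ f) (h0 : f 0 ≠ 0) (F : Finset ℂ) :
    ∃ g : ℂ → ℂ, Differentiable ℂ g ∧ (∀ ρ ∈ F, g ρ ≠ 0) ∧
      ∀ z, f z = (∏ ρ ∈ F, (z - ρ) ^ analyticOrderNatAt f ρ) * g z := by
  induction F using Finset.induction_on with
  | empty => exact ⟨f, hf, by simp, by simp⟩
  | insert a F ha ih =>
    obtain ⟨g, hg, hgF, hfg⟩ := ih
    set P : ℂ → ℂ := fun z => ∏ ρ ∈ F, (z - ρ) ^ analyticOrderNatAt f ρ with hP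
    have hPd : Differentiable ℂ P := by
      rw [hP]; fun_prop
    have hfP : f = P * g := funext hfg
    have hPa : P a ≠ 0 := by
      rw [hP, Finset.prod_ne_zero_iff]
      intro ρ hρ
      exact pow_ne_zero _ (sub_ne_zero.2 fun h => ha (h ▸ hρ))
    have hord : analyticOrderAt f a = analyticOrderAt g a := by
      rw [hfP, analyticOrderAt_mul (hPd.analyticAt a) (hg.analyticAt a),
        analyticOrderAt_eq_zero.2 (Or.inr hPa), zero_add]
    have hgt : analyticOrderAt g a ≠ ⊤ := hord ▸ analyticOrderAt_ne_top_of_entire hf h0 a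
    have hnat : analyticOrderNatAt f a = analyticOrderNatAt g a := by
      simp [analyticOrderNatAt, hord]
    obtain ⟨h, hh, hha, hev⟩ := ((hg.analyticAt a).analyticOrderAt_ne_top).1 hgt
    set n := analyticOrderNatAt g a
    -- The quotient, with its removable singularity filled by the value of the local cofactor h.
    set k : ℂ → ℂ := fun z => if z = a then h a else g z / (z - a) ^ n with hk
    have hkev : k =ᶠ[𝓝 a] h := by
      filter_upwards [hev] with z hz
      by_cases hza : z = a
      · simp [hk, hza]
      · simp only [hk, hza, if_false, hz, smul_eq_mul]
        field_simp [sub_ne_zero.2 hza]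
    have hgk : ∀ z, g z = (z - a) ^ n * k z := by
      intro z
      by_cases hza : z = a
      · subst hza
        simpa [hk] using hev.self_of_nhds
      · have := sub_ne_zero.2 hza
        simp only [hk, hza, if_false]
        field_simp
    refine ⟨k, ?_, ?_, ?_⟩
    · intro z
      by_cases hza : z = a
      · subst hza
        exact (hh.differentiableAt).congr_of_eventuallyEq hkev
      · have : k =ᶠ[𝓝 z] fun w => g w / (w - a) ^ n := by
          filter_upwards [isOpen_ne.mem_nhds hza] with w hw
          simp [hk, show w ≠ a from hw]
        refine DifferentiableAt.congr_of_eventuallyEq ?_ this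
        exact (hg z).div (by fun_prop) (pow_ne_zero _ (sub_ne_zero.2 hza))
    · intro ρ hρ
      rcases Finset.mem_insert.1 hρ with rfl | hρ
      · simpa [hk] using hha
      · intro h
        exact hgF ρ hρ (by rw [hgk, h, mul_zero])
    · intro z
      rw [hfg, Finset.prod_insert ha, hnat, hgk z]
      ring

/-- Jensen's formula with outer radius 2r: each zero in the disc of radius r contributes at least
log 2 to the mean of log |f/f(0)| on the larger circle. -/
lemma sum_analyticOrderNatAt_le (hf : Differentiable ℂ f) (h0 : f 0 ≠ 0) {r M : ℝ} (hr : 0 < r)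
    (hM : 1 ≤ M) (hb : ∀ z, ‖z‖ = 2 * r → ‖f z‖ ≤ M) (F : Finset ℂ) (hF : ∀ ρ ∈ F, ‖ρ‖ ≤ r) :
    (∑ ρ ∈ F, (analyticOrderNatAt f ρ : ℝ)) ≤ Real.log (M / ‖f 0‖) / Real.log 2 := by
  have ha : ∀ s : Set ℂ, AnalyticOnNhd ℂ f s := fun s z _ => hf.analyticAt z
  have h := AnalyticOnNhd.sum_divisor_le (c := 0) (r := r) (R := 2 * r) (M := M) (f := f)
    (by rwa [abs_of_pos hr]) (by rw [abs_of_pos hr, abs_of_pos (by positivity)]; linarith) hM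
    (ha _) h0 (by
      intro z hz
      apply hb
      simpa [abs_of_pos hr] using hz)
  rw [mul_div_assoc, div_self hr.ne', mul_one] at h
  refine le_trans ?_ h
  set D := MeromorphicOn.divisor f (closedBall 0 |r|)
  have hfin : (D : ℂ → ℤ).support.Finite := D.finiteSupport (isCompact_closedBall ..)
  have hD : ∀ z ∈ closedBall (0 : ℂ) |r|, D z = (analyticOrderNatAt f z : ℤ) := by
    intro z hz
    rw [MeromorphicOn.AnalyticOnNhd.divisor_apply (ha _) hz]
    rw [← Nat.cast_analyticOrderNatAt (analyticOrderAt_ne_top_of_entire hf h0 z)]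
    simp
  have hD0 : ∀ z, 0 ≤ D z := by
    intro z
    by_cases hz : z ∈ closedBall (0 : ℂ) |r|
    · rw [hD z hz]; positivity
    · simp [D, hz]
  rw [finsum_eq_sum_of_support_subset D (s := F ∪ hfin.toFinset) (by
    intro z hz; simp only [Finset.coe_union, Finite.coe_toFinset]; exact Or.inr hz)]
  push_cast
  calc (∑ ρ ∈ F, (analyticOrderNatAt f ρ : ℝ)) = ∑ ρ ∈ F, ((D ρ : ℤ) : ℝ) := by
        refine Finset.sum_congr rfl fun ρ hρ => ?_
        rw [hD ρ (by simpa [abs_of_pos hr] using hF ρ hρ)]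
        simp
    _ ≤ _ := Finset.sum_le_sum_of_subset_of_nonneg Finset.subset_union_left
        fun z _ _ => by exact_mod_cast hD0 z


/-- On the disc g = g(0) e^L with Re L ≤ M. Borel–Carathéodory bounds L by 2M on the half disc,
Cauchy's estimate bounds L' by 8M/r on the quarter disc, and the Schwarz lemma for L' - L'(0) gains
the factor |s|. -/
lemma norm_logDeriv_sub_le_of_zero_free {g : ℂ → ℂ} (hg : Differentiable ℂ g) {r M : ℝ}
    (hM : 0 < M) (hgz : ∀ z ∈ ball (0 : ℂ) r, g z ≠ 0)
    (hgb : ∀ z ∈ ball (0 : ℂ) r, ‖g z‖ ≤ Real.exp M * ‖g 0‖) {s : ℂ} (hs : ‖s‖ < r / 4) :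
    ‖logDeriv g s - logDeriv g 0‖ ≤ 64 * M * ‖s‖ / r ^ 2 := by
  have hr : 0 < r := by linarith [norm_nonneg s]
  have hg0 : g 0 ≠ 0 := hgz 0 (by simpa using hr)
  have hlog : DifferentiableOn ℂ (logDeriv g) (ball 0 r) := by
    intro z hz
    exact (((hg.analyticAt z).deriv.differentiableAt).div (hg z) (hgz z hz)).differentiableWithinAt
  obtain ⟨L, hL0, hL⟩ := hlog.isExactOn_ball.with_val_at 0 0
  have hLd : DifferentiableOn ℂ L (ball 0 r) := fun z hz =>
    (hL z hz).differentiableAt.differentiableWithinAt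
  have hconst : ∀ z ∈ ball (0 : ℂ) r, g z = g 0 * cexp (L z) := by
    have hd : ∀ z ∈ ball (0 : ℂ) r, HasDerivAt (fun z => g z * cexp (-L z)) 0 z := by
      intro z hz
      have h1 := (hg z).hasDerivAt.mul ((hL z hz).neg.cexp)
      refine h1.congr_deriv ?_
      have := hgz z hz
      simp only [logDeriv_apply]
      field_simp
      ring
    intro z hz
    have := (convex_ball (0 : ℂ) r).is_const_of_fderivWithin_eq_zero (𝕜 := ℂ)
      (f := fun z => g z * cexp (-L z))
      (fun w hw => (hd w hw).differentiableAt.differentiableWithinAt)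
      (fun w hw => by
        rw [fderivWithin_of_isOpen isOpen_ball hw]
        ext
        simp [(hd w hw).deriv])
      hz (show (0 : ℂ) ∈ ball 0 r by simpa using hr)
    simp only [hL0, neg_zero, Complex.exp_zero, mul_one] at this
    rw [← this, mul_assoc, ← Complex.exp_add]
    simp
  have hre : MapsTo L (ball 0 r) {z | z.re ≤ M} := by
    intro z hz
    have h1 := hgb z hz
    rw [hconst z hz, norm_mul, Complex.norm_exp, mul_comm] at h1
    exact Real.exp_le_exp.1 (le_of_mul_le_mul_right h1 (norm_pos_iff.2 hg0))
  have hbd : ∀ z, ‖z‖ ≤ r / 2 → ‖L z‖ ≤ 2 * M := by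
    intro z hz
    have hzr : ‖z‖ < r := by linarith
    refine (borelCaratheodory_zero hM hLd hre hr (by simpa using hzr) hL0).trans ?_
    rw [div_le_iff₀ (by linarith)]
    nlinarith [norm_nonneg z]
  have hder : ∀ w ∈ ball (0 : ℂ) (r / 4), ‖logDeriv g w‖ ≤ 8 * M / r := by
    intro w hw
    have hw' : ‖w‖ < r / 4 := by simpa using hw
    rw [← (hL w (by simpa using hw'.trans (by linarith))).deriv]
    have hsub : closedBall w (r / 4) ⊆ ball 0 r := by
      intro z hz
      have : ‖z - w‖ ≤ r / 4 := by simpa [dist_eq_norm] using hz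
      have := norm_le_norm_add_norm_sub' z w
      simp only [mem_ball, dist_zero_right]
      linarith
    have := norm_deriv_le_of_forall_mem_sphere_norm_le (c := w) (R := r / 4) (C := 2 * M) (f := L)
      (by positivity) (hLd.diffContOnCl_ball hsub) (by
        intro z hz
        apply hbd
        have : ‖z - w‖ = r / 4 := by simpa [dist_eq_norm] using hz
        have := norm_le_norm_add_norm_sub' z w
        linarith)
    refine this.trans_eq ?_
    field_simp
    ring
  have h0r : (0 : ℂ) ∈ ball (0 : ℂ) (r / 4) := by simpa using hr
  have := dist_le_div_mul_dist_of_mapsTo_ball (f := logDeriv g) (c := 0) (R₁ := r / 4)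
    (R₂ := 16 * M / r) (z := s) (hlog.mono (ball_subset_ball (by linarith))) (by
      intro w hw
      rw [mem_closedBall, dist_eq_norm]
      refine (norm_sub_le _ _).trans ?_
      have h1 := hder w hw
      have h2 := hder 0 h0r
      have : 16 * M / r = 8 * M / r + 8 * M / r := by ring
      linarith) (by simpa using hs)
  rw [dist_eq_norm, dist_zero_right] at this
  refine this.trans_eq ?_
  field_simp
  ring

/-- Jensen's bound allows O(2^{3j/2}) zeros in the dyadic shell 2^j ≤ 1 + |ρ| < 2^{j+1}, against a
weight of at most 4^{-j}. Points that are not zeros have order 0 and do not count. -/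
lemma summable_analyticOrderNatAt_div_sq (hf : Differentiable ℂ f) (h0 : f 0 ≠ 0) {C : ℝ}
    (hC : 0 ≤ C) (hb : ∀ z, ‖f z‖ ≤ Real.exp (C * (1 + ‖z‖) ^ (3 / 2 : ℝ))) :
    Summable fun ρ : ℂ => (analyticOrderNatAt f ρ : ℝ) / (1 + ‖ρ‖) ^ 2 := by
  set q : ℝ := 2 ^ (3 / 2 : ℝ) with hq
  have hq1 : 1 ≤ q := Real.one_le_rpow (by norm_num) (by norm_num)
  have hq4 : q < 4 := by
    calc q < 2 ^ (2 : ℝ) := Real.rpow_lt_rpow_of_exponent_lt (by norm_num) (by norm_num)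
      _ = 4 := by norm_num
  set K : ℝ := (C * q ^ 3 + |Real.log ‖f 0‖|) / Real.log 2 with hK
  have hl2 : 0 < Real.log 2 := Real.log_pos (by norm_num)
  have hgeo : Summable fun j : ℕ => K * (q / 4) ^ j :=
    (summable_geometric_of_lt_one (by positivity) (by linarith)).mul_left K
  set J : ℂ → ℕ := fun ρ => Nat.log 2 ⌊1 + ‖ρ‖⌋₊ with hJ
  have hfl : ∀ ρ : ℂ, ⌊1 + ‖ρ‖⌋₊ ≠ 0 := fun ρ => by
    rw [Ne, Nat.floor_eq_zero, not_lt]; linarith [norm_nonneg ρ]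
  have hJl : ∀ ρ : ℂ, (2 : ℝ) ^ J ρ ≤ 1 + ‖ρ‖ := by
    intro ρ
    have h1 := Nat.pow_log_le_self 2 (hfl ρ)
    calc (2 : ℝ) ^ J ρ = ((2 ^ J ρ : ℕ) : ℝ) := by push_cast; rfl
      _ ≤ (⌊1 + ‖ρ‖⌋₊ : ℝ) := by exact_mod_cast h1
      _ ≤ _ := Nat.floor_le (by positivity)
  have hJu : ∀ ρ : ℂ, 1 + ‖ρ‖ < (2 : ℝ) ^ (J ρ + 1) := by
    intro ρ
    have h1 := Nat.lt_pow_succ_log_self (b := 2) (by norm_num) ⌊1 + ‖ρ‖⌋₊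
    rw [Nat.floor_lt (by positivity)] at h1
    exact_mod_cast h1
  refine summable_of_sum_le (c := ∑' j : ℕ, K * (q / 4) ^ j) (fun ρ => by positivity) fun F => ?_
  rw [← Finset.sum_fiberwise_of_maps_to (t := F.image J) (g := J)
    fun x hx => Finset.mem_image_of_mem J hx]
  refine le_trans (Finset.sum_le_sum fun j _ => ?_)
    (hgeo.sum_le_tsum (F.image J) fun j _ => by positivity)
  have hpow : ∀ i : ℕ, ((2 : ℝ) ^ i) ^ (3 / 2 : ℝ) = q ^ i := fun i => by
    rw [hq, ← Real.rpow_natCast, ← Real.rpow_natCast, ← Real.rpow_mul (by norm_num),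
      ← Real.rpow_mul (by norm_num), mul_comm]
  have hcount := sum_analyticOrderNatAt_le hf h0 (r := 2 ^ (j + 1))
    (M := Real.exp (C * (1 + 2 * 2 ^ (j + 1)) ^ (3 / 2 : ℝ))) (by positivity)
    (Real.one_le_exp (by positivity)) (fun z hz => by rw [← hz]; exact hb z)
    (F.filter fun ρ => J ρ = j) (by
      intro ρ hρ
      have := hJu ρ
      rw [(Finset.mem_filter.1 hρ).2] at this
      linarith)
  -- Since 1 + 2·2^{j+1} ≤ 2^{j+3}, the growth bound costs C q³ q^j; the contribution of f(0) is
  -- absorbed because q^j ≥ 1.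
  have hM : Real.log (Real.exp (C * (1 + 2 * 2 ^ (j + 1)) ^ (3 / 2 : ℝ)) / ‖f 0‖) / Real.log 2
      ≤ K * q ^ j := by
    rw [Real.log_div (Real.exp_pos _).ne' (norm_ne_zero_iff.2 h0), Real.log_exp, hK,
      div_mul_eq_mul_div]
    gcongr
    have h1 : (1 + 2 * (2 : ℝ) ^ (j + 1)) ^ (3 / 2 : ℝ) ≤ q ^ (j + 3) := by
      rw [← hpow]
      refine Real.rpow_le_rpow (by positivity) ?_ (by norm_num)
      have : (1 : ℝ) ≤ 2 ^ j := one_le_pow₀ (by norm_num)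
      rw [pow_succ, pow_add]
      linarith
    have h2 : |Real.log ‖f 0‖| ≤ |Real.log ‖f 0‖| * q ^ j :=
      le_mul_of_one_le_right (abs_nonneg _) (one_le_pow₀ hq1)
    have h3 := neg_abs_le (Real.log ‖f 0‖)
    have h4 := mul_le_mul_of_nonneg_left h1 hC
    have h5 : C * q ^ (j + 3) = C * q ^ 3 * q ^ j := by ring
    linarith
  calc ∑ ρ ∈ F with J ρ = j, (analyticOrderNatAt f ρ : ℝ) / (1 + ‖ρ‖) ^ 2
      ≤ ∑ ρ ∈ F with J ρ = j, (analyticOrderNatAt f ρ : ℝ) / 4 ^ j := by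
        refine Finset.sum_le_sum fun ρ hρ => ?_
        have h1 := hJl ρ
        rw [(Finset.mem_filter.1 hρ).2] at h1
        have h2 : (4 : ℝ) ^ j ≤ (1 + ‖ρ‖) ^ 2 := by
          calc (4 : ℝ) ^ j = (2 ^ j) ^ 2 := by rw [← pow_mul, mul_comm, pow_mul]; norm_num
            _ ≤ _ := by gcongr
        gcongr
    _ = (∑ ρ ∈ F with J ρ = j, (analyticOrderNatAt f ρ : ℝ)) / 4 ^ j := by
        rw [Finset.sum_div]
    _ ≤ K * q ^ j / 4 ^ j := by
        gcongr
        exact hcount.trans hM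
    _ = K * (q / 4) ^ j := by rw [div_pow]; ring

/-- The logarithmic derivative of an entire function is approximated by the contribution of the
zeros in a large disc. -/
lemma norm_logDeriv_sub_sum_le (hf : Differentiable ℂ f) (h0 : f 0 ≠ 0) {R B : ℝ}
    (hB : 0 ≤ B) (hb : ∀ z, ‖z‖ = R → ‖f z‖ ≤ Real.exp B) {s : ℂ} (hs : ‖s‖ < R / 8)
    (hfs : f s ≠ 0) (F : Finset ℂ) (hF : ∀ ρ, ρ ∈ F ↔ f ρ = 0 ∧ ‖ρ‖ ≤ R / 2) :
    ‖logDeriv f s - logDeriv f 0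
        - ∑ ρ ∈ F, (analyticOrderNatAt f ρ : ℂ) * (1 / (s - ρ) + 1 / ρ)‖
      ≤ 256 * (B + |Real.log ‖f 0‖| + 1) * ‖s‖ / R ^ 2 := by
  have hR : 0 < R := by linarith [norm_nonneg s]
  obtain ⟨g, hg, hgF, hfg⟩ := exists_entire_factorization hf h0 F
  -- The summand 1 makes M positive, as the Borel–Carathéodory step requires.
  set M := B + |Real.log ‖f 0‖| + 1 with hMdef
  have hM : 0 < M := by positivity
  have hρ0 : ∀ ρ ∈ F, ρ ≠ 0 := by
    rintro ρ hρ rfl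
    exact h0 ((hF 0).1 hρ).1
  set P : ℂ → ℂ := fun z => ∏ ρ ∈ F, (z - ρ) ^ analyticOrderNatAt f ρ with hP
  have hPd : Differentiable ℂ P := by rw [hP]; fun_prop
  have hfP : f = fun z => P z * g z := funext hfg
  have hP0 : P 0 ≠ 0 := by
    intro h
    exact h0 (by rw [hfP]; simp [h])
  have hg0 : g 0 ≠ 0 := by
    intro h
    exact h0 (by rw [hfP]; simp [h])
  have hzero : ∀ z ∈ ball (0 : ℂ) (R / 2), g z ≠ 0 := by
    intro z hz h
    have hfz : f z = 0 := by rw [hfP]; simp [h]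
    have : z ∈ F := (hF z).2 ⟨hfz, by simpa using (mem_ball.1 hz).le⟩
    exact hgF z this h
  -- A zero with |ρ| ≤ R/2 is at least as far from the circle |z| = R as from 0, so dividing by P
  -- costs nothing there.
  have hPge : ∀ z, ‖z‖ = R → ‖P 0‖ ≤ ‖P z‖ := by
    intro z hz
    simp only [hP, norm_prod, norm_pow]
    refine Finset.prod_le_prod (fun ρ _ => by positivity) fun ρ hρ => ?_
    have h1 := ((hF ρ).1 hρ).2
    have h2 := norm_sub_norm_le z ρ
    have : ‖(0 : ℂ) - ρ‖ ≤ ‖z - ρ‖ := by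
      rw [zero_sub, norm_neg]
      linarith
    gcongr
  have hgR : ∀ z, ‖z‖ = R → ‖g z‖ ≤ Real.exp M * ‖g 0‖ := by
    intro z hz
    have h1 := hb z hz
    have h2 := hPge z hz
    have h3 : ‖f 0‖ = ‖P 0‖ * ‖g 0‖ := by rw [hfP]; simp
    have h4 : ‖f z‖ = ‖P z‖ * ‖g z‖ := by rw [hfP]; simp
    have hP0' : 0 < ‖P 0‖ := norm_pos_iff.2 hP0
    have h5 : Real.exp B ≤ Real.exp M * ‖f 0‖ := by
      rw [← Real.exp_log (norm_pos_iff.2 h0), ← Real.exp_add]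
      apply Real.exp_le_exp.2
      have := neg_abs_le (Real.log ‖f 0‖)
      linarith
    have h6 : ‖P 0‖ * ‖g z‖ ≤ ‖P 0‖ * (Real.exp M * ‖g 0‖) := by
      calc ‖P 0‖ * ‖g z‖ ≤ ‖P z‖ * ‖g z‖ := by gcongr
        _ ≤ Real.exp M * ‖f 0‖ := by rw [← h4]; exact h1.trans h5
        _ = _ := by rw [h3]; ring
    exact le_of_mul_le_mul_left h6 hP0'
  have hgb : ∀ z ∈ ball (0 : ℂ) (R / 2), ‖g z‖ ≤ Real.exp M * ‖g 0‖ := by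
    intro z hz
    refine norm_le_of_forall_mem_frontier_norm_le (U := ball (0 : ℂ) R) isBounded_ball
      hg.diffContOnCl ?_ (subset_closure (ball_subset_ball (by linarith) hz))
    intro w hw
    rw [frontier_ball _ hR.ne'] at hw
    exact hgR w (by simpa using hw)
  have hgs : g s ≠ 0 := hzero s (by simpa using hs.trans (by linarith))
  have hkey := norm_logDeriv_sub_le_of_zero_free hg hM hzero hgb (s := s) (by linarith)
  have hlogP : ∀ z, (∀ ρ ∈ F, z ≠ ρ) →
      logDeriv P z = ∑ ρ ∈ F, (analyticOrderNatAt f ρ : ℂ) * (1 / (z - ρ)) := by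
    intro z hz
    rw [hP, logDeriv_prod]
    · refine Finset.sum_congr rfl fun ρ hρ => ?_
      rw [logDeriv_fun_pow (by fun_prop)]
      simp [logDeriv_apply]
    · exact fun ρ hρ => pow_ne_zero _ (sub_ne_zero.2 (hz ρ hρ))
    · intro ρ hρ
      fun_prop
  have hsF : ∀ ρ ∈ F, s ≠ ρ := by
    rintro ρ hρ rfl
    exact hfs ((hF s).1 hρ).1
  have hPs : P s ≠ 0 := by
    intro h
    exact hfs (by rw [hfP]; simp [h])
  have e1 : logDeriv f s = logDeriv P s + logDeriv g s := by
    conv_lhs => rw [hfP]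
    exact logDeriv_mul s hPs hgs (hPd s) (hg s)
  have e2 : logDeriv f 0 = logDeriv P 0 + logDeriv g 0 := by
    conv_lhs => rw [hfP]
    exact logDeriv_mul 0 hP0 hg0 (hPd 0) (hg 0)
  have e3 : logDeriv f s - logDeriv f 0
      - ∑ ρ ∈ F, (analyticOrderNatAt f ρ : ℂ) * (1 / (s - ρ) + 1 / ρ)
      = logDeriv g s - logDeriv g 0 := by
    rw [e1, e2, hlogP s hsF, hlogP 0 fun ρ hρ => (hρ0 ρ hρ).symm]
    simp only [mul_add, Finset.sum_add_distrib, zero_sub, one_div, inv_neg, mul_neg,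
      Finset.sum_neg_distrib]
    ring
  rw [e3]
  refine hkey.trans_eq ?_
  field_simp
  ring

/-- The summand equals s/((s - ρ)ρ), so the series converges absolutely by the zero count. Its value
is read off along the discs |ρ| ≤ n/2, where the error is O(n^{3/2}/n²). -/
lemma hasSum_logDeriv_of_entire (hf : Differentiable ℂ f) (h0 : f 0 ≠ 0) {C : ℝ}
    (hC : 0 ≤ C) (hb : ∀ z, ‖f z‖ ≤ Real.exp (C * (1 + ‖z‖) ^ (3 / 2 : ℝ))) {s : ℂ}
    (hfs : f s ≠ 0) :
    HasSum (fun ρ : {z : ℂ | f z = 0} =>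
      (analyticOrderNatAt f ρ : ℂ) * (1 / (s - (ρ : ℂ)) + 1 / (ρ : ℂ)))
      (logDeriv f s - logDeriv f 0) := by
  have hsumm : Summable fun ρ : {z : ℂ | f z = 0} =>
      (analyticOrderNatAt f ρ : ℂ) * (1 / (s - (ρ : ℂ)) + 1 / (ρ : ℂ)) := by
    have h1 := ((summable_analyticOrderNatAt_div_sq hf h0 hC hb).subtype
      {z : ℂ | f z = 0}).mul_left (8 * ‖s‖)
    refine Summable.of_norm_bounded_eventually h1 ?_
    have hfin : {ρ : {z : ℂ | f z = 0} | ‖(ρ : ℂ)‖ ≤ 2 * ‖s‖ + 1}.Finite := by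
      refine Set.Finite.of_finite_image ((finite_zeros_closedBall hf h0 (2 * ‖s‖ + 1)).subset ?_)
        Subtype.val_injective.injOn
      rintro _ ⟨ρ, hρ, rfl⟩
      exact ⟨ρ.2, hρ⟩
    filter_upwards [hfin.compl_mem_cofinite] with ρ hρ
    have hρ' : 2 * ‖s‖ + 1 < ‖(ρ : ℂ)‖ := not_le.1 hρ
    have hρpos : 0 < ‖(ρ : ℂ)‖ := by linarith [norm_nonneg s]
    have hρ0 : (ρ : ℂ) ≠ 0 := norm_pos_iff.1 hρpos
    have hsρ : ‖(ρ : ℂ)‖ / 2 ≤ ‖s - ρ‖ := by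
      have := norm_sub_norm_le (ρ : ℂ) s
      rw [norm_sub_rev] at this
      linarith
    have hsρ0 : s - ρ ≠ 0 := norm_pos_iff.1 (by linarith)
    have e : 1 / (s - (ρ : ℂ)) + 1 / (ρ : ℂ) = s / ((s - ρ) * ρ) := by
      field_simp
      ring
    rw [e, norm_mul, norm_div, norm_mul, Complex.norm_natCast]
    have : (1 + ‖(ρ : ℂ)‖) ^ 2 ≤ 8 * (‖s - ρ‖ * ‖(ρ : ℂ)‖) := by nlinarith [norm_nonneg s]
    have h2 : ‖s‖ / (‖s - ρ‖ * ‖(ρ : ℂ)‖) ≤ 8 * ‖s‖ / (1 + ‖(ρ : ℂ)‖) ^ 2 := by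
      rw [div_le_div_iff₀ (by positivity) (by positivity)]
      nlinarith [norm_nonneg s]
    calc (analyticOrderNatAt f ρ : ℝ) * (‖s‖ / (‖s - ρ‖ * ‖(ρ : ℂ)‖))
        ≤ (analyticOrderNatAt f ρ : ℝ) * (8 * ‖s‖ / (1 + ‖(ρ : ℂ)‖) ^ 2) := by gcongr
      _ = 8 * ‖s‖ * ((analyticOrderNatAt f ρ : ℝ) / (1 + ‖(ρ : ℂ)‖) ^ 2) := by ring
  have hfin : ∀ n : ℕ, {ρ : {z : ℂ | f z = 0} | ‖(ρ : ℂ)‖ ≤ (n : ℝ) / 2}.Finite := fun n => by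
    refine Set.Finite.of_finite_image ((finite_zeros_closedBall hf h0 ((n : ℝ) / 2)).subset ?_)
      Subtype.val_injective.injOn
    rintro _ ⟨ρ, hρ, rfl⟩
    exact ⟨ρ.2, hρ⟩
  have htop : Tendsto (fun n => (hfin n).toFinset) atTop atTop := by
    refine tendsto_atTop_finset_of_monotone ?_ ?_
    · intro m n hmn ρ hρ
      simp only [Finite.mem_toFinset, mem_ofPred_eq] at hρ ⊢
      refine hρ.trans ?_
      gcongr
    · intro ρ
      obtain ⟨n, hn⟩ := exists_nat_ge (2 * ‖(ρ : ℂ)‖)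
      refine ⟨n, ?_⟩
      simp only [Finite.mem_toFinset, mem_ofPred_eq]
      linarith
  have hlim := hsumm.hasSum.comp htop
  have hlim2 : Tendsto (fun n : ℕ => ∑ ρ ∈ (hfin n).toFinset,
      (analyticOrderNatAt f ρ : ℂ) * (1 / (s - (ρ : ℂ)) + 1 / (ρ : ℂ))) atTop
      (𝓝 (logDeriv f s - logDeriv f 0)) := by
    rw [tendsto_iff_norm_sub_tendsto_zero]
    set K := |Real.log ‖f 0‖| + 1 with hK
    have hbound : Tendsto (fun n : ℕ => 256 * (4 * C + K) * ‖s‖ * (n : ℝ) ^ (-(1 / 2) : ℝ))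
        atTop (𝓝 0) := by
      have := (tendsto_rpow_neg_atTop (y := 1 / 2) (by norm_num)).comp tendsto_natCast_atTop_atTop
      simpa using this.const_mul (256 * (4 * C + K) * ‖s‖)
    refine squeeze_zero' (Eventually.of_forall fun _ => norm_nonneg _) ?_ hbound
    obtain ⟨n₀, hn₀⟩ := exists_nat_gt (8 * ‖s‖)
    filter_upwards [eventually_ge_atTop (max n₀ 1)] with n hn
    have hn1 : (1 : ℝ) ≤ n := by exact_mod_cast (le_max_right _ _).trans hn
    have hn0 : 8 * ‖s‖ < n := hn₀.trans_le (by exact_mod_cast (le_max_left _ _).trans hn)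
    have h := norm_logDeriv_sub_sum_le hf h0 (R := n) (B := C * (1 + (n : ℝ)) ^ (3 / 2 : ℝ))
      (by positivity) (fun z hz => by rw [← hz]; exact hb z) (s := s) (by linarith) hfs
      ((hfin n).toFinset.map (Function.Embedding.subtype _)) (by
        intro ρ
        simp only [Finset.mem_map, Finite.mem_toFinset, Function.Embedding.subtype_apply]
        constructor
        · rintro ⟨a, ha, rfl⟩
          exact ⟨a.2, ha⟩
        · rintro ⟨h1, h2⟩
          exact ⟨⟨ρ, h1⟩, h2, rfl⟩)
    rw [norm_sub_rev]
    rw [Finset.sum_map] at h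
    refine h.trans ?_
    have hnpos : (0 : ℝ) < n := by linarith
    have hB : C * (1 + (n : ℝ)) ^ (3 / 2 : ℝ) ≤ 4 * C * (n : ℝ) ^ (3 / 2 : ℝ) := by
      have : (1 + (n : ℝ)) ^ (3 / 2 : ℝ) ≤ 4 * (n : ℝ) ^ (3 / 2 : ℝ) := by
        calc (1 + (n : ℝ)) ^ (3 / 2 : ℝ) ≤ (2 * (n : ℝ)) ^ (3 / 2 : ℝ) := by
              gcongr; linarith
          _ = 2 ^ (3 / 2 : ℝ) * (n : ℝ) ^ (3 / 2 : ℝ) := Real.mul_rpow (by norm_num) hnpos.le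
          _ ≤ 2 ^ (2 : ℝ) * (n : ℝ) ^ (3 / 2 : ℝ) := by
              gcongr
              · norm_num
              · norm_num
          _ = _ := by norm_num
      nlinarith
    have hK' : K ≤ K * (n : ℝ) ^ (3 / 2 : ℝ) :=
      le_mul_of_one_le_right (by positivity) (Real.one_le_rpow hn1 (by norm_num))
    have he : (n : ℝ) ^ (-(1 / 2) : ℝ) = (n : ℝ) ^ (3 / 2 : ℝ) / (n : ℝ) ^ 2 := by
      rw [← Real.rpow_natCast, ← Real.rpow_sub hnpos]
      norm_num
    rw [he, add_assoc, ← hK]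
    calc 256 * (C * (1 + (n : ℝ)) ^ (3 / 2 : ℝ) + K) * ‖s‖ / (n : ℝ) ^ 2
        ≤ 256 * (4 * C * (n : ℝ) ^ (3 / 2 : ℝ) + K * (n : ℝ) ^ (3 / 2 : ℝ)) * ‖s‖ / (n : ℝ) ^ 2 := by
          gcongr
      _ = _ := by ring
  rw [← tendsto_nhds_unique hlim hlim2]
  exact hsumm.hasSum

end EntireFunctions

/-! ### Growth of (s - 1)ζ(s), its zeros, and the partial fractions of ζ'/ζ. -/

section ZetaFunction

/-- The entire function `(s - 1) ζ(s)`. -/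
noncomputable def zetaEntire : ℂ → ℂ := Function.update (fun s => (s - 1) * riemannZeta s) 1 1

lemma zetaEntire_of_ne {s : ℂ} (hs : s ≠ 1) : zetaEntire s = (s - 1) * riemannZeta s := by
  simp [zetaEntire, hs]

lemma zetaEntire_eventuallyEq {s : ℂ} (hs : s ≠ 1) :
    zetaEntire =ᶠ[𝓝 s] fun s => (s - 1) * riemannZeta s := by
  filter_upwards [isOpen_ne.mem_nhds hs] with w hw using zetaEntire_of_ne hw

lemma differentiable_zetaEntire : Differentiable ℂ zetaEntire := by
  have h1 : ∀ s : ℂ, s ≠ 1 → DifferentiableAt ℂ zetaEntire s := fun s hs =>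
    DifferentiableAt.congr_of_eventuallyEq
      (by have := differentiableAt_riemannZeta hs; fun_prop) (zetaEntire_eventuallyEq hs)
  intro s
  by_cases hs : s = 1
  · subst hs
    refine (analyticAt_of_differentiable_on_punctured_nhds_of_continuousAt ?_ ?_).differentiableAt
    · filter_upwards [self_mem_nhdsWithin] with w hw using h1 w hw
    · rw [zetaEntire, continuousAt_update_same]
      exact riemannZeta_residue_one
  · exact h1 s hs

lemma zetaEntire_zero : zetaEntire 0 ≠ 0 := by
  rw [zetaEntire_of_ne (by norm_num), riemannZeta_zero]
  norm_num

lemma zetaEntire_eq_zero_iff {s : ℂ} : zetaEntire s = 0 ↔ riemannZeta s = 0 := by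
  by_cases hs : s = 1
  · subst hs
    simp [zetaEntire, riemannZeta_one_ne_zero]
  · simp [zetaEntire_of_ne hs, sub_ne_zero.2 hs]

lemma analyticOrderNatAt_zetaEntire {s : ℂ} (hs : s ≠ 1) :
    analyticOrderNatAt zetaEntire s = analyticOrderNatAt riemannZeta s := by
  have hz : AnalyticAt ℂ riemannZeta s := analyticOn_riemannZeta s hs
  have h : analyticOrderAt zetaEntire s = analyticOrderAt riemannZeta s := by
    rw [analyticOrderAt_congr (zetaEntire_eventuallyEq hs)]
    change analyticOrderAt ((fun s : ℂ => s - 1) * riemannZeta) s = _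
    rw [analyticOrderAt_mul (by fun_prop) hz,
      analyticOrderAt_eq_zero (f := fun s : ℂ => s - 1).2 (Or.inr (sub_ne_zero.2 hs)), zero_add]
  simp [analyticOrderNatAt, h]

/-- The fractional part on `(1, ∞)`, extended by zero. -/
noncomputable def fractIoi (x : ℝ) : ℂ := (Ioi (1 : ℝ)).indicator (fun x => ((Int.fract x : ℝ) : ℂ)) x

lemma measurable_fractIoi : Measurable fractIoi := by
  unfold fractIoi
  exact (Complex.measurable_ofReal.comp measurable_fract).indicator measurableSet_Ioi

lemma norm_fractIoi_le (x : ℝ) : ‖fractIoi x‖ ≤ 1 := by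
  unfold fractIoi
  by_cases hx : x ∈ Ioi (1 : ℝ)
  · rw [indicator_of_mem hx, norm_real, Real.norm_eq_abs, abs_of_nonneg (Int.fract_nonneg x)]
    exact (Int.fract_lt_one x).le
  · simp [indicator_of_notMem hx]

lemma mellin_fractIoi (s : ℂ) :
    mellin fractIoi (-s) = ∫ x in Ioi (1 : ℝ), (x : ℂ) ^ (-s - 1) * ((Int.fract x : ℝ) : ℂ) := by
  have : ∀ x : ℝ, (x : ℂ) ^ (-s - 1) • fractIoi x =
      (Ioi (1 : ℝ)).indicator (fun x : ℝ => (x : ℂ) ^ (-s - 1) * ((Int.fract x : ℝ) : ℂ)) x := by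
    intro x
    unfold fractIoi
    by_cases hx : x ∈ Ioi (1 : ℝ) <;> simp [hx]
  simp only [mellin, this]
  rw [setIntegral_indicator measurableSet_Ioi, Ioi_inter_Ioi]
  norm_num

lemma integrableOn_cpow_mul_fract {s : ℂ} (hs : 0 < s.re) :
    IntegrableOn (fun x : ℝ => (x : ℂ) ^ (-s - 1) * ((Int.fract x : ℝ) : ℂ)) (Ioi 1) := by
  refine (integrableOn_Ioi_cpow_of_lt (a := -s - 1) (by simp; linarith) zero_lt_one).mul_bdd
    (c := 1) (Complex.measurable_ofReal.comp measurable_fract).aestronglyMeasurable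
    (Eventually.of_forall fun x => ?_)
  rw [norm_real, Real.norm_eq_abs, abs_of_nonneg (Int.fract_nonneg x)]
  exact (Int.fract_lt_one x).le

lemma norm_mellin_fractIoi_le {s : ℂ} (hs : 0 < s.re) : ‖mellin fractIoi (-s)‖ ≤ 1 / s.re := by
  rw [mellin_fractIoi]
  have h1 : ‖∫ x in Ioi (1 : ℝ), (x : ℂ) ^ (-s - 1) * ((Int.fract x : ℝ) : ℂ)‖
      ≤ ∫ x in Ioi (1 : ℝ), x ^ (-s.re - 1) := by
    refine norm_integral_le_of_norm_le (integrableOn_Ioi_rpow_of_lt (by linarith) zero_lt_one) ?_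
    refine (ae_restrict_iff' measurableSet_Ioi).2 (Eventually.of_forall fun x hx => ?_)
    have hx0 : (0 : ℝ) < x := zero_lt_one.trans hx
    rw [norm_mul, norm_cpow_eq_rpow_re_of_pos hx0, norm_real, Real.norm_eq_abs,
      abs_of_nonneg (Int.fract_nonneg x)]
    simp only [sub_re, neg_re, one_re]
    exact mul_le_of_le_one_right (by positivity) (Int.fract_lt_one x).le
  refine h1.trans_eq ?_
  rw [integral_Ioi_rpow_of_lt (by linarith) zero_lt_one]
  simp

lemma differentiableAt_mellin_fractIoi {s : ℂ} (hs : 0 < s.re) :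
    DifferentiableAt ℂ (fun s => mellin fractIoi (-s)) s := by
  have : DifferentiableAt ℂ (mellin fractIoi) (-s) := by
    -- `fractIoi` is bounded at infinity, hence a = 0; it vanishes near 0, so any b below Re(-s)
    -- will do.
    refine mellin_differentiableAt_of_isBigO_rpow (a := 0) (b := -s.re - 1) ?_ ?_
      (by simpa using hs) ?_ (by simp)
    · refine LocallyIntegrable.locallyIntegrableOn ?_ _
      exact (locallyIntegrable_const (1 : ℝ)).mono measurable_fractIoi.aestronglyMeasurable
        (Eventually.of_forall fun x => by simpa using norm_fractIoi_le x)
    · refine Asymptotics.IsBigO.of_bound 1 (Eventually.of_forall fun x => ?_)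
      simpa using norm_fractIoi_le x
    · refine Asymptotics.IsBigO.of_bound 1 ?_
      filter_upwards [mem_nhdsWithin_of_mem_nhds (Iio_mem_nhds zero_lt_one)] with x hx
      have : fractIoi x = 0 := indicator_of_notMem (by simpa using (mem_Iio.1 hx).le) _
      rw [this]
      simp only [norm_zero]
      positivity
  exact this.comp s differentiableAt_id.neg

/-- Partial summation writes ζ(s) as s ∫ ⌊x⌋ x^{-s-1} dx over x > 1. Splitting ⌊x⌋ = x - {x}
isolates the pole, and the integral left over converges for Re s > 0, where the identity then
persists by analytic continuation. -/
lemma zetaEntire_eq_of_one_lt_re {s : ℂ} (hs : 1 < s.re) :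
    zetaEntire s = s - s * (s - 1) * mellin fractIoi (-s) := by
  have hs1 : s ≠ 1 := by rintro rfl; simp at hs
  have hs10 := sub_ne_zero.2 hs1
  rw [zetaEntire_of_ne hs1, ← LSeries_one_eq_riemannZeta hs,
    LSeries_eq_mul_integral' 1 zero_le_one hs (by
      simp only [Pi.one_apply, norm_one, Finset.sum_const, Nat.card_Icc, add_tsub_cancel_right,
        nsmul_eq_mul, mul_one, Real.rpow_one]
      exact Asymptotics.isBigO_refl _ _), mellin_fractIoi]
  have h1 : ∫ t in Ioi (1 : ℝ), (∑ k ∈ Finset.Icc 1 ⌊t⌋₊, (1 : ℕ → ℂ) k) * (t : ℂ) ^ (-(s + 1)) =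
      ∫ t in Ioi (1 : ℝ), ((t : ℂ) ^ (-s) - (t : ℂ) ^ (-s - 1) * ((Int.fract t : ℝ) : ℂ)) := by
    refine setIntegral_congr_fun measurableSet_Ioi fun t ht => ?_
    have ht0 : (0 : ℝ) < t := zero_lt_one.trans ht
    have ht0' : (t : ℂ) ≠ 0 := by exact_mod_cast ht0.ne'
    have hfl : ((⌊t⌋₊ : ℕ) : ℂ) = (t : ℂ) - ((Int.fract t : ℝ) : ℂ) := by
      have : ((⌊t⌋₊ : ℕ) : ℝ) = t - Int.fract t := by
        rw [Int.self_sub_fract]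
        exact natCast_floor_eq_intCast_floor ht0.le
      exact_mod_cast congrArg (fun x : ℝ => (x : ℂ)) this
    have hp : (t : ℂ) ^ (-s) = (t : ℂ) ^ (-s - 1) * t := by
      rw [cpow_sub _ _ ht0', cpow_one]
      field_simp
    simp only [Pi.one_apply, Finset.sum_const, Nat.card_Icc, add_tsub_cancel_right, nsmul_eq_mul,
      mul_one, hfl]
    rw [hp, show -(s + 1) = -s - 1 by ring]
    ring
  rw [h1, integral_sub (integrableOn_Ioi_cpow_of_lt (by simpa using hs) zero_lt_one)
    (integrableOn_cpow_mul_fract (by linarith)),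
    integral_Ioi_cpow_of_lt (by simpa using hs) zero_lt_one]
  have : -s + 1 ≠ 0 := by rw [show -s + 1 = -(s - 1) by ring]; exact neg_ne_zero.2 hs10
  simp only [ofReal_one, one_cpow]
  field_simp
  ring

lemma zetaEntire_eq_of_re_pos {s : ℂ} (hs : 0 < s.re) :
    zetaEntire s = s - s * (s - 1) * mellin fractIoi (-s) := by
  have hopen : IsOpen {s : ℂ | 0 < s.re} := isOpen_lt continuous_const continuous_re
  have hconv : Convex ℝ {s : ℂ | 0 < s.re} := convex_halfSpace_re_gt 0
  refine AnalyticOnNhd.eqOn_of_preconnected_of_eventuallyEq (U := {s : ℂ | 0 < s.re}) (z₀ := 2)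
    (f := zetaEntire) (g := fun s => s - s * (s - 1) * mellin fractIoi (-s))
    (fun z _ => differentiable_zetaEntire.analyticAt z) ?_ hconv.isPreconnected (by simp) ?_ hs
  · refine DifferentiableOn.analyticOnNhd (fun z hz => ?_) hopen
    have := differentiableAt_mellin_fractIoi hz
    exact DifferentiableAt.differentiableWithinAt (by fun_prop)
  · have : {s : ℂ | 1 < s.re} ∈ 𝓝 (2 : ℂ) :=
      (isOpen_lt continuous_const continuous_re).mem_nhds (by simp)
    filter_upwards [this] with z hz using zetaEntire_eq_of_one_lt_re hz

lemma norm_zetaEntire_le_of_half_le_re {s : ℂ} (hs : 1 / 2 ≤ s.re) :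
    ‖zetaEntire s‖ ≤ 3 * (1 + ‖s‖) ^ 2 := by
  have hs0 : 0 < s.re := by linarith
  rw [zetaEntire_eq_of_re_pos hs0]
  have h1 : ‖mellin fractIoi (-s)‖ ≤ 2 := (norm_mellin_fractIoi_le hs0).trans (by
    rw [div_le_iff₀ hs0]; linarith)
  have h2 : ‖s - 1‖ ≤ ‖s‖ + 1 := by simpa using norm_sub_le s 1
  calc ‖s - s * (s - 1) * mellin fractIoi (-s)‖ ≤ ‖s‖ + ‖s‖ * ‖s - 1‖ * ‖mellin fractIoi (-s)‖ := by
        simpa [norm_mul] using norm_sub_le s (s * (s - 1) * mellin fractIoi (-s))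
    _ ≤ ‖s‖ + ‖s‖ * (‖s‖ + 1) * 2 := by gcongr
    _ ≤ _ := by nlinarith [norm_nonneg s]

lemma norm_Gamma_le_Gamma_re {w : ℂ} (hw : 0 < w.re) : ‖Complex.Gamma w‖ ≤ Real.Gamma w.re := by
  rw [Complex.Gamma_eq_integral hw, Complex.GammaIntegral, Real.Gamma_eq_integral hw]
  refine norm_integral_le_of_norm_le (Real.GammaIntegral_convergent hw) ?_
  refine (ae_restrict_iff' measurableSet_Ioi).2 (Eventually.of_forall fun x hx => ?_)
  rw [norm_mul, norm_cpow_eq_rpow_re_of_pos hx, norm_real, Real.norm_eq_abs,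
    abs_of_pos (Real.exp_pos _)]
  simp

/-- A shift by 2 reaches [2, ∞), where Γ is monotone and comparable with a factorial. Then n! ≤ n^n
and log y ≤ 2y^{1/2}; the latter is the origin of the exponent 3/2. -/
lemma Real_Gamma_le_exp {x : ℝ} (hx : 1 / 2 ≤ x) :
    Real.Gamma x ≤ 2 * Real.exp (2 * (x + 2) ^ (3 / 2 : ℝ)) := by
  have hx0 : 0 < x := by linarith
  have h1 : Real.Gamma (x + 2) = (x + 1) * (x * Real.Gamma x) := by
    rw [show x + 2 = (x + 1) + 1 by ring, Real.Gamma_add_one (by linarith),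
      Real.Gamma_add_one hx0.ne']
  have hG := Real.Gamma_pos_of_pos hx0
  have h2 : Real.Gamma x ≤ 2 * Real.Gamma (x + 2) := by
    rw [h1]
    nlinarith [mul_pos hx0 hG]
  set n := ⌈x⌉₊ with hn
  have hnx : x ≤ n := Nat.le_ceil x
  have hnx' : (n : ℝ) < x + 1 := Nat.ceil_lt_add_one hx0.le
  have h3 : Real.Gamma (x + 2) ≤ Real.Gamma ((n + 1 : ℕ) + 1) :=
    Real.Gamma_strictMonoOn_Ici.monotoneOn (by simp; linarith) (by simp; linarith)
      (by push_cast; linarith)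
  rw [Real.Gamma_nat_eq_factorial] at h3
  have h4 : (((n + 1).factorial : ℕ) : ℝ) ≤ ((n + 1 : ℕ) : ℝ) ^ (n + 1) := by
    exact_mod_cast Nat.factorial_le_pow (n + 1)
  have h5 : ((n + 1 : ℕ) : ℝ) ^ (n + 1) ≤ Real.exp (2 * (x + 2) ^ (3 / 2 : ℝ)) := by
    have hy : (0 : ℝ) < ((n + 1 : ℕ) : ℝ) := by positivity
    have hyx : ((n + 1 : ℕ) : ℝ) ≤ x + 2 := by push_cast; linarith
    rw [← Real.exp_log (pow_pos hy _), Real.log_pow]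
    apply Real.exp_le_exp.2
    have hlog := Real.log_le_rpow_div hy.le (ε := 1 / 2) (by norm_num)
    calc ((n + 1 : ℕ) : ℝ) * Real.log ((n + 1 : ℕ) : ℝ)
        ≤ ((n + 1 : ℕ) : ℝ) * (((n + 1 : ℕ) : ℝ) ^ (1 / 2 : ℝ) / (1 / 2)) := by gcongr
      _ = 2 * ((n + 1 : ℕ) : ℝ) ^ (3 / 2 : ℝ) := by
          rw [show (3 / 2 : ℝ) = 1 + 1 / 2 by norm_num, Real.rpow_add hy, Real.rpow_one]
          ring
      _ ≤ _ := by gcongr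
  linarith

lemma norm_cos_le_exp_norm (z : ℂ) : ‖Complex.cos z‖ ≤ Real.exp ‖z‖ := by
  have h1 : ‖cexp (z * I)‖ ≤ Real.exp ‖z‖ := (norm_exp_le_exp_norm _).trans (by simp)
  have h2 : ‖cexp (-z * I)‖ ≤ Real.exp ‖z‖ := (norm_exp_le_exp_norm _).trans (by simp)
  rw [Complex.cos, norm_div, Complex.norm_ofNat]
  have := norm_add_le (cexp (z * I)) (cexp (-z * I))
  linarith

lemma zetaEntire_one_sub {w : ℂ} (hw : 0 < w.re) (hw1 : w ≠ 1) :
    zetaEntire (1 - w) = -w * (2 * (2 * (Real.pi : ℂ)) ^ (-w) * Complex.Gamma w *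
      Complex.cos (Real.pi * w / 2)) * (zetaEntire w / (w - 1)) := by
  have hw0 : w ≠ 0 := by rintro rfl; simp at hw
  rw [zetaEntire_of_ne (by simpa using hw0), zetaEntire_of_ne hw1, riemannZeta_one_sub _ hw1]
  · have := sub_ne_zero.2 hw1
    field_simp
    ring
  · intro n hn
    rw [hn] at hw
    simp at hw
    linarith [(Nat.cast_nonneg n : (0 : ℝ) ≤ n)]

/-- Three regions: the unit disc by compactness, Re z ≥ 1/2 by the polynomial bound, and the rest by
the functional equation with w = 1 - z, where Γ(w) dominates. Having removed the unit disc keeps |w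
- 1| > 1, so the division by w - 1 is harmless. -/
lemma exists_zetaEntire_growth :
    ∃ C : ℝ, 0 ≤ C ∧ ∀ z, ‖zetaEntire z‖ ≤ Real.exp (C * (1 + ‖z‖) ^ (3 / 2 : ℝ)) := by
  obtain ⟨A, hA⟩ := (isCompact_closedBall (0 : ℂ) 1).exists_bound_of_continuousOn
    differentiable_zetaEntire.continuous.continuousOn
  refine ⟨|A| + 100, by positivity, fun z => ?_⟩
  set X := (1 + ‖z‖) ^ (3 / 2 : ℝ) with hX
  have hz0 := norm_nonneg z
  have hXge : 1 + ‖z‖ ≤ X := by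
    calc 1 + ‖z‖ = (1 + ‖z‖) ^ (1 : ℝ) := (Real.rpow_one _).symm
      _ ≤ X := Real.rpow_le_rpow_of_exponent_le (by linarith) (by norm_num)
  have hX1 : 1 ≤ X := by linarith
  have hpoly : ∀ y : ℝ, 0 ≤ y → 3 * (1 + y) ^ 2 ≤ Real.exp (5 * (1 + y)) := by
    intro y hy
    have h1 := Real.add_one_le_exp (1 + y)
    have h2 : (3 : ℝ) ≤ Real.exp (3 * (1 + y)) := by
      have := Real.add_one_le_exp (3 * (1 + y)); linarith
    calc 3 * (1 + y) ^ 2 ≤ Real.exp (3 * (1 + y)) * Real.exp (1 + y) ^ 2 := by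
          gcongr; linarith
      _ = _ := by rw [← Real.exp_nat_mul, ← Real.exp_add]; push_cast; ring_nf
  by_cases hz1 : ‖z‖ ≤ 1
  · calc ‖zetaEntire z‖ ≤ A := hA z (by simpa using hz1)
      _ ≤ |A| := le_abs_self A
      _ ≤ Real.exp |A| := by linarith [Real.add_one_le_exp |A|]
      _ ≤ _ := Real.exp_le_exp.2 (by nlinarith [abs_nonneg A])
  push Not at hz1
  by_cases hre : 1 / 2 ≤ z.re
  · refine (norm_zetaEntire_le_of_half_le_re hre).trans ((hpoly _ hz0).trans ?_)
    exact Real.exp_le_exp.2 (by nlinarith [abs_nonneg A])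
  push Not at hre
  obtain ⟨w, rfl⟩ : ∃ w, z = 1 - w := ⟨1 - z, by ring⟩
  simp only [sub_re, one_re] at hre
  have hw : 1 / 2 ≤ w.re := by linarith
  have hw0 : 0 < w.re := by linarith
  have hw1 : 1 < ‖w - 1‖ := by rwa [norm_sub_rev]
  have hw1' : w ≠ 1 := by rintro rfl; simp at hw1; linarith
  rw [zetaEntire_one_sub hw0 hw1']
  set y := ‖1 - w‖ with hy
  have hwy : ‖w‖ ≤ 1 + y := by
    have := norm_sub_le (1 : ℂ) (1 - w)
    simpa using this
  have hG : ‖Complex.Gamma w‖ ≤ Real.exp (1 + 16 * X) := by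
    refine (norm_Gamma_le_Gamma_re hw0).trans ((Real_Gamma_le_exp hw).trans ?_)
    have h2 : (2 : ℝ) ≤ Real.exp 1 := by linarith [Real.add_one_le_exp (1 : ℝ)]
    have h3 : (w.re + 2) ^ (3 / 2 : ℝ) ≤ 8 * X := by
      calc (w.re + 2) ^ (3 / 2 : ℝ) ≤ (3 * (1 + y)) ^ (3 / 2 : ℝ) := by
            have := (re_le_norm w).trans hwy
            gcongr
            linarith
        _ = 3 ^ (3 / 2 : ℝ) * X := by rw [Real.mul_rpow (by norm_num) (by positivity)]
        _ ≤ 8 * X := by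
            gcongr
            calc (3 : ℝ) ^ (3 / 2 : ℝ) ≤ 4 ^ (3 / 2 : ℝ) := by gcongr; norm_num
              _ = 8 := by
                rw [show (4 : ℝ) = 2 ^ (2 : ℝ) by norm_num, ← Real.rpow_mul (by norm_num)]
                norm_num
    calc 2 * Real.exp (2 * (w.re + 2) ^ (3 / 2 : ℝ)) ≤ Real.exp 1 * Real.exp (16 * X) := by
          have : 2 * (w.re + 2) ^ (3 / 2 : ℝ) ≤ 16 * X := by linarith
          gcongr
      _ = _ := by rw [← Real.exp_add]
  have hpi : ‖(2 * (Real.pi : ℂ)) ^ (-w)‖ ≤ 1 := by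
    rw [show (2 * (Real.pi : ℂ)) = ((2 * Real.pi : ℝ) : ℂ) by push_cast; rfl,
      norm_cpow_eq_rpow_re_of_pos (by positivity)]
    exact Real.rpow_le_one_of_one_le_of_nonpos (by linarith [Real.pi_gt_three])
      (by simp; linarith)
  have hcos : ‖Complex.cos (Real.pi * w / 2)‖ ≤ Real.exp (2 * X) := by
    refine (norm_cos_le_exp_norm _).trans (Real.exp_le_exp.2 ?_)
    rw [norm_div, norm_mul, norm_real, Real.norm_eq_abs, abs_of_pos Real.pi_pos,
      Complex.norm_ofNat]
    nlinarith [Real.pi_le_four, norm_nonneg w, Real.pi_pos]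
  have hze : ‖zetaEntire w / (w - 1)‖ ≤ Real.exp (10 * X) := by
    rw [norm_div]
    refine (div_le_self (norm_nonneg _) hw1.le).trans
      ((norm_zetaEntire_le_of_half_le_re hw).trans ((hpoly _ (norm_nonneg w)).trans ?_))
    exact Real.exp_le_exp.2 (by linarith)
  have hwX : ‖-w‖ ≤ Real.exp X := by
    rw [norm_neg]
    linarith [Real.add_one_le_exp X]
  calc _ = ‖-w‖ * (2 * ‖(2 * (Real.pi : ℂ)) ^ (-w)‖ * ‖Complex.Gamma w‖ *
        ‖Complex.cos (Real.pi * w / 2)‖) * ‖zetaEntire w / (w - 1)‖ := by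
        simp only [norm_mul, Complex.norm_ofNat]
    _ ≤ Real.exp X * (Real.exp 1 * 1 * Real.exp (1 + 16 * X) * Real.exp (2 * X)) *
        Real.exp (10 * X) := by
        gcongr
        linarith [Real.add_one_le_exp (1 : ℝ)]
    _ = Real.exp (2 + 29 * X) := by
        rw [mul_one, ← Real.exp_add, ← Real.exp_add, ← Real.exp_add, ← Real.exp_add]
        ring_nf
    _ ≤ _ := Real.exp_le_exp.2 (by nlinarith [abs_nonneg A])

lemma re_lt_one_of_riemannZeta_eq_zero {ρ : ℂ} (h : riemannZeta ρ = 0) : ρ.re < 1 := by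
  by_contra! h1
  exact riemannZeta_ne_zero_of_one_le_re h1 h

/-- The zeros of `ζ` outside the critical strip are real and at most `-2`. -/
lemma trivial_zero {ρ : ℂ} (h : riemannZeta ρ = 0) (hre : ρ.re ≤ 0) :
    ρ = (ρ.re : ℂ) ∧ ρ.re ≤ -2 := by
  obtain ⟨w, rfl⟩ : ∃ w, ρ = 1 - w := ⟨1 - ρ, by ring⟩
  have hw : 1 ≤ w.re := by simpa using hre
  have hw0 : 0 < w.re := by linarith
  have hw1 : w ≠ 1 := by
    rintro rfl
    rw [sub_self, riemannZeta_zero] at h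
    norm_num at h
  have hne : ∀ n : ℕ, w ≠ -n := by
    intro n hn
    rw [hn] at hw0
    simp at hw0
    linarith [(Nat.cast_nonneg n : (0 : ℝ) ≤ n)]
  rw [riemannZeta_one_sub hne hw1] at h
  -- For Re w ≥ 1 every other factor of the functional equation is nonzero. So w is an odd integer,
  -- and w ≠ 1 leaves w ≥ 3.
  have hcos : Complex.cos (Real.pi * w / 2) = 0 := by
    have h1 := riemannZeta_ne_zero_of_one_le_re hw
    have h2 := Complex.Gamma_ne_zero hne
    have h3 : (2 * (Real.pi : ℂ)) ^ (-w) ≠ 0 := by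
      rw [Ne, cpow_eq_zero_iff]
      simp [Real.pi_ne_zero]
    simpa [h1, h2, h3] using h
  obtain ⟨k, hk⟩ := Complex.cos_eq_zero_iff.1 hcos
  have hpi : (Real.pi : ℂ) ≠ 0 := by exact_mod_cast Real.pi_ne_zero
  have hwk : w = 2 * k + 1 := by
    field_simp at hk
    exact hk
  have hwre : w = ((2 * k + 1 : ℤ) : ℂ) := by rw [hwk]; push_cast; rfl
  have hk1 : 1 ≤ k := by
    rw [hwre] at hw
    simp only [intCast_re] at hw
    have : 1 ≤ 2 * k + 1 := by exact_mod_cast hw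
    have hk0 : k ≠ 0 := by
      rintro rfl
      exact hw1 (by rw [hwk]; simp)
    omega
  constructor
  · rw [hwre]
    apply Complex.ext <;> simp
  · rw [hwre]
    simp only [sub_re, one_re, intCast_re]
    have : (1 : ℝ) ≤ k := by exact_mod_cast hk1
    push_cast
    linarith

lemma summable_order_riemannZeta_div_sq :
    Summable fun ρ : riemannZetaZeros =>
      (analyticOrderNatAt riemannZeta ρ : ℝ) / (1 + ‖(ρ : ℂ)‖) ^ 2 := by
  obtain ⟨C, hC, hb⟩ := exists_zetaEntire_growth
  refine ((summable_analyticOrderNatAt_div_sq differentiable_zetaEntire zetaEntire_zero hC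
    hb).subtype riemannZetaZeros).congr fun ρ => ?_
  rw [Function.comp_apply, analyticOrderNatAt_zetaEntire]
  intro h
  exact riemannZeta_one_ne_zero (h ▸ ρ.2)

/-- The partial fraction expansion of `ζ'/ζ`. -/
lemma hasSum_logDeriv_riemannZeta {s : ℂ} (hs : 1 < s.re) :
    HasSum (fun ρ : riemannZetaZeros =>
      (analyticOrderNatAt riemannZeta ρ : ℂ) * (1 / (s - (ρ : ℂ)) + 1 / (ρ : ℂ)))
      (1 / (s - 1) + deriv riemannZeta s / riemannZeta s - logDeriv zetaEntire 0) := by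
  obtain ⟨C, hC, hb⟩ := exists_zetaEntire_growth
  have hs1 : s ≠ 1 := by rintro rfl; simp at hs
  have hz : riemannZeta s ≠ 0 := riemannZeta_ne_zero_of_one_le_re hs.le
  have h := hasSum_logDeriv_of_entire differentiable_zetaEntire zetaEntire_zero hC hb
    (s := s) (by rwa [Ne, zetaEntire_eq_zero_iff])
  have hset : {z : ℂ | zetaEntire z = 0} = riemannZetaZeros := by
    ext z
    exact zetaEntire_eq_zero_iff
  rw [hset] at h
  have hlog : logDeriv zetaEntire s = 1 / (s - 1) + deriv riemannZeta s / riemannZeta s := by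
    rw [(logDeriv_congr_nhds (zetaEntire_eventuallyEq hs1)).self_of_nhds,
      logDeriv_mul (f := fun s : ℂ => s - 1) s (sub_ne_zero.2 hs1) hz (by fun_prop) (differentiableAt_riemannZeta hs1)]
    simp [logDeriv_apply]
  rw [hlog] at h
  convert! h using 3 with ρ
  rw [analyticOrderNatAt_zetaEntire]
  intro h
  exact riemannZeta_one_ne_zero (h ▸ ρ.2)

end ZetaFunction

/-! ### The explicit formula for the integrated Chebyshev function, by Mellin inversion. -/

section ChebyshevIntegral

open ArithmeticFunction (vonMangoldt)

/-- The integrated Chebyshev function `∑_{n ≤ x} Λ(n) (x - n)`. -/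
noncomputable def psiOne (x : ℝ) : ℝ :=
  ∑ n ∈ Finset.Ioc 0 ⌊x⌋₊, vonMangoldt n * (x - n)

/-- With the cut-off carried by max, the range of summation no longer depends on x, so continuity is
visible and integration can be done term by term. The term n = M may be left out because x ≤ M. -/
lemma psiOne_eq_sum_max {x : ℝ} (hx : 0 ≤ x) {M : ℕ} (hM : x ≤ M) :
    psiOne x = ∑ n ∈ Finset.range M, vonMangoldt n * max (x - n) 0 := by
  have h1 : ∀ n ∈ Finset.Ioc 0 ⌊x⌋₊,
      vonMangoldt n * (x - n) = vonMangoldt n * max (x - n) 0 := by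
    intro n hn
    have : (n : ℝ) ≤ x := (Nat.le_floor_iff hx).1 (Finset.mem_Ioc.1 hn).2
    rw [max_eq_left (by linarith)]
  rw [psiOne, Finset.sum_congr rfl h1]
  have hfl : ⌊x⌋₊ ≤ M := Nat.floor_le_of_le hM
  have e1 : ∑ n ∈ Finset.Ioc 0 ⌊x⌋₊, vonMangoldt n * max (x - n) 0
      = ∑ n ∈ Finset.range (M + 1), vonMangoldt n * max (x - n) 0 := by
    refine Finset.sum_subset ?_ ?_
    · intro n hn
      have := (Finset.mem_Ioc.1 hn).2
      exact Finset.mem_range.2 (by omega)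
    · intro n _ hn
      rcases Nat.eq_zero_or_pos n with rfl | h0
      · simp
      · have : ⌊x⌋₊ < n := by
          by_contra! h
          exact hn (Finset.mem_Ioc.2 ⟨h0, h⟩)
        have : x < n := (Nat.floor_lt hx).1 this
        rw [max_eq_right (by linarith), mul_zero]
  rw [e1, Finset.sum_range_succ, max_eq_right (by linarith), mul_zero, add_zero]

lemma hasSum_psiOne {x : ℝ} (hx : 0 ≤ x) :
    HasSum (fun n : ℕ => vonMangoldt n * max (x - n) 0) (psiOne x) := by
  obtain ⟨M, hM⟩ := exists_nat_ge x
  rw [psiOne_eq_sum_max hx hM]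
  refine hasSum_sum_of_ne_finset_zero fun n hn => ?_
  have h1 : M ≤ n := by simpa using hn
  have h2 : (M : ℝ) ≤ n := by exact_mod_cast h1
  rw [max_eq_right (by linarith), mul_zero]

lemma psiOne_nonneg {x : ℝ} (hx : 0 ≤ x) : 0 ≤ psiOne x :=
  (hasSum_psiOne hx).nonneg fun _ =>
    mul_nonneg ArithmeticFunction.vonMangoldt_nonneg (le_max_right _ _)

lemma psiOne_eq_zero {x : ℝ} (hx : x ≤ 1) : psiOne x = 0 := by
  have : ⌊x⌋₊ ≤ 1 := Nat.floor_le_of_le (by simpa using hx)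
  refine Finset.sum_eq_zero fun n hn => ?_
  have hn1 : n = 1 := by have := Finset.mem_Ioc.1 hn; omega
  simp [hn1]

lemma continuousAt_psiOne {x : ℝ} (hx : 0 < x) : ContinuousAt psiOne x := by
  obtain ⟨M, hM⟩ := exists_nat_gt x
  have : psiOne =ᶠ[𝓝 x] fun x => ∑ n ∈ Finset.range M, vonMangoldt n * max (x - n) 0 := by
    filter_upwards [Ioo_mem_nhds hx hM] with y hy using psiOne_eq_sum_max hy.1.le hy.2.le
  refine ContinuousAt.congr ?_ this.symm
  fun_prop

/-- Bounding x - n by x leaves x ψ(x), and Chebyshev's estimate applies. -/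
lemma exists_psiOne_le : ∃ K : ℝ, 0 ≤ K ∧ ∀ x : ℝ, 0 ≤ x → psiOne x ≤ K * x ^ 2 := by
  refine ⟨Real.log 4 + 4, by positivity, fun x hx => ?_⟩
  have h1 : psiOne x ≤ Chebyshev.psi x * x := by
    rw [psiOne, Chebyshev.psi, Finset.sum_mul]
    refine Finset.sum_le_sum fun n _ => ?_
    have : (0 : ℝ) ≤ n := Nat.cast_nonneg n
    exact mul_le_mul_of_nonneg_left (by linarith) ArithmeticFunction.vonMangoldt_nonneg
  have h2 := Chebyshev.psi_le_const_mul_self hx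
  nlinarith

lemma integrableOn_sub_mul_cpow {c : ℝ} (hc : 0 < c) {s : ℂ} (hs : 0 < s.re) :
    IntegrableOn (fun x : ℝ => ((x : ℂ) - c) * (x : ℂ) ^ (-s - 2)) (Ioi c) ∧
      ∫ x in Ioi c, ((x : ℂ) - c) * (x : ℂ) ^ (-s - 2) = (c : ℂ) ^ (-s) / (s * (s + 1)) := by
  have hc0 : (c : ℂ) ≠ 0 := by exact_mod_cast hc.ne'
  have i1 := integrableOn_Ioi_cpow_of_lt (a := -s - 1) (by simp; linarith) hc
  have i2 := (integrableOn_Ioi_cpow_of_lt (a := -s - 2) (by simp; linarith) hc).const_mul (c : ℂ)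
  have e : ∀ x ∈ Ioi c, (x : ℂ) ^ (-s - 1) - c * (x : ℂ) ^ (-s - 2)
      = ((x : ℂ) - c) * (x : ℂ) ^ (-s - 2) := by
    intro x hx
    have hx0 : (x : ℂ) ≠ 0 := by exact_mod_cast (hc.trans hx).ne'
    rw [show -s - 1 = (-s - 2) + 1 by ring, cpow_add _ _ hx0, cpow_one]
    ring
  have hs0 : s ≠ 0 := by rintro rfl; simp at hs
  have hs1 : s + 1 ≠ 0 := by
    intro h
    have := congrArg Complex.re h
    simp at this
    linarith
  refine ⟨(i1.sub i2).congr_fun e measurableSet_Ioi, ?_⟩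
  rw [← setIntegral_congr_fun measurableSet_Ioi e, integral_sub i1 i2, integral_const_mul,
    integral_Ioi_cpow_of_lt (by simp; linarith) hc, integral_Ioi_cpow_of_lt (by simp; linarith) hc,
    show -s - 1 + 1 = -s by ring, show -s - 2 + 1 = -s - 1 by ring, cpow_sub _ _ hc0, cpow_one]
  have : -s - 1 ≠ 0 := by rw [show -s - 1 = -(s + 1) by ring]; exact neg_ne_zero.2 hs1
  field_simp
  ring

lemma norm_vonMangoldt_term {s : ℂ} (n : ℕ) :
    ‖LSeries.term (fun n => (vonMangoldt n : ℂ)) s n‖ = vonMangoldt n * (n : ℝ) ^ (-s.re) := by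
  rcases Nat.eq_zero_or_pos n with rfl | hn
  · simp
  · rw [LSeries.term_of_ne_zero hn.ne', norm_div, norm_real, Real.norm_eq_abs,
      abs_of_nonneg ArithmeticFunction.vonMangoldt_nonneg, norm_natCast_cpow_of_pos hn,
      Real.rpow_neg (Nat.cast_nonneg n), div_eq_mul_inv]

/-- The Mellin transform of `psiOne`. -/
lemma integral_psiOne_mul_cpow {s : ℂ} (hs : 1 < s.re) :
    ∫ x in Ioi (1 : ℝ), (psiOne x : ℂ) * (x : ℂ) ^ (-s - 2)
      = -(deriv riemannZeta s / riemannZeta s) / (s * (s + 1)) := by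
  set F : ℕ → ℝ → ℂ := fun n x =>
    (vonMangoldt n : ℂ) * (((max (x - n) 0 : ℝ) : ℂ) * (x : ℂ) ^ (-s - 2)) with hF
  have key : ∀ σ : ℂ, 0 < σ.re → ∀ n : ℕ, 0 < n →
      IntegrableOn (fun x : ℝ => ((max (x - n) 0 : ℝ) : ℂ) * (x : ℂ) ^ (-σ - 2)) (Ioi 1) ∧
      ∫ x in Ioi (1 : ℝ), ((max (x - n) 0 : ℝ) : ℂ) * (x : ℂ) ^ (-σ - 2)
        = (n : ℂ) ^ (-σ) / (σ * (σ + 1)) := by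
    intro σ hσ n hn
    have hn1 : (1 : ℝ) ≤ n := by exact_mod_cast hn
    have hsub : Ioi (n : ℝ) ⊆ Ioi 1 := Ioi_subset_Ioi hn1
    obtain ⟨hi, he⟩ := integrableOn_sub_mul_cpow (c := n) (by linarith) hσ
    have e1 : ∀ x ∈ Ioi (n : ℝ), ((x : ℂ) - (n : ℝ)) * (x : ℂ) ^ (-σ - 2)
        = ((max (x - n) 0 : ℝ) : ℂ) * (x : ℂ) ^ (-σ - 2) := by
      intro x hx
      rw [max_eq_left (by linarith [mem_Ioi.1 hx])]
      push_cast
      rfl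
    have e2 : ∀ x ∈ Ioi (1 : ℝ) \ Ioi (n : ℝ),
        ((max (x - n) 0 : ℝ) : ℂ) * (x : ℂ) ^ (-σ - 2) = 0 := by
      intro x hx
      have h1 : ¬ (n : ℝ) < x := hx.2
      rw [max_eq_right (by linarith)]
      simp
    refine ⟨IntegrableOn.of_forall_sdiff_eq_zero (hi.congr_fun e1 measurableSet_Ioi)
      measurableSet_Ioi e2, ?_⟩
    rw [setIntegral_eq_of_subset_of_forall_sdiff_eq_zero measurableSet_Ioi hsub e2,
      ← setIntegral_congr_fun measurableSet_Ioi e1, he]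
    simp
  have hs0 : 0 < s.re := by linarith
  have hFi : ∀ n, Integrable (F n) (volume.restrict (Ioi 1)) := by
    intro n
    rcases Nat.eq_zero_or_pos n with rfl | hn
    · simp [hF]
    · exact (key s hs0 n hn).1.const_mul _
  have hFn : ∀ n, ∫ x in Ioi (1 : ℝ), ‖F n x‖
      = vonMangoldt n * (n : ℝ) ^ (-s.re) * (1 / (s.re * (s.re + 1))) := by
    intro n
    rcases Nat.eq_zero_or_pos n with rfl | hn
    · simp [hF]
    -- The norm of the n-th integrand is the integrand at the real point Re s, so the same formula
    -- evaluates its integral.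
    · have e := (key (s.re : ℂ) (by simpa using hs0) n hn).2
      have e2 : ∫ x in Ioi (1 : ℝ), ((max (x - n) 0 : ℝ) : ℂ) * (x : ℂ) ^ (-(s.re : ℂ) - 2)
          = ((∫ x in Ioi (1 : ℝ), max (x - n) 0 * x ^ (-s.re - 2) : ℝ) : ℂ) := by
        rw [← integral_complex_ofReal]
        refine setIntegral_congr_fun measurableSet_Ioi fun x hx => ?_
        have hx0 : (0 : ℝ) ≤ x := zero_le_one.trans (mem_Ioi.1 hx).le
        rw [show (-(s.re : ℂ) - 2) = ((-s.re - 2 : ℝ) : ℂ) by push_cast; ring,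
          ← ofReal_cpow hx0]
        push_cast
        rfl
      rw [e2] at e
      have e3 : (∫ x in Ioi (1 : ℝ), max (x - n) 0 * x ^ (-s.re - 2))
          = (n : ℝ) ^ (-s.re) / (s.re * (s.re + 1)) := by
        rw [← ofReal_natCast, ← ofReal_neg, ← ofReal_cpow (Nat.cast_nonneg n)] at e
        exact_mod_cast e
      calc ∫ x in Ioi (1 : ℝ), ‖F n x‖
          = ∫ x in Ioi (1 : ℝ), vonMangoldt n * (max (x - n) 0 * x ^ (-s.re - 2)) := by
            refine setIntegral_congr_fun measurableSet_Ioi fun x hx => ?_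
            have hx0 : (0 : ℝ) < x := zero_lt_one.trans (mem_Ioi.1 hx)
            simp only [hF, norm_mul, norm_real, Real.norm_eq_abs,
              abs_of_nonneg ArithmeticFunction.vonMangoldt_nonneg,
              abs_of_nonneg (le_max_right (x - (n : ℝ)) 0), norm_cpow_eq_rpow_re_of_pos hx0]
            simp
        _ = _ := by rw [integral_const_mul, e3]; ring
  have hsum : Summable fun n => ∫ x in Ioi (1 : ℝ), ‖F n x‖ := by
    simp only [hFn]
    refine Summable.mul_right _ ?_
    exact (ArithmeticFunction.LSeriesSummable_vonMangoldt hs).norm.congr norm_vonMangoldt_term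
  have h := hasSum_integral_of_summable_integral_norm hFi hsum
  have h1 : ∫ x in Ioi (1 : ℝ), ∑' n, F n x
      = ∫ x in Ioi (1 : ℝ), (psiOne x : ℂ) * (x : ℂ) ^ (-s - 2) := by
    refine setIntegral_congr_fun measurableSet_Ioi fun x hx => ?_
    have hx0 : (0 : ℝ) ≤ x := zero_le_one.trans (mem_Ioi.1 hx).le
    have h2 : HasSum (fun n : ℕ => ((vonMangoldt n * max (x - n) 0 : ℝ) : ℂ)) (psiOne x : ℂ) :=
      hasSum_ofReal.2 (hasSum_psiOne hx0)
    have h3 := (h2.mul_right ((x : ℂ) ^ (-s - 2))).tsum_eq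
    rw [← h3]
    refine tsum_congr fun n => ?_
    simp only [hF]
    push_cast
    ring
  rw [← h1, ← h.tsum_eq, neg_div', ← ArithmeticFunction.LSeries_vonMangoldt_eq_deriv_riemannZeta_div hs,
    LSeries, ← tsum_div_const]
  refine tsum_congr fun n => ?_
  rcases Nat.eq_zero_or_pos n with rfl | hn
  · simp [hF]
  · rw [LSeries.term_of_ne_zero hn.ne']
    simp only [hF]
    rw [integral_const_mul, (key s hs0 n hn).2, cpow_neg]
    ring

lemma countable_riemannZetaZeros : Countable riemannZetaZeros := by
  have : riemannZetaZeros = ⋃ n : ℕ, closedBall (0 : ℂ) n ∩ riemannZetaZeros := by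
    rw [← iUnion_inter, iUnion_closedBall_nat, univ_inter]
  have h : riemannZetaZeros.Countable := by
    rw [this]
    exact countable_iUnion fun n =>
      ((isCompact_closedBall (0 : ℂ) n).inter_riemannZetaZeros_finite).countable
  exact h.to_subtype

lemma ne_zero_of_mem_zeros (ρ : riemannZetaZeros) : (ρ : ℂ) ≠ 0 := by
  intro h
  have := mem_riemannZetaZeros.1 ρ.2
  rw [h, riemannZeta_zero] at this
  norm_num at this

lemma add_one_ne_zero_of_mem_zeros (ρ : riemannZetaZeros) : (ρ : ℂ) + 1 ≠ 0 := by
  intro h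
  have h1 : (ρ : ℂ) = -1 := eq_neg_of_add_eq_zero_left h
  have := (trivial_zero ρ.2 (by rw [h1]; simp)).2
  rw [h1] at this
  norm_num at this

/-- The multiplicity of a zero `ρ` divided by `ρ (ρ + 1)`. -/
noncomputable def zeroWeight (ρ : riemannZetaZeros) : ℂ :=
  (analyticOrderNatAt riemannZeta ρ : ℂ) / ((ρ : ℂ) * (ρ + 1))

lemma summable_norm_zeroWeight : Summable fun ρ => ‖zeroWeight ρ‖ := by
  refine Summable.of_norm_bounded_eventually (summable_order_riemannZeta_div_sq.mul_left 8) ?_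
  have hfin : {ρ : riemannZetaZeros | ‖(ρ : ℂ)‖ ≤ 2}.Finite := by
    refine Set.Finite.of_finite_image
      (((isCompact_closedBall (0 : ℂ) 2).inter_riemannZetaZeros_finite).subset ?_)
      Subtype.val_injective.injOn
    rintro _ ⟨ρ, hρ, rfl⟩
    exact ⟨by simpa using hρ, ρ.2⟩
  filter_upwards [hfin.compl_mem_cofinite] with ρ hρ
  have hρ' : 2 < ‖(ρ : ℂ)‖ := not_le.1 hρ
  have h1 : ‖(ρ : ℂ)‖ - 1 ≤ ‖(ρ : ℂ) + 1‖ := by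
    have := norm_sub_norm_le (ρ : ℂ) (-1)
    simpa using this
  rw [norm_norm, zeroWeight, norm_div, norm_mul, Complex.norm_natCast, ← mul_div_assoc,
    div_le_div_iff₀ (by nlinarith) (by positivity)]
  have h2 : (1 + ‖(ρ : ℂ)‖) ^ 2 ≤ 8 * (‖(ρ : ℂ)‖ * ‖(ρ : ℂ) + 1‖) := by nlinarith
  have h3 : (0 : ℝ) ≤ (analyticOrderNatAt riemannZeta ρ : ℝ) := Nat.cast_nonneg _
  nlinarith

lemma norm_cpow_zero_add_one_le {x : ℝ} (hx : 1 ≤ x) (ρ : riemannZetaZeros) :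
    ‖(x : ℂ) ^ ((ρ : ℂ) + 1) - 1‖ ≤ 2 * x ^ 2 := by
  have h1 : ‖(x : ℂ) ^ ((ρ : ℂ) + 1)‖ ≤ x ^ 2 := by
    rw [norm_cpow_eq_rpow_re_of_pos (by linarith), ← Real.rpow_natCast]
    have := re_lt_one_of_riemannZeta_eq_zero ρ.2
    refine Real.rpow_le_rpow_of_exponent_le hx ?_
    simp
    linarith
  have h2 := norm_sub_le ((x : ℂ) ^ ((ρ : ℂ) + 1)) 1
  rw [norm_one] at h2
  nlinarith

lemma summable_zeroWeight_mul {x : ℝ} (hx : 1 ≤ x) :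
    Summable fun ρ : riemannZetaZeros => zeroWeight ρ * ((x : ℂ) ^ ((ρ : ℂ) + 1) - 1) := by
  refine Summable.of_norm_bounded (summable_norm_zeroWeight.mul_right (2 * x ^ 2)) fun ρ => ?_
  rw [norm_mul]
  gcongr
  exact norm_cpow_zero_add_one_le hx ρ

/-- The contribution of the zeros to `psiOne`. -/
noncomputable def zeroSum (x : ℝ) : ℂ :=
  ∑' ρ : riemannZetaZeros, zeroWeight ρ * ((x : ℂ) ^ ((ρ : ℂ) + 1) - 1)

lemma norm_zeroSum_le {x : ℝ} (hx : 1 ≤ x) :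
    ‖zeroSum x‖ ≤ (∑' ρ, ‖zeroWeight ρ‖) * (2 * x ^ 2) := by
  rw [← tsum_mul_right]
  refine tsum_of_norm_bounded (summable_norm_zeroWeight.mul_right (2 * x ^ 2)).hasSum fun ρ => ?_
  rw [norm_mul]
  gcongr
  exact norm_cpow_zero_add_one_le hx ρ

lemma continuousOn_zeroSum : ContinuousOn zeroSum (Ioi 1) := by
  intro x hx
  refine ContinuousAt.continuousWithinAt ?_
  have hx1 : (1 : ℝ) < x := hx
  have : ContinuousOn zeroSum (Ioo 1 (x + 1)) := by
    refine continuousOn_tsum (u := fun ρ => ‖zeroWeight ρ‖ * (2 * (x + 1) ^ 2)) (fun ρ => ?_)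
      (summable_norm_zeroWeight.mul_right _) fun ρ y hy => ?_
    · refine ContinuousOn.mul continuousOn_const (ContinuousOn.sub ?_ continuousOn_const)
      intro y hy
      have hy0 : y ≠ 0 := by linarith [hy.1]
      exact (continuousAt_ofReal_cpow_const _ _ (Or.inr hy0)).continuousWithinAt
    · rw [norm_mul]
      have h1 := norm_cpow_zero_add_one_le hy.1.le ρ
      have h2 : y ^ 2 ≤ (x + 1) ^ 2 := by nlinarith [hy.1, hy.2]
      gcongr
      linarith
  exact this.continuousAt (Ioo_mem_nhds hx1 (by linarith))

/-- The -1 in `zeroSum` is chosen for this: x^{ρ+1} - 1 has transform (ρ+1)/((s-ρ)(s+1)), and the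
weight m(ρ)/(ρ(ρ+1)) turns it into m(ρ)(1/(s-ρ) + 1/ρ)/(s(s+1)), a term of the expansion of ζ'/ζ. On
Re s = 2 the bound O(x²) leaves the integrable majorant x^{-2}, so summation and integration
commute. -/
lemma integral_zeroSum_mul_cpow {s : ℂ} (hs : s.re = 2) :
    ∫ x in Ioi (1 : ℝ), zeroSum x * (x : ℂ) ^ (-s - 2)
      = (1 / (s - 1) + deriv riemannZeta s / riemannZeta s - logDeriv zetaEntire 0)
        / (s * (s + 1)) := by
  have := countable_riemannZetaZeros
  set F : riemannZetaZeros → ℝ → ℂ := fun ρ x =>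
    zeroWeight ρ * (((x : ℂ) ^ ((ρ : ℂ) + 1) - 1) * (x : ℂ) ^ (-s - 2)) with hF
  have e : ∀ ρ : riemannZetaZeros, ∀ x ∈ Ioi (1 : ℝ),
      (x : ℂ) ^ ((ρ : ℂ) - s - 1) - (x : ℂ) ^ (-s - 2)
        = ((x : ℂ) ^ ((ρ : ℂ) + 1) - 1) * (x : ℂ) ^ (-s - 2) := by
    intro ρ x hx
    have hx0 : (x : ℂ) ≠ 0 := by exact_mod_cast (zero_lt_one.trans (mem_Ioi.1 hx)).ne'
    rw [show (ρ : ℂ) - s - 1 = ((ρ : ℂ) + 1) + (-s - 2) by ring, cpow_add _ _ hx0]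
    ring
  have i1 : ∀ ρ : riemannZetaZeros, IntegrableOn (fun x : ℝ => (x : ℂ) ^ ((ρ : ℂ) - s - 1))
      (Ioi 1) := fun ρ => by
    have := re_lt_one_of_riemannZeta_eq_zero ρ.2
    exact integrableOn_Ioi_cpow_of_lt (by simp; linarith) zero_lt_one
  have i2 : IntegrableOn (fun x : ℝ => (x : ℂ) ^ (-s - 2)) (Ioi 1) :=
    integrableOn_Ioi_cpow_of_lt (by simp; linarith) zero_lt_one
  have hFi : ∀ ρ, Integrable (F ρ) (volume.restrict (Ioi 1)) := fun ρ =>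
    Integrable.const_mul (IntegrableOn.congr_fun ((i1 ρ).sub i2) (e ρ) measurableSet_Ioi) _
  have i3 : IntegrableOn (fun x : ℝ => 2 * x ^ (-2 : ℝ)) (Ioi 1) :=
    (integrableOn_Ioi_rpow_of_lt (by norm_num) zero_lt_one).const_mul 2
  have hbd : ∀ ρ, ∀ x ∈ Ioi (1 : ℝ), ‖F ρ x‖ ≤ ‖zeroWeight ρ‖ * (2 * x ^ (-2 : ℝ)) := by
    intro ρ x hx
    have hx0 : (0 : ℝ) < x := zero_lt_one.trans (mem_Ioi.1 hx)
    simp only [hF, norm_mul]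
    refine mul_le_mul_of_nonneg_left ?_ (norm_nonneg _)
    rw [norm_cpow_eq_rpow_re_of_pos hx0]
    calc ‖(x : ℂ) ^ ((ρ : ℂ) + 1) - 1‖ * x ^ (-s - 2).re
        ≤ 2 * x ^ 2 * x ^ (-s - 2).re := by
          gcongr
          exact norm_cpow_zero_add_one_le (mem_Ioi.1 hx).le ρ
      _ = 2 * x ^ (-2 : ℝ) := by
          rw [mul_assoc, ← Real.rpow_natCast x 2, ← Real.rpow_add hx0,
            show ((2 : ℕ) : ℝ) + (-s - 2).re = -2 by norm_num [hs]]
  have hsum : Summable fun ρ => ∫ x in Ioi (1 : ℝ), ‖F ρ x‖ := by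
    refine Summable.of_nonneg_of_le (fun ρ => integral_nonneg fun _ => norm_nonneg _)
      (fun ρ => setIntegral_mono_on (hFi ρ).norm (i3.const_mul _) measurableSet_Ioi (hbd ρ)) ?_
    simp only [integral_const_mul]
    exact summable_norm_zeroWeight.mul_right _
  have h := hasSum_integral_of_summable_integral_norm hFi hsum
  have h1 : ∫ x in Ioi (1 : ℝ), ∑' ρ, F ρ x
      = ∫ x in Ioi (1 : ℝ), zeroSum x * (x : ℂ) ^ (-s - 2) := by
    refine setIntegral_congr_fun measurableSet_Ioi fun x hx => ?_
    simp only [hF, zeroSum, ← tsum_mul_right]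
    exact tsum_congr fun ρ => by ring
  have h2 := (hasSum_logDeriv_riemannZeta (s := s) (by linarith)).div_const (s * (s + 1))
  rw [← h1, ← h.tsum_eq, ← h2.tsum_eq]
  refine tsum_congr fun ρ => ?_
  have hρ0 := ne_zero_of_mem_zeros ρ
  have hρ1 := add_one_ne_zero_of_mem_zeros ρ
  have hρre := re_lt_one_of_riemannZeta_eq_zero ρ.2
  have hs0 : s ≠ 0 := by rintro rfl; simp at hs
  have hs1 : s + 1 ≠ 0 := fun h => by
    have := congrArg Complex.re h
    simp [hs] at this
    norm_num at this
  have hs1' : -s - 2 + 1 ≠ 0 := by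
    rw [show -s - 2 + 1 = -(s + 1) by ring]; exact neg_ne_zero.2 hs1
  have hsρ : s - ρ ≠ 0 := fun h => by
    have := congrArg Complex.re h
    simp [hs] at this
    linarith
  have hsρ' : (ρ : ℂ) - s - 1 + 1 ≠ 0 := by
    rw [show (ρ : ℂ) - s - 1 + 1 = -(s - ρ) by ring]; exact neg_ne_zero.2 hsρ
  simp only [hF]
  rw [integral_const_mul, ← setIntegral_congr_fun measurableSet_Ioi (e ρ), integral_sub (i1 ρ) i2,
    integral_Ioi_cpow_of_lt (by simp; linarith) zero_lt_one,
    integral_Ioi_cpow_of_lt (by simp; linarith) zero_lt_one]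
  simp only [ofReal_one, one_cpow, zeroWeight]
  rw [show (ρ : ℂ) - s - 1 + 1 = -(s - ρ) by ring, show -s - 2 + 1 = -(s + 1) by ring]
  field_simp
  ring

/-- The explicit formula for `psiOne`. -/
theorem psiOne_eq {x : ℝ} (hx : 1 ≤ x) :
    (psiOne x : ℂ) = ((x : ℂ) - 1) ^ 2 / 2 - logDeriv zetaEntire 0 * ((x : ℂ) - 1) - zeroSum x := by
  rcases hx.eq_or_lt with rfl | hx
  · simp [psiOne_eq_zero le_rfl, zeroSum]
  set b := logDeriv zetaEntire 0 with hb
  -- D is the difference of the two sides. Its extension E by zero has a Mellin transform, taken at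
  -- w = -s - 1 with Re s = 2.
  set D : ℝ → ℂ := fun x =>
    (psiOne x : ℂ) + (zeroSum x + (b * ((x : ℂ) - 1) - ((x : ℂ) - 1) ^ 2 / 2)) with hD
  set E : ℝ → ℂ := (Ioi (1 : ℝ)).indicator D with hE
  have hDc : ContinuousOn D (Ioi 1) := by
    refine ContinuousOn.add (fun y hy => ?_) (continuousOn_zeroSum.add (by fun_prop))
    exact (continuous_ofReal.continuousAt.comp
      (continuousAt_psiOne (zero_lt_one.trans hy))).continuousWithinAt
  have hEc : ContinuousAt E x := by
    refine ContinuousAt.congr (hDc.continuousAt (Ioi_mem_nhds hx)) ?_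
    filter_upwards [Ioi_mem_nhds hx] with y hy
    rw [hE, indicator_of_mem hy]
  obtain ⟨K, hK0, hK⟩ := exists_psiOne_le
  have hInt : ∀ g : ℝ → ℂ, ContinuousOn g (Ioi 1) → (∃ A : ℝ, ∀ y : ℝ, 1 < y → ‖g y‖ ≤ A * y ^ 2) →
      ∀ s : ℂ, s.re = 2 → IntegrableOn (fun y : ℝ => g y * (y : ℂ) ^ (-s - 2)) (Ioi 1) := by
    rintro g hg ⟨A, hA⟩ s hs
    have hm : ContinuousOn (fun y : ℝ => g y * (y : ℂ) ^ (-s - 2)) (Ioi 1) := by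
      refine hg.mul fun y hy => ?_
      exact (continuousAt_ofReal_cpow_const _ _
        (Or.inr (zero_lt_one.trans hy).ne')).continuousWithinAt
    refine Integrable.mono' ((integrableOn_Ioi_rpow_of_lt (a := -2) (by norm_num)
      zero_lt_one).const_mul A) (hm.aestronglyMeasurable measurableSet_Ioi) ?_
    refine (ae_restrict_iff' measurableSet_Ioi).2 (Eventually.of_forall fun y hy => ?_)
    have hy0 : (0 : ℝ) < y := zero_lt_one.trans hy
    rw [norm_mul, norm_cpow_eq_rpow_re_of_pos hy0]
    calc ‖g y‖ * y ^ (-s - 2).re ≤ A * y ^ 2 * y ^ (-s - 2).re := by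
          gcongr
          exact hA y hy
      _ = A * y ^ (-2 : ℝ) := by
          rw [mul_assoc, ← Real.rpow_natCast y 2, ← Real.rpow_add hy0,
            show ((2 : ℕ) : ℝ) + (-s - 2).re = -2 by norm_num [hs]]
  have c1 : ContinuousOn (fun y : ℝ => (psiOne y : ℂ)) (Ioi 1) := fun y hy =>
    (continuous_ofReal.continuousAt.comp
      (continuousAt_psiOne (zero_lt_one.trans hy))).continuousWithinAt
  have b1 : ∃ A : ℝ, ∀ y : ℝ, 1 < y → ‖(psiOne y : ℂ)‖ ≤ A * y ^ 2 := ⟨K, fun y hy => by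
    rw [norm_real, Real.norm_eq_abs, abs_of_nonneg (psiOne_nonneg (by linarith))]
    exact hK y (by linarith)⟩
  have b2 : ∃ A : ℝ, ∀ y : ℝ, 1 < y → ‖zeroSum y‖ ≤ A * y ^ 2 :=
    ⟨(∑' ρ, ‖zeroWeight ρ‖) * 2, fun y hy => (norm_zeroSum_le hy.le).trans_eq (by ring)⟩
  have b3 : ∃ A : ℝ, ∀ y : ℝ, 1 < y → ‖b * ((y : ℂ) - 1) - ((y : ℂ) - 1) ^ 2 / 2‖ ≤ A * y ^ 2 := by
    refine ⟨‖b‖ + 1, fun y hy => ?_⟩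
    have hn : ‖(y : ℂ) - 1‖ = y - 1 := by
      rw [← ofReal_one, ← ofReal_sub, norm_real, Real.norm_eq_abs, abs_of_pos (by linarith)]
    refine (norm_sub_le _ _).trans ?_
    rw [norm_mul, norm_div, norm_pow, hn, Complex.norm_ofNat, add_mul]
    have h1 : ‖b‖ * (y - 1) ≤ ‖b‖ * y ^ 2 := by
      gcongr
      nlinarith
    nlinarith
  -- Over the common denominator s(s+1), the three pieces of D contribute -ζ'/ζ, then 1/(s-1) + ζ'/ζ
  -- - b, then b - 1/(s-1), which add up to 0.
  have hmel : ∀ w : ℂ, w.re = -3 → mellin E w = 0 := by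
    intro w hw
    obtain ⟨s, rfl⟩ : ∃ s, w = -s - 1 := ⟨-w - 1, by ring⟩
    have hs : s.re = 2 := by simp at hw; linarith
    have hs0 : s ≠ 0 := by rintro rfl; simp at hs
    have hs1 : s + 1 ≠ 0 := fun h => by
      have := congrArg Complex.re h
      simp [hs] at this
      norm_num at this
    have hs1' : s - 1 ≠ 0 := fun h => by
      have := congrArg Complex.re h
      simp [hs] at this
      norm_num at this
    have e0 : mellin E (-s - 1) = ∫ y in Ioi (1 : ℝ), D y * (y : ℂ) ^ (-s - 2) := by
      have : ∀ y : ℝ, (y : ℂ) ^ (-s - 1 - 1) • E y =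
          (Ioi (1 : ℝ)).indicator (fun y : ℝ => D y * (y : ℂ) ^ (-s - 2)) y := by
        intro y
        rw [show -s - 1 - 1 = -s - 2 by ring]
        by_cases hy : y ∈ Ioi (1 : ℝ)
        · rw [hE, indicator_of_mem hy, indicator_of_mem hy, smul_eq_mul, mul_comm]
        · rw [hE, indicator_of_notMem hy, indicator_of_notMem hy, smul_zero]
      simp only [mellin, this]
      rw [setIntegral_indicator measurableSet_Ioi, Ioi_inter_Ioi]
      norm_num
    have e1 : ∫ y in Ioi (1 : ℝ), (b * ((y : ℂ) - 1) - ((y : ℂ) - 1) ^ 2 / 2) * (y : ℂ) ^ (-s - 2)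
        = (b - 1 / (s - 1)) / (s * (s + 1)) := by
      have j1 := integrableOn_Ioi_cpow_of_lt (a := -s) (by simp; linarith) zero_lt_one
      have j2 := integrableOn_Ioi_cpow_of_lt (a := -s - 1) (by simp; linarith) zero_lt_one
      have j3 := integrableOn_Ioi_cpow_of_lt (a := -s - 2) (by simp; linarith) zero_lt_one
      have ee : ∀ y ∈ Ioi (1 : ℝ), (-(1 / 2) * (y : ℂ) ^ (-s) + (b + 1) * (y : ℂ) ^ (-s - 1))
          + -(b + 1 / 2) * (y : ℂ) ^ (-s - 2)
          = (b * ((y : ℂ) - 1) - ((y : ℂ) - 1) ^ 2 / 2) * (y : ℂ) ^ (-s - 2) := by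
        intro y hy
        have hy0 : (y : ℂ) ≠ 0 := by exact_mod_cast (zero_lt_one.trans (mem_Ioi.1 hy)).ne'
        have h1 : (y : ℂ) ^ (-s - 1) = (y : ℂ) ^ (-s - 2) * y := by
          rw [show -s - 1 = (-s - 2) + 1 by ring, cpow_add _ _ hy0, cpow_one]
        have h2 : (y : ℂ) ^ (-s) = (y : ℂ) ^ (-s - 2) * y ^ 2 := by
          rw [show (y : ℂ) ^ (-s) = (y : ℂ) ^ ((-s - 2) + 2) by ring_nf, cpow_add _ _ hy0,
            cpow_ofNat]
        rw [h1, h2]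
        ring
      have i12 : IntegrableOn (fun y : ℝ => -(1 / 2) * (y : ℂ) ^ (-s) + (b + 1) * (y : ℂ) ^ (-s - 1))
          (Ioi 1) := (j1.const_mul _).add (j2.const_mul _)
      rw [← setIntegral_congr_fun measurableSet_Ioi ee, integral_add i12 (j3.const_mul _),
        integral_add (j1.const_mul _) (j2.const_mul _), integral_const_mul, integral_const_mul,
        integral_const_mul, integral_Ioi_cpow_of_lt (by simp; linarith) zero_lt_one,
        integral_Ioi_cpow_of_lt (by simp; linarith) zero_lt_one,
        integral_Ioi_cpow_of_lt (by simp; linarith) zero_lt_one]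
      simp only [ofReal_one, one_cpow]
      rw [show -s + 1 = -(s - 1) by ring, show -s - 1 + 1 = -s by ring,
        show -s - 2 + 1 = -(s + 1) by ring]
      field_simp
      ring
    have i1 := hInt _ c1 b1 s hs
    have i2 := hInt _ continuousOn_zeroSum b2 s hs
    have i3 := hInt _ (by fun_prop) b3 s hs
    have i23 : IntegrableOn (fun y : ℝ => zeroSum y * (y : ℂ) ^ (-s - 2) +
        (b * ((y : ℂ) - 1) - ((y : ℂ) - 1) ^ 2 / 2) * (y : ℂ) ^ (-s - 2)) (Ioi 1) := i2.add i3
    rw [e0]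
    simp only [hD, add_mul]
    rw [integral_add i1 i23, integral_add i2 i3, e1, integral_psiOne_mul_cpow (by linarith),
      integral_zeroSum_mul_cpow hs, ← hb]
    ring
  have hconv : MellinConvergent E ((-3 : ℝ) : ℂ) := by
    have h1 : IntegrableOn (fun y : ℝ => D y * (y : ℂ) ^ (-(2 : ℂ) - 2)) (Ioi 1) := by
      have i1 := hInt _ c1 b1 2 (by simp)
      have i2 := hInt _ continuousOn_zeroSum b2 2 (by simp)
      have i3 := hInt _ (by fun_prop) b3 2 (by simp)
      refine (i1.add (i2.add i3)).congr_fun (fun y _ => ?_) measurableSet_Ioi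
      simp only [hD, Pi.add_apply]
      ring
    rw [MellinConvergent]
    have h2 : ∀ y : ℝ, (y : ℂ) ^ (((-3 : ℝ) : ℂ) - 1) • E y =
        (Ioi (1 : ℝ)).indicator (fun y : ℝ => D y * (y : ℂ) ^ (-(2 : ℂ) - 2)) y := by
      intro y
      rw [show ((-3 : ℝ) : ℂ) - 1 = -(2 : ℂ) - 2 by push_cast; ring]
      by_cases hy : y ∈ Ioi (1 : ℝ)
      · rw [hE, indicator_of_mem hy, indicator_of_mem hy, smul_eq_mul, mul_comm]
      · rw [hE, indicator_of_notMem hy, indicator_of_notMem hy, smul_zero]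
    simp only [h2]
    rw [← integrable_indicator_iff measurableSet_Ioi] at h1
    exact h1.integrableOn
  have hzero : ∀ y : ℝ, mellin E (((-3 : ℝ) : ℂ) + y * I) = 0 := fun y => hmel _ (by simp)
  -- A transform that vanishes on the line is trivially integrable there, so inversion at the
  -- continuity point x gives E x = 0.
  have h := mellinInv_mellin_eq (-3) E (zero_lt_one.trans hx) hconv (by
    simp only [VerticalIntegrable, hzero]
    exact integrable_zero _ _ _) hEc
  rw [mellinInv] at h
  simp only [hzero, smul_zero, integral_zero] at h
  rw [hE, indicator_of_mem (mem_Ioi.2 hx), hD] at h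
  dsimp only at h
  linear_combination -h

end ChebyshevIntegral

/-! ### The explicit formula for Riesz means of order k > 1. -/

section RieszMeans

open ArithmeticFunction (vonMangoldt)

lemma zetaZeros_subset : zetaZeros ⊆ riemannZetaZeros := fun _ h => h.1

lemma injective_inclusion_zetaZeros : Function.Injective (inclusion zetaZeros_subset) :=
  inclusion_injective _

lemma countable_zetaZeros : Countable zetaZeros :=
  have := countable_riemannZetaZeros
  injective_inclusion_zetaZeros.countable

/-- The weight `m(ρ) / (ρ (ρ + 1))` of a non-trivial zero. -/
noncomputable def ntWeight (ρ : zetaZeros) : ℂ := zeroWeight (inclusion zetaZeros_subset ρ)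

lemma summable_norm_ntWeight : Summable fun ρ => ‖ntWeight ρ‖ :=
  summable_norm_zeroWeight.comp_injective injective_inclusion_zetaZeros

lemma norm_cpow_nontrivial_le {t : ℝ} (ht : 0 < t) (ρ : zetaZeros) :
    ‖(t : ℂ) ^ ((ρ : ℂ) + 1)‖ ≤ 1 + t ^ 2 := by
  rw [norm_cpow_eq_rpow_re_of_pos ht]
  have h0 := ρ.2.2.1
  have h1 := ρ.2.2.2
  simp only [add_re, one_re]
  rcases le_total t 1 with h | h
  · have := Real.rpow_le_one ht.le h (z := (ρ : ℂ).re + 1) (by linarith)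
    nlinarith
  · have : t ^ ((ρ : ℂ).re + 1) ≤ t ^ (2 : ℝ) :=
      Real.rpow_le_rpow_of_exponent_le h (by linarith)
    rw [Real.rpow_two] at this
    linarith

/-- The contribution of the non-trivial zeros to `psiOne`. -/
noncomputable def ntSum (t : ℝ) : ℂ := ∑' ρ : zetaZeros, ntWeight ρ * (t : ℂ) ^ ((ρ : ℂ) + 1)

lemma summable_ntSum {t : ℝ} (ht : 0 < t) :
    Summable fun ρ : zetaZeros => ntWeight ρ * (t : ℂ) ^ ((ρ : ℂ) + 1) := by
  refine Summable.of_norm_bounded (summable_norm_ntWeight.mul_right (1 + t ^ 2)) fun ρ => ?_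
  rw [norm_mul]
  gcongr
  exact norm_cpow_nontrivial_le ht ρ

/-- A non-trivial zero contributes only the constant -1 of `zeroSum` to the difference. A trivial
zero has ρ + 1 ≤ -1, so its power of t stays bounded for t ≥ 1. -/
lemma norm_ntSum_sub_zeroSum_le {t : ℝ} (ht : 1 ≤ t) :
    ‖ntSum t - zeroSum t‖ ≤ 2 * ∑' ρ, ‖zeroWeight ρ‖ := by
  classical
  have ht0 : 0 < t := by linarith
  set h : riemannZetaZeros → ℂ := fun ρ =>
    if 0 < (ρ : ℂ).re then zeroWeight ρ * (t : ℂ) ^ ((ρ : ℂ) + 1) else 0 with hh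
  have hsupp : Function.support h ⊆ range (inclusion zetaZeros_subset) := by
    intro ρ hρ
    have h0 : 0 < (ρ : ℂ).re := by
      by_contra hc
      exact hρ (by simp [hh, hc])
    exact ⟨⟨ρ, mem_riemannZetaZeros.1 ρ.2, h0, re_lt_one_of_riemannZeta_eq_zero ρ.2⟩, rfl⟩
  have hcomp : (fun ρ : zetaZeros => ntWeight ρ * (t : ℂ) ^ ((ρ : ℂ) + 1))
      = h ∘ inclusion zetaZeros_subset := by
    funext ρ
    have : 0 < (ρ : ℂ).re := ρ.2.2.1
    simp [hh, this, ntWeight]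
  have e1 : ntSum t = ∑' ρ, h ρ := by
    rw [ntSum, hcomp]
    exact injective_inclusion_zetaZeros.tsum_eq hsupp
  have hsum : Summable h := by
    rw [← injective_inclusion_zetaZeros.summable_iff
      (fun x hx => Function.notMem_support.1 fun hs => hx (hsupp hs)), ← hcomp]
    exact summable_ntSum ht0
  rw [e1, zeroSum, ← hsum.tsum_sub (summable_zeroWeight_mul ht), ← tsum_mul_left]
  refine tsum_of_norm_bounded (summable_norm_zeroWeight.mul_left 2).hasSum fun ρ => ?_
  by_cases hρ : 0 < (ρ : ℂ).re
  · have : h ρ - zeroWeight ρ * ((t : ℂ) ^ ((ρ : ℂ) + 1) - 1) = zeroWeight ρ := by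
      simp only [hh, hρ, if_true]
      ring
    rw [this]
    linarith [norm_nonneg (zeroWeight ρ)]
  · simp only [hh, hρ, if_false, zero_sub, norm_neg, norm_mul]
    have h2 := (trivial_zero ρ.2 (not_lt.1 hρ)).2
    have h1 : ‖(t : ℂ) ^ ((ρ : ℂ) + 1)‖ ≤ 1 := by
      rw [norm_cpow_eq_rpow_re_of_pos ht0]
      exact Real.rpow_le_one_of_one_le_of_nonpos ht (by simp; linarith)
    have h3 : ‖(t : ℂ) ^ ((ρ : ℂ) + 1) - 1‖ ≤ 2 := by
      refine (norm_sub_le _ _).trans ?_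
      rw [norm_one]
      linarith
    nlinarith [norm_nonneg (zeroWeight ρ)]

/-- The smooth explicit formula with the trivial zeros absorbed in the error term. -/
lemma exists_psiOne_error : ∃ C : ℝ, 0 ≤ C ∧ ∀ t : ℝ, 0 < t →
    ‖(psiOne t : ℂ) - (t : ℂ) ^ 2 / 2 + ntSum t‖ ≤ C * (1 + t) := by
  set b := logDeriv zetaEntire 0
  set S := ∑' ρ, ‖zeroWeight ρ‖
  set S' := ∑' ρ, ‖ntWeight ρ‖
  have hS : 0 ≤ S := tsum_nonneg fun _ => norm_nonneg _
  have hS' : 0 ≤ S' := tsum_nonneg fun _ => norm_nonneg _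
  refine ⟨2 * S + 2 * S' + 2 + ‖b‖, by positivity, fun t ht => ?_⟩
  rcases le_total t 1 with h | h
  -- On (0, 1] the function `psiOne` vanishes and the other terms are bounded. This range is needed
  -- because the integrals for Riesz means start at 0.
  · have h1 : ‖ntSum t‖ ≤ S' * 2 := by
      rw [← tsum_mul_right]
      refine tsum_of_norm_bounded (summable_norm_ntWeight.mul_right 2).hasSum fun ρ => ?_
      rw [norm_mul]
      gcongr
      refine (norm_cpow_nontrivial_le ht ρ).trans ?_
      nlinarith
    have h2 : ‖(t : ℂ) ^ 2 / 2‖ ≤ 1 := by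
      rw [norm_div, norm_pow, norm_real, Real.norm_eq_abs, abs_of_pos ht, Complex.norm_ofNat]
      nlinarith
    rw [psiOne_eq_zero h, ofReal_zero, zero_sub]
    have h3 := norm_add_le (-((t : ℂ) ^ 2 / 2)) (ntSum t)
    rw [norm_neg] at h3
    have := norm_nonneg b
    nlinarith
  · have h1 := norm_ntSum_sub_zeroSum_le h
    have e : (psiOne t : ℂ) - (t : ℂ) ^ 2 / 2 + ntSum t
        = (ntSum t - zeroSum t) + (1 / 2 - (t : ℂ)) - b * ((t : ℂ) - 1) := by
      rw [psiOne_eq h]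
      ring
    have h2 : ‖(1 / 2 : ℂ) - t‖ ≤ 1 + t := by
      refine (norm_sub_le _ _).trans ?_
      rw [norm_real, Real.norm_eq_abs, abs_of_pos ht]
      norm_num
    have h3 : ‖b * ((t : ℂ) - 1)‖ ≤ ‖b‖ * (1 + t) := by
      rw [norm_mul]
      gcongr
      refine (norm_sub_le _ _).trans ?_
      rw [norm_real, Real.norm_eq_abs, abs_of_pos ht, norm_one]
      linarith
    rw [e]
    have h4 := norm_sub_le ((ntSum t - zeroSum t) + (1 / 2 - (t : ℂ))) (b * ((t : ℂ) - 1))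
    have h5 := norm_add_le (ntSum t - zeroSum t) (1 / 2 - (t : ℂ))
    nlinarith

lemma continuousOn_ntSum : ContinuousOn ntSum (Ioi 0) := by
  intro x hx
  refine ContinuousAt.continuousWithinAt ?_
  have hx1 : (0 : ℝ) < x := hx
  have : ContinuousOn ntSum (Ioo 0 (x + 1)) := by
    refine continuousOn_tsum (u := fun ρ => ‖ntWeight ρ‖ * (1 + (x + 1) ^ 2)) (fun ρ => ?_)
      (summable_norm_ntWeight.mul_right _) fun ρ y hy => ?_
    · refine ContinuousOn.mul continuousOn_const ?_
      intro y hy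
      exact (continuousAt_ofReal_cpow_const _ _ (Or.inr hy.1.ne')).continuousWithinAt
    · rw [norm_mul]
      have h1 := norm_cpow_nontrivial_le hy.1 ρ
      have h2 : y ^ 2 ≤ (x + 1) ^ 2 := by nlinarith [hy.1, hy.2]
      gcongr
      linarith
  exact this.continuousAt (Ioo_mem_nhds hx1 (by linarith))

lemma intervalIntegrable_sub_cpow {X : ℝ} {a : ℂ} (ha : -1 < a.re) (c : ℝ) :
    IntervalIntegrable (fun t : ℝ => ((X : ℂ) - t) ^ a) volume c X := by
  have h := (intervalIntegral.intervalIntegrable_cpow' (a := X - c) (b := 0) ha).comp_sub_left X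
  simp only [sub_sub_cancel, sub_zero] at h
  simpa using h

lemma norm_sub_cpow {X t : ℝ} (ht : t < X) (a : ℂ) :
    ‖((X : ℂ) - t) ^ a‖ = (X - t) ^ a.re := by
  rw [← ofReal_sub, norm_cpow_eq_rpow_re_of_pos (by linarith)]

lemma betaIntegral_eq {s t : ℂ} (hs : 0 < s.re) (ht : 0 < t.re) :
    s.betaIntegral t = Complex.Gamma s * Complex.Gamma t / Complex.Gamma (s + t) := by
  rw [Complex.Gamma_mul_Gamma_eq_betaIntegral hs ht]
  have : Complex.Gamma (s + t) ≠ 0 := Complex.Gamma_ne_zero_of_re_pos (by simp; linarith)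
  field_simp

/-- The Riesz mean of order `k` of the von Mangoldt function. -/
noncomputable def rieszMean (k : ℝ) (X : ℕ) : ℝ :=
  ∑ n ∈ Finset.Ioc 0 X, vonMangoldt n * (((X : ℝ) - n) ^ k / Real.Gamma (k + 1))

/-- After u = t - c this is the scaled beta integral B(2, k-1), with Γ(2) = 1. -/
lemma integral_max_mul_cpow {k : ℝ} (hk : 1 < k) {c X : ℝ} (hc : 0 ≤ c) (hcX : c < X) :
    ∫ t in (0 : ℝ)..X, ((max (t - c) 0 : ℝ) : ℂ) * ((X : ℂ) - t) ^ ((k : ℂ) - 2)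
      = ((X - c : ℝ) : ℂ) ^ (k : ℂ) * (Complex.Gamma ((k : ℂ) - 1) / Complex.Gamma ((k : ℂ) + 1)) := by
  set G : ℝ → ℂ := fun t => ((max (t - c) 0 : ℝ) : ℂ) * ((X : ℂ) - t) ^ ((k : ℂ) - 2) with hG
  have hK : IntervalIntegrable G volume 0 X := by
    refine (intervalIntegrable_sub_cpow (by simp; linarith) 0).continuousOn_mul ?_
    fun_prop
  have h1 : IntervalIntegrable G volume 0 c :=
    hK.mono_set (by rw [uIcc_of_le hc, uIcc_of_le (by linarith)]; exact Icc_subset_Icc_right hcX.le)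
  have h2 : IntervalIntegrable G volume c X :=
    hK.mono_set (by
      rw [uIcc_of_le hcX.le, uIcc_of_le (by linarith)]; exact Icc_subset_Icc_left hc)
  rw [← intervalIntegral.integral_add_adjacent_intervals h1 h2]
  have e1 : ∫ t in (0 : ℝ)..c, G t = 0 := by
    rw [intervalIntegral.integral_congr (g := fun _ => (0 : ℂ))]
    · simp
    · intro t ht
      rw [uIcc_of_le hc] at ht
      simp only [hG]
      rw [max_eq_right (by linarith [ht.2])]
      simp
  have e2 : ∫ t in c..X, G t
      = ∫ u in (0 : ℝ)..(X - c), (u : ℂ) ^ ((2 : ℂ) - 1) * (((X - c : ℝ) : ℂ) - u) ^ (((k : ℂ) - 1) - 1) := by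
    have := intervalIntegral.integral_comp_sub_right (a := c) (b := X)
      (fun u : ℝ => (u : ℂ) ^ ((2 : ℂ) - 1) * (((X - c : ℝ) : ℂ) - u) ^ (((k : ℂ) - 1) - 1)) c
    rw [sub_self] at this
    rw [← this]
    refine intervalIntegral.integral_congr fun t ht => ?_
    rw [uIcc_of_le hcX.le] at ht
    simp only [hG]
    rw [max_eq_left (by linarith [ht.1]), show (2 : ℂ) - 1 = 1 by norm_num, cpow_one]
    push_cast
    ring_nf
  rw [e1, e2, zero_add, Complex.betaIntegral_scaled _ _ (by linarith : (0 : ℝ) < X - c),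
    betaIntegral_eq (by norm_num) (by simp; linarith)]
  have hG2 : Complex.Gamma 2 = 1 := by simp
  rw [hG2, one_mul, show (2 : ℂ) + ((k : ℂ) - 1) - 1 = k by ring,
    show (2 : ℂ) + ((k : ℂ) - 1) = k + 1 by ring]

/-- Up to the factor Γ(k-1), the integral is the fractional integral of order k - 1 of `psiOne`,
which is itself the Riesz mean of order 1. -/
lemma integral_psiOne_mul_sub_cpow {k : ℝ} (hk : 1 < k) (X : ℕ) (hX : 0 < X) :
    ∫ t in (0 : ℝ)..X, (psiOne t : ℂ) * (((X : ℝ) : ℂ) - t) ^ ((k : ℂ) - 2)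
      = Complex.Gamma ((k : ℂ) - 1) * rieszMean k X := by
  have hX0 : (0 : ℝ) < X := by exact_mod_cast hX
  have e1 : ∫ t in (0 : ℝ)..X, (psiOne t : ℂ) * (((X : ℝ) : ℂ) - t) ^ ((k : ℂ) - 2)
      = ∫ t in (0 : ℝ)..X, ∑ n ∈ Finset.range X, (vonMangoldt n : ℂ) *
        (((max (t - n) 0 : ℝ) : ℂ) * (((X : ℝ) : ℂ) - t) ^ ((k : ℂ) - 2)) := by
    refine intervalIntegral.integral_congr fun t ht => ?_
    rw [uIcc_of_le hX0.le] at ht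
    rw [psiOne_eq_sum_max ht.1 ht.2, ofReal_sum, Finset.sum_mul]
    refine Finset.sum_congr rfl fun n _ => ?_
    push_cast
    ring
  have hK : IntervalIntegrable (fun t : ℝ => (((X : ℝ) : ℂ) - t) ^ ((k : ℂ) - 2)) volume 0 X :=
    intervalIntegrable_sub_cpow (by simp; linarith) 0
  rw [e1, intervalIntegral.integral_finsetSum]
  · have e2 : rieszMean k X
        = ∑ n ∈ Finset.range X, vonMangoldt n * (((X : ℝ) - n) ^ k / Real.Gamma (k + 1)) := by
      have h1 : ∑ n ∈ Finset.Ioc 0 X, vonMangoldt n * (((X : ℝ) - n) ^ k / Real.Gamma (k + 1))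
          = ∑ n ∈ Finset.range (X + 1), vonMangoldt n * (((X : ℝ) - n) ^ k / Real.Gamma (k + 1)) := by
        refine Finset.sum_subset ?_ ?_
        · intro n hn
          have := (Finset.mem_Ioc.1 hn).2
          exact Finset.mem_range.2 (by omega)
        · intro n hn hn'
          have : n = 0 := by
            by_contra h
            exact hn' (Finset.mem_Ioc.2 ⟨Nat.pos_of_ne_zero h,
              Nat.lt_succ_iff.1 (Finset.mem_range.1 hn)⟩)
          simp [this]
      rw [rieszMean, h1, Finset.sum_range_succ, sub_self, Real.zero_rpow (by linarith)]
      simp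
    rw [e2, ofReal_sum, Finset.mul_sum]
    refine Finset.sum_congr rfl fun n hn => ?_
    have hnX : (n : ℝ) < X := by exact_mod_cast Finset.mem_range.1 hn
    rw [intervalIntegral.integral_const_mul, integral_max_mul_cpow hk (Nat.cast_nonneg n) hnX]
    rw [ofReal_mul, ofReal_div, ofReal_cpow (by linarith), ← Complex.Gamma_ofReal]
    push_cast
    ring
  · intro n _
    refine IntervalIntegrable.const_mul (hK.continuousOn_mul ?_) _
    fun_prop

/-- The coefficient `m(ρ) Γ(ρ) / Γ(k + 1 + ρ)` of the explicit formula. -/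
noncomputable def rieszCoeff (k : ℝ) (ρ : zetaZeros) : ℂ :=
  (zetaMult ρ : ℂ) * (Complex.Gamma ρ / Complex.Gamma ((k : ℂ) + 1 + ρ))

/-- B(ρ+2, k-1) supplies Γ(ρ+2) = ρ(ρ+1)Γ(ρ), which cancels the denominator of the weight. -/
lemma ntWeight_mul_beta {k : ℝ} (hk : 1 < k) (ρ : zetaZeros) :
    ntWeight ρ * Complex.betaIntegral ((ρ : ℂ) + 2) ((k : ℂ) - 1)
      = Complex.Gamma ((k : ℂ) - 1) * rieszCoeff k ρ := by
  have h0 : 0 < (ρ : ℂ).re := ρ.2.2.1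
  have hρ0 : (ρ : ℂ) ≠ 0 := ne_zero_of_mem_zeros (inclusion zetaZeros_subset ρ)
  have hρ1 : (ρ : ℂ) + 1 ≠ 0 := add_one_ne_zero_of_mem_zeros (inclusion zetaZeros_subset ρ)
  rw [betaIntegral_eq (by simp; linarith) (by simp; linarith), rieszCoeff, ntWeight, zeroWeight,
    show (ρ : ℂ) + 2 + ((k : ℂ) - 1) = k + 1 + ρ by ring,
    show (ρ : ℂ) + 2 = (ρ + 1) + 1 by ring, Complex.Gamma_add_one _ hρ1,
    Complex.Gamma_add_one _ hρ0]
  simp only [zetaMult]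
  field_simp

/-- Termwise integration of the contribution of the non-trivial zeros. -/
lemma hasSum_rieszCoeff {k : ℝ} (hk : 1 < k) {X : ℝ} (hX : 0 < X) :
    IntervalIntegrable (fun t : ℝ => ntSum t * ((X : ℂ) - t) ^ ((k : ℂ) - 2)) volume 0 X ∧
    HasSum (fun ρ : zetaZeros => Complex.Gamma ((k : ℂ) - 1) *
        (rieszCoeff k ρ * (X : ℂ) ^ ((k : ℂ) + ρ)))
      (∫ t in (0 : ℝ)..X, ntSum t * ((X : ℂ) - t) ^ ((k : ℂ) - 2)) := by
  have := countable_zetaZeros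
  have hK : IntervalIntegrable (fun t : ℝ => ((X : ℂ) - t) ^ ((k : ℂ) - 2)) volume 0 X :=
    intervalIntegrable_sub_cpow (by simp; linarith) 0
  have hbd : ∀ ρ : zetaZeros, ∀ t ∈ Ioc 0 X,
      ‖ntWeight ρ * (t : ℂ) ^ ((ρ : ℂ) + 1)‖ ≤ ‖ntWeight ρ‖ * (1 + X ^ 2) := by
    intro ρ t ht
    rw [norm_mul]
    have h1 := norm_cpow_nontrivial_le ht.1 ρ
    have h2 : t ^ 2 ≤ X ^ 2 := by nlinarith [ht.1, ht.2]
    gcongr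
    linarith
  constructor
  · rw [intervalIntegrable_iff_integrableOn_Ioc_of_le hX.le] at hK ⊢
    refine Integrable.bdd_mul (c := (∑' ρ, ‖ntWeight ρ‖) * (1 + X ^ 2)) hK
      ((continuousOn_ntSum.mono Ioc_subset_Ioi_self).aestronglyMeasurable measurableSet_Ioc)
      ((ae_restrict_iff' measurableSet_Ioc).2 (Eventually.of_forall fun t ht => ?_))
    rw [← tsum_mul_right]
    exact tsum_of_norm_bounded (summable_norm_ntWeight.mul_right _).hasSum fun ρ => hbd ρ t ht
  · have h := intervalIntegral.hasSum_integral_of_dominated_convergence (μ := volume) (a := 0) (b := X)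
      (F := fun (ρ : zetaZeros) (t : ℝ) =>
        ntWeight ρ * (t : ℂ) ^ ((ρ : ℂ) + 1) * ((X : ℂ) - t) ^ ((k : ℂ) - 2))
      (f := fun t : ℝ => ntSum t * ((X : ℂ) - t) ^ ((k : ℂ) - 2))
      (fun ρ t => ‖ntWeight ρ‖ * (1 + X ^ 2) * ‖((X : ℂ) - t) ^ ((k : ℂ) - 2)‖) ?_ ?_ ?_ ?_ ?_
    · refine h.congr_fun fun ρ => ?_
      have h0 : 0 < (ρ : ℂ).re := ρ.2.2.1
      rw [← mul_assoc, ← ntWeight_mul_beta hk ρ, mul_assoc, mul_comm (Complex.betaIntegral _ _),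
        show (k : ℂ) + ρ = ((ρ : ℂ) + 2) + (k - 1) - 1 by ring, ← Complex.betaIntegral_scaled _ _ hX,
        ← intervalIntegral.integral_const_mul]
      refine intervalIntegral.integral_congr fun t _ => ?_
      rw [show (ρ : ℂ) + 2 - 1 = ρ + 1 by ring, show (k : ℂ) - 1 - 1 = k - 2 by ring]
      ring
    · intro ρ
      rw [uIoc_of_le hX.le]
      refine AEStronglyMeasurable.mul (ContinuousOn.aestronglyMeasurable ?_ measurableSet_Ioc)
        ((intervalIntegrable_iff_integrableOn_Ioc_of_le hX.le).1 hK).aestronglyMeasurable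
      refine ContinuousOn.mul continuousOn_const fun t ht => ?_
      exact (continuousAt_ofReal_cpow_const _ _ (Or.inr ht.1.ne')).continuousWithinAt
    · intro ρ
      refine Eventually.of_forall fun t ht => ?_
      rw [uIoc_of_le hX.le] at ht
      rw [norm_mul]
      gcongr
      exact hbd ρ t ht
    · exact Eventually.of_forall fun t _ => (summable_norm_ntWeight.mul_right _).mul_right _
    · simp only [tsum_mul_right]
      exact hK.norm.const_mul _
    · refine Eventually.of_forall fun t ht => ?_
      rw [uIoc_of_le hX.le] at ht
      exact (summable_ntSum ht.1).hasSum.mul_right _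

/-- The termwise integration at X = 1 already contains this, so no asymptotics of Γ(ρ) along the
zeros are needed. -/
lemma summable_rieszCoeff {k : ℝ} (hk : 1 < k) : Summable (rieszCoeff k) := by
  have h := (hasSum_rieszCoeff hk zero_lt_one).2.summable
  have hG : Complex.Gamma ((k : ℂ) - 1) ≠ 0 :=
    Complex.Gamma_ne_zero_of_re_pos (by simp; linarith)
  simp only [ofReal_one, one_cpow, mul_one] at h
  exact (summable_mul_left_iff hG).1 h

/-- The explicit formula for the Riesz means of the von Mangoldt function. -/
theorem exists_rieszMean_error {k : ℝ} (hk : 1 < k) : ∃ C : ℝ, 0 ≤ C ∧ ∀ X : ℕ, 0 < X →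
    ‖(rieszMean k X : ℂ) - (X : ℂ) ^ ((k : ℂ) + 1) / Complex.Gamma ((k : ℂ) + 2)
      + ∑' ρ, rieszCoeff k ρ * (X : ℂ) ^ ((k : ℂ) + ρ)‖ ≤ C * (X : ℝ) ^ k := by
  obtain ⟨C, hC, hE⟩ := exists_psiOne_error
  set γ := Complex.Gamma ((k : ℂ) - 1) with hγ
  have hG : γ ≠ 0 := Complex.Gamma_ne_zero_of_re_pos (by simp; linarith)
  have hγ0 : 0 < ‖γ‖ := norm_pos_iff.2 hG
  have hk1 : 0 < k - 1 := by linarith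
  refine ⟨2 * C / (k - 1) / ‖γ‖, by positivity, fun X hX => ?_⟩
  have hX0 : (0 : ℝ) < X := by exact_mod_cast hX
  have hX1 : (1 : ℝ) ≤ X := by exact_mod_cast hX
  set K : ℝ → ℂ := fun t => (((X : ℝ) : ℂ) - t) ^ ((k : ℂ) - 2) with hK
  have hKi : IntervalIntegrable K volume 0 X := intervalIntegrable_sub_cpow (by simp; linarith) 0
  obtain ⟨i3, hs⟩ := hasSum_rieszCoeff hk hX0
  have i1 : IntervalIntegrable (fun t : ℝ => (psiOne t : ℂ) * K t) volume 0 X := by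
    have : IntervalIntegrable (fun t : ℝ =>
        ((∑ n ∈ Finset.range X, vonMangoldt n * max (t - n) 0 : ℝ) : ℂ) * K t) volume 0 X := by
      refine hKi.continuousOn_mul ?_
      fun_prop
    refine this.congr fun t ht => ?_
    rw [uIoc_of_le hX0.le] at ht
    rw [psiOne_eq_sum_max ht.1.le ht.2]
  have i2 : IntervalIntegrable (fun t : ℝ => (t : ℂ) ^ 2 / 2 * K t) volume 0 X :=
    hKi.continuousOn_mul (by fun_prop)
  have e2 : ∫ t in (0 : ℝ)..X, (t : ℂ) ^ 2 / 2 * K t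
      = γ * ((X : ℂ) ^ ((k : ℂ) + 1) / Complex.Gamma ((k : ℂ) + 2)) := by
    have h1 := Complex.betaIntegral_scaled 3 ((k : ℂ) - 1) hX0
    rw [betaIntegral_eq (by norm_num) (by simp; linarith)] at h1
    have hG3 : Complex.Gamma 3 = 2 := by simp
    rw [hG3, show (3 : ℂ) + ((k : ℂ) - 1) - 1 = k + 1 by ring,
      show (3 : ℂ) + ((k : ℂ) - 1) = k + 2 by ring] at h1
    have h2 : ∫ t in (0 : ℝ)..X, (t : ℂ) ^ 2 / 2 * K t
        = 1 / 2 * ∫ t in (0 : ℝ)..X, (t : ℂ) ^ ((3 : ℂ) - 1) *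
          (((X : ℝ) : ℂ) - t) ^ (((k : ℂ) - 1) - 1) := by
      rw [← intervalIntegral.integral_const_mul]
      refine intervalIntegral.integral_congr fun t _ => ?_
      simp only [hK]
      rw [show (3 : ℂ) - 1 = 2 by norm_num, show (k : ℂ) - 1 - 1 = k - 2 by ring, cpow_ofNat]
      ring
    rw [h2, h1]
    push_cast
    ring
  have e3 : ∫ t in (0 : ℝ)..X, ntSum t * K t
      = γ * ∑' ρ, rieszCoeff k ρ * (X : ℂ) ^ ((k : ℂ) + ρ) := by
    rw [← hs.tsum_eq, tsum_mul_left, hγ]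
    simp only [ofReal_natCast]
  have e : γ * ((rieszMean k X : ℂ) - (X : ℂ) ^ ((k : ℂ) + 1) / Complex.Gamma ((k : ℂ) + 2)
      + ∑' ρ, rieszCoeff k ρ * (X : ℂ) ^ ((k : ℂ) + ρ))
      = ∫ t in (0 : ℝ)..X, ((psiOne t : ℂ) - (t : ℂ) ^ 2 / 2 + ntSum t) * K t := by
    simp only [add_mul, sub_mul]
    rw [intervalIntegral.integral_add (i1.sub i2) i3, intervalIntegral.integral_sub i1 i2, e2, e3,
      integral_psiOne_mul_sub_cpow hk X hX]
    ring
  have hi : IntervalIntegrable (fun t : ℝ => C * (1 + X) * ((X : ℝ) - t) ^ (k - 2)) volume 0 X := by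
    have h := (intervalIntegral.intervalIntegrable_rpow' (a := X) (b := 0)
      (r := k - 2) (by linarith)).comp_sub_left X
    simp only [sub_self, sub_zero] at h
    exact h.const_mul _
  have hInt : ∫ t in (0 : ℝ)..X, C * (1 + X) * ((X : ℝ) - t) ^ (k - 2)
      = C * (1 + X) * ((X : ℝ) ^ (k - 1) / (k - 1)) := by
    rw [intervalIntegral.integral_const_mul,
      intervalIntegral.integral_comp_sub_left (fun u : ℝ => u ^ (k - 2)) (X : ℝ), sub_self, sub_zero,
      integral_rpow (Or.inl (by linarith)), Real.zero_rpow (by linarith),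
      show k - 2 + 1 = k - 1 by ring, sub_zero]
  have hnorm : ‖∫ t in (0 : ℝ)..X, ((psiOne t : ℂ) - (t : ℂ) ^ 2 / 2 + ntSum t) * K t‖
      ≤ C * (1 + X) * ((X : ℝ) ^ (k - 1) / (k - 1)) := by
    rw [← hInt]
    refine intervalIntegral.norm_integral_le_of_norm_le hX0.le ?_ hi
    have hne : ∀ᵐ t : ℝ, t ≠ X := by
      simp [ae_iff]
    filter_upwards [hne] with t htX ht
    have htlt : t < X := lt_of_le_of_ne ht.2 htX
    rw [norm_mul, hK]
    dsimp only
    rw [norm_sub_cpow htlt]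
    have h1 := hE t ht.1
    have h2 : C * (1 + t) ≤ C * (1 + X) := mul_le_mul_of_nonneg_left (by linarith [ht.2]) hC
    have h3 : ((k : ℂ) - 2).re = k - 2 := by simp
    rw [h3]
    have h4 : (0 : ℝ) ≤ ((X : ℝ) - t) ^ (k - 2) := Real.rpow_nonneg (by linarith) _
    exact mul_le_mul_of_nonneg_right (h1.trans h2) h4
  rw [← e, norm_mul] at hnorm
  have hpow : (X : ℝ) ^ k = X * (X : ℝ) ^ (k - 1) := by
    rw [← Real.rpow_one_add' hX0.le (by linarith), add_sub_cancel]
  have hfin : C * (1 + X) * ((X : ℝ) ^ (k - 1) / (k - 1)) ≤ 2 * C / (k - 1) * (X : ℝ) ^ k := by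
    have h5 : 0 ≤ C * ((X : ℝ) ^ (k - 1) / (k - 1)) := by positivity
    calc C * (1 + X) * ((X : ℝ) ^ (k - 1) / (k - 1))
        = C * ((X : ℝ) ^ (k - 1) / (k - 1)) * (1 + X) := by ring
      _ ≤ C * ((X : ℝ) ^ (k - 1) / (k - 1)) * (2 * X) := by
          gcongr
          linarith
      _ = _ := by rw [hpow]; ring
  rw [div_mul_eq_mul_div, le_div_iff₀ hγ0, mul_comm]
  exact hnorm.trans hfin

end RieszMeans

/-! ### Sonine's integral: Laplace inversion, decay, and Fourier transform of (1 - x²)_+^a. -/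

section Bessel

open scoped FourierTransform

lemma vline_ne_zero (t : ℝ) : 1 + (t : ℂ) * I ≠ 0 := fun h => by
  have := congrArg Complex.re h
  simp at this

lemma vline_mem_slitPlane (t : ℝ) : 1 + (t : ℂ) * I ∈ slitPlane := Or.inl (by simp)

lemma norm_vline_rpow (t x : ℝ) : ‖1 + (t : ℂ) * I‖ ^ x = (1 + t ^ 2) ^ (x / 2) := by
  have h : ‖1 + (t : ℂ) * I‖ = (1 + t ^ 2) ^ (1 / 2 : ℝ) := by
    have := Complex.norm_add_mul_I 1 t
    rw [ofReal_one] at this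
    rw [this, Real.sqrt_eq_rpow]
    norm_num
  rw [h, ← Real.rpow_mul (by positivity)]
  ring_nf

lemma norm_vline_cpow_le (t : ℝ) (w : ℂ) :
    ‖(1 + (t : ℂ) * I) ^ w‖ ≤ Real.exp (Real.pi * |w.im|) * (1 + t ^ 2) ^ (w.re / 2) := by
  rw [norm_cpow_of_ne_zero (vline_ne_zero t), norm_vline_rpow, div_eq_mul_inv, ← Real.exp_neg,
    mul_comm]
  gcongr
  have h1 : |(1 + (t : ℂ) * I).arg * w.im| ≤ Real.pi * |w.im| := by
    rw [abs_mul]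
    gcongr
    exact abs_arg_le_pi _
  linarith [neg_abs_le ((1 + (t : ℂ) * I).arg * w.im)]

lemma continuous_vline_cpow (w : ℂ) : Continuous fun t : ℝ => (1 + (t : ℂ) * I) ^ w := by
  refine continuous_iff_continuousAt.2 fun t => ?_
  exact ContinuousAt.cpow (by fun_prop) continuousAt_const (vline_mem_slitPlane t)

lemma integrable_one_add_sq_rpow {r : ℝ} (hr : r < -1) :
    Integrable fun t : ℝ => (1 + t ^ 2) ^ (r / 2) := by
  have := integrable_rpow_neg_one_add_norm_sq (E := ℝ) (μ := volume) (r := -r)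
    (by simp; linarith)
  simpa using this

lemma integrable_vline_cpow {w : ℂ} (hw : w.re < -1) :
    Integrable fun t : ℝ => (1 + (t : ℂ) * I) ^ w :=
  Integrable.mono' ((integrable_one_add_sq_rpow hw).const_mul (Real.exp (Real.pi * |w.im|)))
    (continuous_vline_cpow w).aestronglyMeasurable
    (Eventually.of_forall fun t => norm_vline_cpow_le t w)

/-- The Laplace transform of a power, for a complex frequency. -/
lemma integral_cpow_mul_exp_neg_complex {a : ℂ} (ha : 0 < a.re) {r : ℂ} (hr : 0 < r.re) :
    IntegrableOn (fun t : ℝ => (t : ℂ) ^ (a - 1) * cexp (-(r * t))) (Ioi 0) ∧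
    ∫ t in Ioi (0 : ℝ), (t : ℂ) ^ (a - 1) * cexp (-(r * t)) = r ^ (-a) * Complex.Gamma a := by
  have hcont : ∀ (b r : ℂ), ContinuousOn (fun t : ℝ => (t : ℂ) ^ b * cexp (-(r * t))) (Ioi 0) := by
    intro b r
    refine ContinuousOn.mul (fun t ht => ?_) (by fun_prop)
    exact (continuousAt_ofReal_cpow_const _ _ (Or.inr (ne_of_gt ht))).continuousWithinAt
  have hnorm : ∀ (b r : ℂ), ∀ t ∈ Ioi (0 : ℝ),
      ‖(t : ℂ) ^ b * cexp (-(r * t))‖ = t ^ b.re * Real.exp (-r.re * t) := by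
    intro b r t ht
    rw [norm_mul, norm_cpow_eq_rpow_re_of_pos ht, Complex.norm_exp]
    simp
  have hreal : ∀ (x c : ℝ), -1 < x → 0 < c →
      IntegrableOn (fun t : ℝ => t ^ x * Real.exp (-c * t)) (Ioi 0) := by
    intro x c hx hc
    simpa using integrableOn_rpow_mul_exp_neg_mul_rpow (p := 1) hx zero_lt_one hc
  have hInt : ∀ (b r : ℂ), -1 < b.re → 0 < r.re →
      IntegrableOn (fun t : ℝ => (t : ℂ) ^ b * cexp (-(r * t))) (Ioi 0) := by
    intro b r hb hr
    refine Integrable.mono' (hreal b.re r.re hb hr)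
      ((hcont b r).aestronglyMeasurable measurableSet_Ioi) ?_
    exact (ae_restrict_iff' measurableSet_Ioi).2
      (Eventually.of_forall fun t ht => (hnorm b r t ht).le)
  refine ⟨hInt _ r (by simp; linarith) hr, ?_⟩
  have hopen : IsOpen {r : ℂ | 0 < r.re} := isOpen_lt continuous_const continuous_re
  have hconv : Convex ℝ {r : ℂ | 0 < r.re} := convex_halfSpace_re_gt 0
  -- Both sides are analytic in r on the right half-plane and agree at the real points r > 0, which
  -- accumulate at 1.
  refine AnalyticOnNhd.eqOn_of_preconnected_of_frequently_eq (U := {r : ℂ | 0 < r.re}) (z₀ := 1)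
    (f := fun r : ℂ => ∫ t in Ioi (0 : ℝ), (t : ℂ) ^ (a - 1) * cexp (-(r * t)))
    (g := fun r => r ^ (-a) * Complex.Gamma a) ?_ ?_ hconv.isPreconnected (by simp) ?_ hr
  · refine DifferentiableOn.analyticOnNhd (fun z hz => ?_) hopen
    have hz0 : 0 < z.re := hz
    refine DifferentiableAt.differentiableWithinAt ?_
    have hs : {r : ℂ | z.re / 2 < r.re} ∈ 𝓝 z :=
      (isOpen_lt continuous_const continuous_re).mem_nhds (by
        change z.re / 2 < z.re
        linarith)
    refine (hasDerivAt_integral_of_dominated_loc_of_deriv_le (μ := volume.restrict (Ioi 0))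
      (F := fun (r : ℂ) (t : ℝ) => (t : ℂ) ^ (a - 1) * cexp (-(r * t)))
      (F' := fun (r : ℂ) (t : ℝ) => -((t : ℂ) ^ a * cexp (-(r * t))))
      (bound := fun t => t ^ a.re * Real.exp (-(z.re / 2) * t)) hs
      (Eventually.of_forall fun r => (hcont _ r).aestronglyMeasurable measurableSet_Ioi)
      (hInt _ z (by simp; linarith) hz0)
      ((hcont _ z).aestronglyMeasurable measurableSet_Ioi).neg ?_
      (hreal _ _ (by linarith) (by linarith)) ?_).2.differentiableAt
    · refine (ae_restrict_iff' measurableSet_Ioi).2 (Eventually.of_forall fun t ht r hr => ?_)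
      have ht0 : (0 : ℝ) < t := ht
      have hr' : z.re / 2 < r.re := hr
      rw [norm_neg, hnorm a r t ht]
      gcongr
    · refine (ae_restrict_iff' measurableSet_Ioi).2 (Eventually.of_forall fun t ht r _ => ?_)
      have ht0 : (t : ℂ) ≠ 0 := by exact_mod_cast (ne_of_gt ht)
      have h1 : HasDerivAt (fun r : ℂ => -(r * t)) (-(t : ℂ)) r := by
        simpa using (((hasDerivAt_id r).mul_const (t : ℂ)).fun_neg)
      refine (h1.cexp.const_mul ((t : ℂ) ^ (a - 1))).congr_deriv ?_
      rw [cpow_sub _ _ ht0, cpow_one]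
      field_simp
  · refine DifferentiableOn.analyticOnNhd (fun z hz => ?_) hopen
    have hz' : z ∈ slitPlane := Or.inl hz
    refine DifferentiableAt.differentiableWithinAt ?_
    exact (DifferentiableAt.cpow differentiableAt_id (differentiableAt_const _) hz').mul_const _
  · have htend : Tendsto (fun x : ℝ => (x : ℂ)) (𝓝[≠] 1) (𝓝[≠] 1) := by
      refine tendsto_nhdsWithin_of_tendsto_nhds_of_eventually_within _ ?_ ?_
      · exact (continuous_ofReal.tendsto' 1 1 (by simp)).mono_left nhdsWithin_le_nhds
      · filter_upwards [self_mem_nhdsWithin] with x hx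
        simpa using hx
    refine htend.frequently (Eventually.frequently ?_)
    filter_upwards [mem_nhdsWithin_of_mem_nhds (Ioi_mem_nhds zero_lt_one)] with x hx
    have hx0 : (0 : ℝ) < x := hx
    rw [Complex.integral_cpow_mul_exp_neg_mul_Ioi ha hx0, one_div, inv_cpow, cpow_neg]
    rw [arg_ofReal_of_nonneg hx0.le]
    exact Real.pi_ne_zero.symm

/-- The positive part of a real number raised to a complex power. -/
noncomputable def posCpow (a : ℂ) (x : ℝ) : ℂ := ((max x 0 : ℝ) : ℂ) ^ a

lemma posCpow_of_pos {a : ℂ} {x : ℝ} (hx : 0 < x) : posCpow a x = (x : ℂ) ^ a := by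
  rw [posCpow, max_eq_left hx.le]

lemma posCpow_of_nonpos {a : ℂ} (ha : 0 < a.re) {x : ℝ} (hx : x ≤ 0) : posCpow a x = 0 := by
  have : a ≠ 0 := by rintro rfl; simp at ha
  rw [posCpow, max_eq_right hx, ofReal_zero, zero_cpow this]

lemma continuous_posCpow {a : ℂ} (ha : 0 < a.re) : Continuous (posCpow a) :=
  (continuous_ofReal_cpow_const ha).comp (continuous_id.max continuous_const)

/-- Laplace inversion for powers, along the line `re s = 1`. -/
lemma integral_vline_cpow_mul_exp {w : ℂ} (hw : 1 < w.re) (y : ℝ) :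
    ∫ t : ℝ, (1 + (t : ℂ) * I) ^ (-w) * cexp ((1 + (t : ℂ) * I) * y)
      = 2 * Real.pi / Complex.Gamma w * posCpow (w - 1) y := by
  have hw1 : 0 < (w - 1).re := by simpa using hw
  have hw0 : 0 < w.re := by linarith
  -- The Fourier transform of φ at ξ is Γ(w)(1 + 2πiξ)^{-w}, integrable because Re w > 1. Fourier
  -- inversion of φ is the claim after the substitution t = 2πξ.
  set φ : ℝ → ℂ := fun x => posCpow (w - 1) x * cexp (-x) with hφ
  have hφc : Continuous φ := (continuous_posCpow hw1).mul (by fun_prop)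
  have hind : ∀ ξ : ℂ, (fun x : ℝ => cexp (-(2 * Real.pi * x * ξ) * I) * φ x) =
      (Ioi (0 : ℝ)).indicator
        (fun x : ℝ => (x : ℂ) ^ (w - 1) * cexp (-((1 + 2 * Real.pi * ξ * I) * x))) := by
    intro ξ
    funext x
    by_cases hx : x ∈ Ioi (0 : ℝ)
    · rw [indicator_of_mem hx, hφ]
      dsimp only
      rw [posCpow_of_pos hx, mul_left_comm, ← Complex.exp_add]
      ring_nf
    · rw [indicator_of_notMem hx, hφ]
      dsimp only
      rw [posCpow_of_nonpos hw1 (not_lt.1 hx)]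
      simp
  have hφi : Integrable φ := by
    have h1 := hind 0
    simp only [mul_zero, neg_zero, zero_mul, Complex.exp_zero, one_mul, add_zero] at h1
    rw [show φ = fun x => φ x from rfl, h1, integrable_indicator_iff measurableSet_Ioi]
    simpa using (integral_cpow_mul_exp_neg_complex hw0 (r := 1) (by simp)).1
  have hF : 𝓕 φ = fun ξ : ℝ => (1 + ((2 * Real.pi * ξ : ℝ) : ℂ) * I) ^ (-w) * Complex.Gamma w := by
    funext ξ
    rw [Real.fourier_real_eq_integral_exp_smul]
    have h1 : (fun v : ℝ => cexp (((-2 * Real.pi * v * ξ : ℝ) : ℂ) * I) • φ v)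
        = fun x : ℝ => cexp (-(2 * Real.pi * x * (ξ : ℂ)) * I) * φ x := by
      funext v
      rw [smul_eq_mul]
      push_cast
      ring_nf
    rw [h1, hind, integral_indicator measurableSet_Ioi,
      (integral_cpow_mul_exp_neg_complex hw0 (by simp)).2]
    push_cast
    rfl
  have hFi : Integrable (𝓕 φ) := by
    rw [hF]
    refine Integrable.mul_const ?_ _
    exact (integrable_vline_cpow (w := -w) (by simpa using hw)).comp_mul_left' (by positivity)
  have hinv := congrFun (hφc.fourierInv_fourier_eq hφi hFi) y
  rw [Real.fourierInv_eq', hF] at hinv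
  have hG : Complex.Gamma w ≠ 0 := Complex.Gamma_ne_zero_of_re_pos hw0
  set g : ℝ → ℂ := fun t => (1 + (t : ℂ) * I) ^ (-w) * cexp ((1 + (t : ℂ) * I) * y) with hg
  have h2 : ∫ ξ : ℝ, cexp (((2 * Real.pi * inner ℝ ξ y : ℝ) : ℂ) * I) •
      ((1 + ((2 * Real.pi * ξ : ℝ) : ℂ) * I) ^ (-w) * Complex.Gamma w)
      = Complex.Gamma w * cexp (-y) * ∫ ξ : ℝ, g (2 * Real.pi * ξ) := by
    rw [← integral_const_mul]
    congr 1
    funext ξ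
    simp only [hg, smul_eq_mul, RCLike.inner_apply, conj_trivial]
    have : cexp ((1 + ((2 * Real.pi * ξ : ℝ) : ℂ) * I) * y)
        = cexp y * cexp (((2 * Real.pi * (y * ξ) : ℝ) : ℂ) * I) := by
      rw [← Complex.exp_add]
      push_cast
      ring_nf
    rw [this]
    have h3 : cexp (-(y : ℂ)) * cexp y = 1 := by rw [← Complex.exp_add]; simp
    linear_combination (-(Complex.Gamma w * (1 + ((2 * Real.pi * ξ : ℝ) : ℂ) * I) ^ (-w) *
      cexp (((2 * Real.pi * (y * ξ) : ℝ) : ℂ) * I))) * h3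
  rw [h2, Measure.integral_comp_mul_left] at hinv
  have hpi : (0 : ℝ) < 2 * Real.pi := by positivity
  rw [abs_of_pos (by positivity), hφ] at hinv
  simp only [real_smul] at hinv
  have hpi' : (Real.pi : ℂ) ≠ 0 := by exact_mod_cast Real.pi_ne_zero
  have he : cexp (-(y : ℂ)) ≠ 0 := Complex.exp_ne_zero _
  push_cast at hinv
  field_simp at hinv ⊢
  linear_combination hinv

/-- The integral in Sonine's representation of the Bessel function. -/
noncomputable def sonine (ν : ℂ) (u : ℝ) : ℂ :=
  ∫ t : ℝ, (1 + (t : ℂ) * I) ^ (-ν - 1) * cexp (1 + (t : ℂ) * I) *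
    cexp (-(u : ℂ) ^ 2 / (4 * (1 + (t : ℂ) * I)))

lemma besselJ_eq_sonine (ν : ℂ) (u : ℝ) :
    besselJ ν u = ((u : ℂ) / 2) ^ ν / (2 * Real.pi) * sonine ν u := by
  rw [besselJ, integral_mul_const]
  change _ / (2 * (Real.pi : ℂ) * I) * (sonine ν u * I) = _
  have := I_ne_zero
  field_simp

lemma sonine_neg (ν : ℂ) (u : ℝ) : sonine ν (-u) = sonine ν u := by
  simp [sonine]

lemma sonine_zero {ν : ℂ} (hν : 0 < ν.re) : sonine ν 0 = 2 * Real.pi / Complex.Gamma (ν + 1) := by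
  have h := integral_vline_cpow_mul_exp (w := ν + 1) (by simpa using hν) 1
  rw [posCpow_of_pos zero_lt_one, ofReal_one, one_cpow, mul_one] at h
  rw [← h, sonine]
  congr 1
  funext t
  rw [show -(ν + 1) = -ν - 1 by ring]
  simp

lemma exp_neg_le_rpow {y p : ℝ} (hy : 0 < y) (hp : 0 ≤ p) (hp1 : p ≤ 1) :
    Real.exp (-y) ≤ y ^ (-p) := by
  rw [Real.rpow_neg hy.le, Real.exp_neg]
  have h : y ^ p ≤ Real.exp y := by
    rcases le_total y 1 with h | h
    · exact (Real.rpow_le_one hy.le h hp).trans (Real.one_le_exp hy.le)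
    · calc y ^ p ≤ y ^ (1 : ℝ) := Real.rpow_le_rpow_of_exponent_le h hp1
        _ = y := Real.rpow_one y
        _ ≤ _ := by linarith [Real.add_one_le_exp y]
  gcongr

/-- On s = 1 + it the last exponential has norm e^{-y} with y = u²/(4(1+t²)), and e^{-y} ≤ y^{-5/8}
buys the factor |u|^{-5/4} at the price (1+t²)^{5/8}. The exponent 5/4 exceeds 1, which makes the
values at integers summable, and is below 3/2 < Re ν, which keeps the integral over t convergent. -/
lemma exists_norm_sonine_le {ν : ℂ} (hν : 3 / 2 < ν.re) :
    ∃ C : ℝ, ∀ u : ℝ, u ≠ 0 → ‖sonine ν u‖ ≤ C * |u| ^ (-(5 / 4) : ℝ) := by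
  set A := Real.exp (Real.pi * |(-ν - 1).im|) with hA
  set r : ℝ := -ν.re + 1 / 4 with hr
  have hi := integrable_one_add_sq_rpow (r := r) (by linarith)
  refine ⟨A * Real.exp 1 * 4 ^ (5 / 8 : ℝ) * ∫ t : ℝ, (1 + t ^ 2) ^ (r / 2), fun u hu => ?_⟩
  have hu0 : 0 < |u| := abs_pos.2 hu
  have hbd : ∀ t : ℝ, ‖(1 + (t : ℂ) * I) ^ (-ν - 1) * cexp (1 + (t : ℂ) * I) *
      cexp (-(u : ℂ) ^ 2 / (4 * (1 + (t : ℂ) * I)))‖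
      ≤ A * Real.exp 1 * 4 ^ (5 / 8 : ℝ) * |u| ^ (-(5 / 4) : ℝ) * (1 + t ^ 2) ^ (r / 2) := by
    intro t
    have hq : (0 : ℝ) < 1 + t ^ 2 := by positivity
    have h1 := norm_vline_cpow_le t (-ν - 1)
    have h2 : ‖cexp (1 + (t : ℂ) * I)‖ = Real.exp 1 := by
      rw [Complex.norm_exp]
      simp
    have h3 : (-(u : ℂ) ^ 2 / (4 * (1 + (t : ℂ) * I))).re = -(u ^ 2 / (4 * (1 + t ^ 2))) := by
      have : -(u : ℂ) ^ 2 / (4 * (1 + (t : ℂ) * I))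
          = ((-(u ^ 2 / (4 * (1 + t ^ 2))) : ℝ) : ℂ) * (1 - (t : ℂ) * I) := by
        have hq' : (1 + (t : ℂ) ^ 2) ≠ 0 := by exact_mod_cast hq.ne'
        have hv := vline_ne_zero t
        push_cast
        field_simp
        ring_nf
        rw [I_sq]
        ring
      rw [this, re_ofReal_mul]
      simp
    have h4 : ‖cexp (-(u : ℂ) ^ 2 / (4 * (1 + (t : ℂ) * I)))‖
        ≤ 4 ^ (5 / 8 : ℝ) * |u| ^ (-(5 / 4) : ℝ) * (1 + t ^ 2) ^ (5 / 8 : ℝ) := by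
      rw [Complex.norm_exp, h3]
      refine (exp_neg_le_rpow (p := 5 / 8) (by positivity) (by norm_num) (by norm_num)).trans_eq ?_
      have hsq : (u ^ 2) ^ (-(5 / 8) : ℝ) = |u| ^ (-(5 / 4) : ℝ) := by
        rw [← sq_abs, ← Real.rpow_natCast |u| 2, ← Real.rpow_mul hu0.le]
        norm_num
      rw [Real.div_rpow (sq_nonneg u) (by positivity), hsq, Real.rpow_neg (by positivity) (5 / 8),
        Real.mul_rpow (by norm_num) hq.le, div_inv_eq_mul]
      ring
    rw [norm_mul, norm_mul, h2]
    have h5 : (1 + t ^ 2) ^ (r / 2) = (1 + t ^ 2) ^ ((-ν - 1).re / 2) * (1 + t ^ 2) ^ (5 / 8 : ℝ) := by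
      rw [← Real.rpow_add hq]
      congr 1
      simp only [sub_re, neg_re, one_re, hr]
      ring
    calc ‖(1 + (t : ℂ) * I) ^ (-ν - 1)‖ * Real.exp 1 *
          ‖cexp (-(u : ℂ) ^ 2 / (4 * (1 + (t : ℂ) * I)))‖
        ≤ A * (1 + t ^ 2) ^ ((-ν - 1).re / 2) * Real.exp 1 *
          (4 ^ (5 / 8 : ℝ) * |u| ^ (-(5 / 4) : ℝ) * (1 + t ^ 2) ^ (5 / 8 : ℝ)) := by
          gcongr
      _ = _ := by rw [h5]; ring
  refine (norm_integral_le_of_norm_le (hi.const_mul _) (Eventually.of_forall hbd)).trans_eq ?_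
  rw [integral_const_mul]
  ring

lemma pi_div_cpow_half (t : ℝ) :
    ((Real.pi : ℂ) / (1 + (t : ℂ) * I)) ^ (1 / 2 : ℂ)
      = (Real.pi : ℂ) ^ (1 / 2 : ℂ) * (1 + (t : ℂ) * I) ^ (-(1 / 2) : ℂ) := by
  have hv := vline_ne_zero t
  have harg : (1 + (t : ℂ) * I).arg ≠ Real.pi := slitPlane_arg_ne_pi (vline_mem_slitPlane t)
  have hpi : (Real.pi : ℂ) ≠ 0 := by exact_mod_cast Real.pi_ne_zero
  rw [div_eq_mul_inv, cpow_def_of_ne_zero (mul_ne_zero hpi (inv_ne_zero hv)),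
    log_ofReal_mul Real.pi_pos (inv_ne_zero hv), log_inv _ harg, cpow_def_of_ne_zero hpi,
    cpow_def_of_ne_zero hv, ← Complex.exp_add, ofReal_log Real.pi_pos.le]
  ring_nf

/-- The Fourier transform of `(1 - x²)₊ ^ a` in terms of Sonine's integral. -/
lemma integral_exp_mul_posCpow {a : ℂ} (ha : 0 < a.re) (u : ℝ) :
    ∫ x : ℝ, cexp (I * u * x) * posCpow a (1 - x ^ 2)
      = Complex.Gamma (a + 1) / (2 * (Real.pi : ℂ) ^ (1 / 2 : ℂ)) * sonine (a + 1 / 2) u := by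
  have hpi : (Real.pi : ℂ) ≠ 0 := by exact_mod_cast Real.pi_ne_zero
  have hpih : (Real.pi : ℂ) ^ (1 / 2 : ℂ) ≠ 0 := by
    rw [Ne, cpow_eq_zero_iff]
    simp [hpi]
  have hpisq : (Real.pi : ℂ) ^ (1 / 2 : ℂ) * (Real.pi : ℂ) ^ (1 / 2 : ℂ) = Real.pi := by
    rw [← cpow_add _ _ hpi]
    norm_num
  -- The Laplace inversion integrand for (1 - x²)_+^a times the oscillating factor. Integrating over
  -- t first recovers (1 - x²)_+^a; integrating over x first is a Gaussian transform, whose factor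
  -- s^{-1/2} raises the order to a + 1/2.
  set F : ℝ → ℝ → ℂ := fun t x => (1 + (t : ℂ) * I) ^ (-(a + 1)) *
    (cexp ((1 + (t : ℂ) * I) * ((1 - x ^ 2 : ℝ) : ℂ)) * cexp (I * u * x)) with hF
  -- Because Re s = 1 on the line, the norm of F splits into a power of |1 + it| and a Gaussian in
  -- x.
  have hFint : Integrable (Function.uncurry F) (volume.prod volume) := by
    have h1 := (integrable_vline_cpow (w := -(a + 1)) (by simp; linarith)).mul_prod
      (((integrable_exp_neg_mul_sq zero_lt_one).const_mul (Real.exp 1)).ofReal (𝕜 := ℂ))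
    refine h1.mono ?_ (Eventually.of_forall fun z => ?_)
    · refine Continuous.aestronglyMeasurable ?_
      simp only [hF, Function.uncurry_def]
      refine ((continuous_vline_cpow _).comp continuous_fst).mul ?_
      fun_prop
    · simp only [hF, Function.uncurry_def, norm_mul]
      refine le_of_eq ?_
      congr 1
      rw [Complex.norm_exp, Complex.norm_exp]
      have e1 : ((1 + (z.1 : ℂ) * I) * ((1 - z.2 ^ 2 : ℝ) : ℂ)).re = 1 - z.2 ^ 2 := by
        rw [re_mul_ofReal]
        simp
      have e2 : (I * u * z.2).re = 0 := by simp
      rw [e1, e2, Real.exp_zero, mul_one]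
      simp only [coe_algebraMap, norm_real, Real.norm_eq_abs]
      rw [abs_of_pos (by positivity), ← Real.exp_add]
      ring_nf
  have hswap := integral_integral_swap hFint
  have hleft : ∀ t : ℝ, ∫ x : ℝ, F t x = (Real.pi : ℂ) ^ (1 / 2 : ℂ) *
      ((1 + (t : ℂ) * I) ^ (-(a + 1 / 2) - 1) * cexp (1 + (t : ℂ) * I) *
        cexp (-(u : ℂ) ^ 2 / (4 * (1 + (t : ℂ) * I)))) := by
    intro t
    have h1 := fourierIntegral_gaussian (b := 1 + (t : ℂ) * I) (by simp) u
    rw [pi_div_cpow_half] at h1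
    have h2 : (1 + (t : ℂ) * I) ^ (-(a + 1 / 2) - 1)
        = (1 + (t : ℂ) * I) ^ (-(a + 1)) * (1 + (t : ℂ) * I) ^ (-(1 / 2) : ℂ) := by
      rw [← cpow_add _ _ (vline_ne_zero t)]
      ring_nf
    have h3 : ∀ x : ℝ, F t x = (1 + (t : ℂ) * I) ^ (-(a + 1)) * cexp (1 + (t : ℂ) * I) *
        (cexp (I * u * x) * cexp (-(1 + (t : ℂ) * I) * (x : ℂ) ^ 2)) := by
      intro x
      have : cexp ((1 + (t : ℂ) * I) * ((1 - x ^ 2 : ℝ) : ℂ))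
          = cexp (1 + (t : ℂ) * I) * cexp (-(1 + (t : ℂ) * I) * (x : ℂ) ^ 2) := by
        rw [← Complex.exp_add]
        push_cast
        ring_nf
      simp only [hF, this]
      ring
    simp only [h3]
    rw [integral_const_mul, h1, h2]
    ring
  have hright : ∀ x : ℝ, ∫ t : ℝ, F t x
      = 2 * Real.pi / Complex.Gamma (a + 1) * (cexp (I * u * x) * posCpow a (1 - x ^ 2)) := by
    intro x
    have h1 := integral_vline_cpow_mul_exp (w := a + 1) (by simpa using ha) (1 - x ^ 2)
    rw [add_sub_cancel_right] at h1
    simp only [hF, ← mul_assoc]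
    rw [integral_mul_const, h1]
    ring
  simp only [hleft, hright] at hswap
  rw [integral_const_mul, integral_const_mul] at hswap
  have hG : Complex.Gamma (a + 1) ≠ 0 := Complex.Gamma_ne_zero_of_re_pos (by simp; linarith)
  have hson : (∫ t : ℝ, (1 + (t : ℂ) * I) ^ (-(a + 1 / 2) - 1) * cexp (1 + (t : ℂ) * I) *
        cexp (-(u : ℂ) ^ 2 / (4 * (1 + (t : ℂ) * I)))) = sonine (a + 1 / 2) u := rfl
  rw [hson] at hswap
  field_simp at hswap ⊢
  rw [← mul_right_inj' hpih]
  linear_combination -hswap + 2 * (∫ x : ℝ, cexp (I * u * x) * posCpow a (1 - x ^ 2)) * hpisq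

end Bessel

/-! ### Poisson summation for (N - m²)_+^a. -/

section Poisson

open scoped FourierTransform

lemma sqrt_cpow (x : ℝ) (hx : 0 < x) (ν : ℂ) :
    ((Real.sqrt x : ℝ) : ℂ) ^ ν = (x : ℂ) ^ (ν / 2) := by
  have hs : 0 < Real.sqrt x := Real.sqrt_pos.2 hx
  have hs' : ((Real.sqrt x : ℝ) : ℂ) ≠ 0 := by exact_mod_cast hs.ne'
  conv_rhs => rw [← Real.mul_self_sqrt hx.le, ofReal_mul, mul_cpow_ofReal_nonneg hs.le hs.le,
    ← cpow_add _ _ hs', add_halves]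

/-- The denominator ℓ^ν cancels the ℓ^ν in (u/2)^ν. Hence the Bessel terms are a constant multiple
of Sonine's integral at equally spaced points, the shape in which they appear in Poisson's formula.
-/
lemma besselTerm_eq_sonine (ν : ℂ) {N : ℕ} (hN : 1 ≤ N) (ℓ : ℕ+) :
    besselTerm ν N ℓ = (Real.pi : ℂ) ^ ν * (N : ℂ) ^ (ν / 2) / (2 * Real.pi) *
      sonine ν (2 * Real.pi * ((ℓ : ℕ) : ℝ) * Real.sqrt N) := by
  have hN0 : (0 : ℝ) < N := by exact_mod_cast hN
  have hl : ((ℓ : ℕ) : ℂ) ≠ 0 := by exact_mod_cast ℓ.ne_zero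
  have hl' : ((ℓ : ℕ) : ℂ) ^ ν ≠ 0 := by simp [cpow_eq_zero_iff, hl]
  have h1 : ((2 * Real.pi * ((ℓ : ℕ) : ℝ) * Real.sqrt N : ℝ) : ℂ) / 2
      = ((Real.pi * ((ℓ : ℕ) : ℝ) : ℝ) : ℂ) * (Real.sqrt N : ℝ) := by
    push_cast
    ring
  rw [besselTerm, besselJ_eq_sonine, h1, mul_cpow_ofReal_nonneg (by positivity) (by positivity),
    sqrt_cpow _ hN0, ofReal_mul, mul_cpow_ofReal_nonneg (by positivity) (by positivity)]
  simp only [ofReal_natCast]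
  field_simp

lemma summable_sonine_int {ν : ℂ} (hν : 3 / 2 < ν.re) {c : ℝ} (hc : 0 < c) :
    Summable fun n : ℤ => sonine ν (c * n) := by
  obtain ⟨C, hC⟩ := exists_norm_sonine_le hν
  have hs := (Real.summable_abs_int_rpow (b := 5 / 4) (by norm_num)).mul_left
    (C * c ^ (-(5 / 4) : ℝ))
  refine hs.of_norm_bounded_eventually ?_
  filter_upwards [(Set.finite_singleton (0 : ℤ)).compl_mem_cofinite] with n hn
  have hn0 : (n : ℝ) ≠ 0 := by exact_mod_cast hn
  refine (hC _ (mul_ne_zero hc.ne' hn0)).trans_eq ?_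
  rw [abs_mul, abs_of_pos hc, Real.mul_rpow hc.le (abs_nonneg _), mul_assoc]

lemma summable_besselTerm {ν : ℂ} (hν : 3 / 2 < ν.re) {N : ℕ} (hN : 1 ≤ N) :
    Summable (besselTerm ν N) := by
  have hN0 : (0 : ℝ) < N := by exact_mod_cast hN
  have hs := summable_sonine_int hν (c := 2 * Real.pi * Real.sqrt N) (by positivity)
  have hinj : Function.Injective fun ℓ : ℕ+ => ((ℓ : ℕ) : ℤ) :=
    Nat.cast_injective.comp PNat.coe_injective
  refine ((hs.comp_injective hinj).mul_left
    ((Real.pi : ℂ) ^ ν * (N : ℂ) ^ (ν / 2) / (2 * Real.pi))).congr fun ℓ => ?_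
  rw [besselTerm_eq_sonine ν hN]
  simp only [Function.comp_apply, Int.cast_natCast]
  ring_nf

lemma posCpow_mul {c : ℝ} (hc : 0 < c) (a : ℂ) (x : ℝ) :
    posCpow a (c * x) = (c : ℂ) ^ a * posCpow a x := by
  have : max (c * x) 0 = c * max x 0 := by rw [mul_max_of_nonneg _ _ hc.le, mul_zero]
  rw [posCpow, posCpow, this, ofReal_mul, mul_cpow_ofReal_nonneg hc.le (le_max_right _ _)]

/-- The scaling v = √x·y reduces to the case x = 1; its Jacobian √x accounts for the extra half
power of x. -/
lemma fourier_posCpow {a : ℂ} (ha : 0 < a.re) {x : ℝ} (hx : 0 < x) (ξ : ℝ) :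
    𝓕 (fun v : ℝ => posCpow a (x - v ^ 2)) ξ
      = (x : ℂ) ^ (a + 1 / 2) * (Complex.Gamma (a + 1) / (2 * (Real.pi : ℂ) ^ (1 / 2 : ℂ))) *
        sonine (a + 1 / 2) (2 * Real.pi * Real.sqrt x * ξ) := by
  have hs : 0 < Real.sqrt x := Real.sqrt_pos.2 hx
  have hs' : ((Real.sqrt x : ℝ) : ℂ) ≠ 0 := by exact_mod_cast hs.ne'
  have hx' : (x : ℂ) ≠ 0 := by exact_mod_cast hx.ne'
  rw [Real.fourier_real_eq_integral_exp_smul]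
  set g : ℝ → ℂ := fun v => cexp (((-2 * Real.pi * v * ξ : ℝ) : ℂ) * I) • posCpow a (x - v ^ 2)
    with hg
  have h1 : ∀ y : ℝ, g (Real.sqrt x * y) = (x : ℂ) ^ a *
      (cexp (I * ((-(2 * Real.pi * Real.sqrt x * ξ) : ℝ) : ℂ) * y) * posCpow a (1 - y ^ 2)) := by
    intro y
    have : x - (Real.sqrt x * y) ^ 2 = x * (1 - y ^ 2) := by
      rw [mul_pow, Real.sq_sqrt hx.le]
      ring
    simp only [hg, smul_eq_mul, this, posCpow_mul hx]
    push_cast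
    ring_nf
  have h2 := Measure.integral_comp_mul_left g (Real.sqrt x)
  simp only [h1] at h2
  rw [integral_const_mul, integral_exp_mul_posCpow ha, sonine_neg, abs_of_pos (by positivity),
    real_smul] at h2
  have h3 : (x : ℂ) ^ (a + 1 / 2) = (x : ℂ) ^ a * (Real.sqrt x : ℝ) := by
    rw [cpow_add _ _ hx', ← sqrt_cpow x hx 1, cpow_one]
  rw [h3]
  push_cast at h2
  rw [show ∫ v : ℝ, g v = (Real.sqrt x : ℝ) * (((Real.sqrt x : ℝ) : ℂ)⁻¹ * ∫ v : ℝ, g v) by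
    rw [mul_inv_cancel_left₀ hs'], ← h2]
  ring

/-- Poisson summation for `(N - m²)₊ ^ a`. -/
lemma sum_posCpow {a : ℂ} (ha : 1 < a.re) {N : ℕ} (hN : 1 ≤ N) :
    ∑ m ∈ Finset.Icc 1 N, posCpow a ((N : ℝ) - (m : ℝ) ^ 2)
      = (Real.pi : ℂ) ^ (1 / 2 : ℂ) / 2 *
          (Complex.Gamma (a + 1) / Complex.Gamma (a + 3 / 2) * (N : ℂ) ^ (a + 1 / 2))
        - (N : ℂ) ^ a / 2
        + Complex.Gamma (a + 1) / (Real.pi : ℂ) ^ a * (N : ℂ) ^ ((a + 1 / 2) / 2) *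
          ∑' ℓ : ℕ+, besselTerm (a + 1 / 2) N ℓ := by
  have hN0 : (0 : ℝ) < N := by exact_mod_cast hN
  have hNc : (N : ℂ) ≠ 0 := by exact_mod_cast hN0.ne'
  have ha0 : 0 < a.re := by linarith
  have hpi : (Real.pi : ℂ) ≠ 0 := by exact_mod_cast Real.pi_ne_zero
  set f : ℝ → ℂ := fun v => posCpow a ((N : ℝ) - v ^ 2) with hf
  set c : ℝ := 2 * Real.pi * Real.sqrt N with hc
  have hc0 : 0 < c := by positivity
  set B : ℂ := (N : ℂ) ^ (a + 1 / 2) *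
    (Complex.Gamma (a + 1) / (2 * (Real.pi : ℂ) ^ (1 / 2 : ℂ))) with hB
  have hfour : ∀ ξ : ℝ, 𝓕 f ξ = B * sonine (a + 1 / 2) (c * ξ) := by
    intro ξ
    rw [hf, fourier_posCpow ha0 hN0, hB, hc, ofReal_natCast]
  -- This is where Re a > 1 is used: it gives the decay that makes the Fourier side summable.
  have hν : 3 / 2 < (a + 1 / 2).re := by
    norm_num
    linarith
  have hzero : ∀ v : ℝ, (N : ℝ) < |v| → f v = 0 := by
    intro v hv
    refine posCpow_of_nonpos ha0 ?_
    have h1 : (1 : ℝ) ≤ N := by exact_mod_cast hN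
    have h2 : (N : ℝ) ^ 2 ≤ |v| ^ 2 := by gcongr
    rw [sq_abs] at h2
    nlinarith
  have hbig : f =O[cocompact ℝ] fun x : ℝ => |x| ^ (-2 : ℝ) := by
    have hev : f =ᶠ[cocompact ℝ] fun _ => (0 : ℂ) := by
      have := (tendsto_norm_cocompact_atTop (E := ℝ)).eventually_gt_atTop (N : ℝ)
      filter_upwards [this] with v hv
      exact hzero v hv
    exact hev.trans_isBigO (Asymptotics.isBigO_zero _ _)
  have hsumF : Summable fun n : ℤ => 𝓕 f n := by
    simp only [hfour]
    exact (summable_sonine_int hν hc0).mul_left B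
  have hpois := Real.tsum_eq_tsum_fourier_of_rpow_decay_of_summable (f := f)
    ((continuous_posCpow ha0).comp (by fun_prop)) one_lt_two hbig hsumF 0
  simp only [zero_add, QuotientAddGroup.mk_zero, fourier_eval_zero, mul_one] at hpois
  have hfin : ∀ n : ℤ, n ∉ Finset.Icc (-(N : ℤ)) N → f n = 0 := by
    intro n hn
    refine hzero _ ?_
    rw [Finset.mem_Icc, ← abs_le, not_le] at hn
    exact_mod_cast hn
  have hsumf : Summable fun n : ℤ => f n := summable_of_ne_finset_zero hfin
  have hevenf : Function.Even fun n : ℤ => f n := by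
    intro n
    simp [hf]
  have hevenF : Function.Even fun n : ℤ => 𝓕 f n := by
    intro n
    simp only [hfour, Int.cast_neg, mul_neg, sonine_neg]
  -- Both sides are even, so each is its zero term plus twice the sum over positive integers. The
  -- zero term f(0) = N^a is the source of -N^a/2.
  rw [tsum_int_eq_zero_add_two_mul_tsum_pnat hevenf hsumf,
    tsum_int_eq_zero_add_two_mul_tsum_pnat hevenF hsumF] at hpois
  have hS : ∑' n : ℕ+, f (((n : ℕ) : ℤ) : ℝ)
      = ∑ m ∈ Finset.Icc 1 N, posCpow a ((N : ℝ) - (m : ℝ) ^ 2) := by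
    rw [tsum_pnat_eq_tsum_succ (f := fun n : ℕ => f ((n : ℤ) : ℝ)),
      tsum_eq_sum (s := Finset.range N)]
    · rw [Finset.range_eq_Ico, Finset.sum_Ico_add' (fun n : ℕ => f ((n : ℤ) : ℝ)) 0 N 1]
      rfl
    · intro n hn
      refine hzero _ ?_
      rw [Finset.mem_range, not_lt] at hn
      push_cast
      rw [abs_of_pos (by positivity)]
      have : (N : ℝ) ≤ n := by exact_mod_cast hn
      linarith
  have hT : ∑' n : ℕ+, 𝓕 f (((n : ℕ) : ℤ) : ℝ)
      = Complex.Gamma (a + 1) / (Real.pi : ℂ) ^ a * (N : ℂ) ^ ((a + 1 / 2) / 2) *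
          ∑' ℓ : ℕ+, besselTerm (a + 1 / 2) N ℓ := by
    rw [← tsum_mul_left]
    congr 1
    funext ℓ
    rw [hfour, besselTerm_eq_sonine _ hN, hB, hc]
    have e1 : (N : ℂ) ^ (a + 1 / 2) = (N : ℂ) ^ ((a + 1 / 2) / 2) * (N : ℂ) ^ ((a + 1 / 2) / 2) := by
      rw [← cpow_add _ _ hNc, add_halves]
    have e2 : (Real.pi : ℂ) ^ (a + 1 / 2) = (Real.pi : ℂ) ^ a * (Real.pi : ℂ) ^ (1 / 2 : ℂ) :=
      cpow_add _ _ hpi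
    have e3 : (Real.pi : ℂ) = (Real.pi : ℂ) ^ (1 / 2 : ℂ) * (Real.pi : ℂ) ^ (1 / 2 : ℂ) := by
      rw [← cpow_add _ _ hpi]
      norm_num
    have h1 : (Real.pi : ℂ) ^ (1 / 2 : ℂ) ≠ 0 := by simp [cpow_eq_zero_iff, hpi]
    have h2 : (Real.pi : ℂ) ^ a ≠ 0 := by simp [cpow_eq_zero_iff, hpi]
    have e4 : c * (((ℓ : ℕ) : ℤ) : ℝ) = 2 * Real.pi * ((ℓ : ℕ) : ℝ) * Real.sqrt N := by
      rw [hc]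
      push_cast
      ring
    rw [← hc, e4, e1, e2]
    generalize sonine _ _ = s
    generalize (Real.pi : ℂ) ^ (1 / 2 : ℂ) = q at *
    generalize (Real.pi : ℂ) ^ a = p at *
    rw [e3]
    field_simp
  have h0 : 𝓕 f ((0 : ℤ) : ℝ) = (Real.pi : ℂ) ^ (1 / 2 : ℂ) *
      (Complex.Gamma (a + 1) / Complex.Gamma (a + 3 / 2) * (N : ℂ) ^ (a + 1 / 2)) := by
    have e3 : (Real.pi : ℂ) = (Real.pi : ℂ) ^ (1 / 2 : ℂ) * (Real.pi : ℂ) ^ (1 / 2 : ℂ) := by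
      rw [← cpow_add _ _ hpi]
      norm_num
    have h1 : (Real.pi : ℂ) ^ (1 / 2 : ℂ) ≠ 0 := by simp [cpow_eq_zero_iff, hpi]
    rw [hfour, Int.cast_zero, mul_zero, sonine_zero (by linarith), hB,
      show a + 1 / 2 + 1 = a + 3 / 2 by ring]
    generalize (Real.pi : ℂ) ^ (1 / 2 : ℂ) = q at *
    rw [e3]
    field_simp
  have hf0 : f ((0 : ℤ) : ℝ) = (N : ℂ) ^ a := by
    simp only [hf, Int.cast_zero]
    rw [posCpow_of_pos (by simpa using hN0)]
    simp
  rw [hS, hT, h0, hf0] at hpois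
  linear_combination hpois / 2

end Poisson

/-! ### Combining the explicit formula with Poisson summation. -/

section Assembly

/-- Reindexing by n = m₁ + m₂². When m² ≥ N the truncated subtraction gives 0 and the Riesz mean is
an empty sum. -/
lemma cesaroHL_eq_sum_rieszMean (k : ℝ) {N : ℕ} (hN : 1 ≤ N) :
    cesaroHL k N = (N : ℝ) ^ (-k) * ∑ m ∈ Finset.Icc 1 N, rieszMean k (N - m ^ 2) := by
  have hN0 : (0 : ℝ) < N := by exact_mod_cast hN
  simp only [cesaroHL, hardyLittlewoodR, rieszMean, Finset.sum_mul, Finset.mul_sum]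
  rw [Finset.sum_sigma', Finset.sum_sigma']
  refine Finset.sum_nbij' (fun x => ⟨x.2.2, x.2.1⟩) (fun y => ⟨y.2 + y.1 ^ 2, (y.2, y.1)⟩)
    ?_ ?_ ?_ ?_ ?_
  · rintro ⟨n, m₁, m₂⟩ h
    simp only [Finset.mem_sigma, Finset.mem_filter, Finset.mem_product, Finset.mem_Icc,
      Finset.mem_Ioc] at h ⊢
    obtain ⟨⟨h1, h2⟩, ⟨⟨h3, h4⟩, h5, h6⟩, h7⟩ := h
    refine ⟨⟨h5, h6.trans h2⟩, h3, ?_⟩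
    omega
  · rintro ⟨m₂, m₁⟩ h
    simp only [Finset.mem_sigma, Finset.mem_filter, Finset.mem_product, Finset.mem_Icc,
      Finset.mem_Ioc] at h ⊢
    obtain ⟨⟨h1, h2⟩, h3, h4⟩ := h
    have h5 : m₂ ≤ m₂ ^ 2 := Nat.le_self_pow two_ne_zero m₂
    refine ⟨⟨by omega, by omega⟩, ⟨⟨h3, by omega⟩, h1, by omega⟩, trivial⟩
  · rintro ⟨n, m₁, m₂⟩ h
    simp only [Finset.mem_sigma, Finset.mem_filter] at h
    obtain ⟨-, -, rfl⟩ := h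
    rfl
  · rintro ⟨m₂, m₁⟩ h
    rfl
  · rintro ⟨n, m₁, m₂⟩ h
    simp only [Finset.mem_sigma, Finset.mem_filter, Finset.mem_Icc] at h
    obtain ⟨⟨h1, h2⟩, -, rfl⟩ := h
    have h3 : ((m₁ + m₂ ^ 2 : ℕ) : ℝ) ≤ N := by exact_mod_cast h2
    dsimp only
    rw [Nat.cast_sub (by omega), one_sub_div hN0.ne', Real.div_rpow (by linarith) hN0.le,
      Real.rpow_neg hN0.le]
    push_cast
    rw [show (N : ℝ) - (m₁ + m₂ ^ 2) = N - m₂ ^ 2 - m₁ by ring]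
    ring

lemma summable_rieszCoeff_mul_cpow {k : ℝ} (hk : 1 < k) (b : ℂ) {X : ℕ} (hX : 0 < X) :
    Summable fun ρ : zetaZeros => rieszCoeff k ρ * (X : ℂ) ^ (b + ρ) := by
  have h1 : (1 : ℝ) ≤ X := by exact_mod_cast hX
  refine ((summable_rieszCoeff hk).norm.mul_right ((X : ℝ) ^ (b.re + 1))).of_norm_bounded
    fun ρ => ?_
  rw [norm_mul, norm_natCast_cpow_of_pos hX, add_re]
  gcongr
  exact ρ.2.2.2.le

lemma posCpow_sub_sq (a : ℂ) {N m : ℕ} (h : m ^ 2 < N) :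
    posCpow a ((N : ℝ) - (m : ℝ) ^ 2) = ((N - m ^ 2 : ℕ) : ℂ) ^ a := by
  have h' : (m : ℝ) ^ 2 < N := by exact_mod_cast h
  rw [posCpow_of_pos (by linarith), Nat.cast_sub h.le]
  push_cast
  rfl

lemma posCpow_sub_sq_eq_zero {a : ℂ} (ha : 0 < a.re) {N m : ℕ} (h : N ≤ m ^ 2) :
    posCpow a ((N : ℝ) - (m : ℝ) ^ 2) = 0 := by
  have h' : (N : ℝ) ≤ (m : ℝ) ^ 2 := by exact_mod_cast h
  exact posCpow_of_nonpos ha (by linarith)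

lemma re_add_zero_pos {k : ℝ} (hk : 1 < k) (ρ : zetaZeros) : 1 < ((k : ℂ) + ρ).re := by
  have := ρ.2.2.1
  rw [add_re, ofReal_re]
  linarith

lemma summable_rieszCoeff_mul_posCpow {k : ℝ} (hk : 1 < k) (N m : ℕ) :
    Summable fun ρ : zetaZeros =>
      rieszCoeff k ρ * posCpow ((k : ℂ) + ρ) ((N : ℝ) - (m : ℝ) ^ 2) := by
  rcases lt_or_ge (m ^ 2) N with h | h
  · simp only [posCpow_sub_sq _ h]
    exact summable_rieszCoeff_mul_cpow hk k (Nat.sub_pos_of_lt h)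
  · have (ρ : zetaZeros) : posCpow ((k : ℂ) + ρ) ((N : ℝ) - (m : ℝ) ^ 2) = 0 :=
      posCpow_sub_sq_eq_zero (zero_lt_one.trans (re_add_zero_pos hk ρ)) h
    simp only [this, mul_zero]
    exact summable_zero

/-- The Cesàro mean in terms of the sums `∑ (N - m²)₊ ^ a`. -/
lemma exists_cesaroHL_error {k : ℝ} (hk : 1 < k) : ∃ C : ℝ, ∀ N : ℕ, 1 ≤ N →
    ‖(cesaroHL k N : ℂ) - (N : ℂ) ^ (-(k : ℂ)) *
      ((∑ m ∈ Finset.Icc 1 N, posCpow ((k : ℂ) + 1) ((N : ℝ) - (m : ℝ) ^ 2)) /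
          Complex.Gamma ((k : ℂ) + 2)
        - ∑' ρ : zetaZeros, rieszCoeff k ρ *
            ∑ m ∈ Finset.Icc 1 N, posCpow ((k : ℂ) + ρ) ((N : ℝ) - (m : ℝ) ^ 2))‖
      ≤ C * (N : ℝ) ^ (1 / 2 : ℝ) := by
  obtain ⟨C, hC0, hC⟩ := exists_rieszMean_error hk
  refine ⟨C, fun N hN => ?_⟩
  have hN0 : (0 : ℝ) < N := by exact_mod_cast hN
  set E : ℕ → ℂ := fun m => (rieszMean k (N - m ^ 2) : ℂ)
    - posCpow ((k : ℂ) + 1) ((N : ℝ) - (m : ℝ) ^ 2) / Complex.Gamma ((k : ℂ) + 2)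
    + ∑' ρ : zetaZeros, rieszCoeff k ρ * posCpow ((k : ℂ) + ρ) ((N : ℝ) - (m : ℝ) ^ 2) with hE
  have hE0 : ∀ m : ℕ, N ≤ m ^ 2 → E m = 0 := by
    intro m hm
    have h1 (ρ : zetaZeros) : posCpow ((k : ℂ) + ρ) ((N : ℝ) - (m : ℝ) ^ 2) = 0 :=
      posCpow_sub_sq_eq_zero (zero_lt_one.trans (re_add_zero_pos hk ρ)) hm
    have h2 : posCpow ((k : ℂ) + 1) ((N : ℝ) - (m : ℝ) ^ 2) = 0 :=
      posCpow_sub_sq_eq_zero (by simp; linarith) hm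
    simp [hE, h1, h2, Nat.sub_eq_zero_of_le hm, rieszMean]
  have hEle : ∀ m : ℕ, ‖E m‖ ≤ C * (N : ℝ) ^ k := by
    intro m
    rcases lt_or_ge (m ^ 2) N with h | h
    · simp only [hE, posCpow_sub_sq _ h]
      refine (hC _ (Nat.sub_pos_of_lt h)).trans ?_
      gcongr
      exact Nat.sub_le _ _
    · rw [hE0 m h, norm_zero]
      positivity
  -- At most √N values of m contribute, each with an error of at most C N^k.
  have hsum : ‖∑ m ∈ Finset.Icc 1 N, E m‖ ≤ Real.sqrt N * (C * (N : ℝ) ^ k) := by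
    have h1 : ∑ m ∈ Finset.Icc 1 (Nat.sqrt N), E m = ∑ m ∈ Finset.Icc 1 N, E m := by
      refine Finset.sum_subset (Finset.Icc_subset_Icc_right (Nat.sqrt_le_self N)) ?_
      intro m hm hm'
      refine hE0 m ?_
      rw [Finset.mem_Icc] at hm hm'
      have : Nat.sqrt N < m := by
        by_contra h
        exact hm' ⟨hm.1, not_lt.1 h⟩
      exact (Nat.sqrt_lt'.1 this).le
    rw [← h1]
    refine (norm_sum_le_of_le _ fun m _ => hEle m).trans ?_
    rw [Finset.sum_const, Nat.card_Icc, nsmul_eq_mul, Nat.add_sub_cancel]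
    gcongr
    exact Real.nat_sqrt_le_real_sqrt
  have hkey : (cesaroHL k N : ℂ) - (N : ℂ) ^ (-(k : ℂ)) *
      ((∑ m ∈ Finset.Icc 1 N, posCpow ((k : ℂ) + 1) ((N : ℝ) - (m : ℝ) ^ 2)) /
          Complex.Gamma ((k : ℂ) + 2)
        - ∑' ρ : zetaZeros, rieszCoeff k ρ *
            ∑ m ∈ Finset.Icc 1 N, posCpow ((k : ℂ) + ρ) ((N : ℝ) - (m : ℝ) ^ 2))
      = (N : ℂ) ^ (-(k : ℂ)) * ∑ m ∈ Finset.Icc 1 N, E m := by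
    have h1 : (((N : ℝ) ^ (-k) : ℝ) : ℂ) = (N : ℂ) ^ (-(k : ℂ)) := by
      rw [ofReal_cpow hN0.le]
      simp
    rw [cesaroHL_eq_sum_rieszMean k hN, ofReal_mul, h1, ofReal_sum]
    simp only [hE, Finset.sum_add_distrib, Finset.sum_sub_distrib, Finset.mul_sum, ← Finset.sum_div]
    -- For each fixed m the series over zeros converges, so it commutes with the finite sum over m.
    rw [Summable.tsum_finsetSum fun m _ => summable_rieszCoeff_mul_posCpow hk N m]
    simp only [← Finset.mul_sum]
    ring
  rw [hkey, norm_mul, norm_natCast_cpow_of_pos hN, neg_re, ofReal_re, ← Real.sqrt_eq_rpow]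
  calc (N : ℝ) ^ (-k) * ‖∑ m ∈ Finset.Icc 1 N, E m‖
      ≤ (N : ℝ) ^ (-k) * (Real.sqrt N * (C * (N : ℝ) ^ k)) := by gcongr
    _ = C * Real.sqrt N * ((N : ℝ) ^ (-k) * (N : ℝ) ^ k) := by ring
    _ = C * Real.sqrt N := by rw [← Real.rpow_add hN0]; simp

lemma gammaZeroTerm_eq_rieszCoeff (k : ℝ) (w' : ℂ) (N : ℕ) (ρ : zetaZeros) :
    gammaZeroTerm ((k : ℂ) + 1) w' N ρ = rieszCoeff k ρ * (N : ℂ) ^ (w' + ρ) := by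
  rw [gammaZeroTerm, rieszCoeff]
  ring

lemma summable_gammaZeroTerm {k : ℝ} (hk : 1 < k) (w' : ℂ) {N : ℕ} (hN : 1 ≤ N) :
    Summable (gammaZeroTerm ((k : ℂ) + 1) w' N) :=
  (summable_rieszCoeff_mul_cpow hk w' hN).congr fun ρ =>
    (gammaZeroTerm_eq_rieszCoeff k w' N ρ).symm

/-- The contribution of a zero, after Poisson summation. -/
lemma rieszCoeff_mul_sum_posCpow {k : ℝ} (hk : 1 < k) {N : ℕ} (hN : 1 ≤ N) (ρ : zetaZeros) :
    (N : ℂ) ^ (-(k : ℂ)) * (rieszCoeff k ρ *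
        ∑ m ∈ Finset.Icc 1 N, posCpow ((k : ℂ) + ρ) ((N : ℝ) - (m : ℝ) ^ 2))
      = (Real.pi : ℂ) ^ (1 / 2 : ℂ) / 2 * gammaZeroTerm ((k : ℂ) + 3 / 2) (1 / 2) N ρ
        - 1 / 2 * gammaZeroTerm ((k : ℂ) + 1) 0 N ρ
        + (N : ℂ) ^ (1 / 4 - (k : ℂ) / 2) / (Real.pi : ℂ) ^ (k : ℂ) * besselZeroTerm k N ρ := by
  have hNc : (N : ℂ) ≠ 0 := by exact_mod_cast (Nat.pos_of_ne_zero (by omega)).ne'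
  have hpi : (Real.pi : ℂ) ≠ 0 := by exact_mod_cast Real.pi_ne_zero
  have hre := re_add_zero_pos hk ρ
  rw [sum_posCpow hre hN, rieszCoeff, gammaZeroTerm, gammaZeroTerm, besselZeroTerm,
    show (k : ℂ) + ρ + 1 / 2 = k + 1 / 2 + ρ by ring, show (k : ℂ) + ρ + 3 / 2 = k + 3 / 2 + ρ by ring,
    show (k : ℂ) + ρ + 1 = k + 1 + ρ by ring]
  have hG : Complex.Gamma ((k : ℂ) + 1 + ρ) ≠ 0 := Complex.Gamma_ne_zero_of_re_pos (by
    rw [show (k : ℂ) + 1 + ρ = k + ρ + 1 by ring, add_re, one_re]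
    linarith)
  have e1 : (N : ℂ) ^ ((k : ℂ) + 1 / 2 + ρ) = (N : ℂ) ^ (k : ℂ) * (N : ℂ) ^ (1 / 2 + (ρ : ℂ)) := by
    rw [← cpow_add _ _ hNc, add_assoc]
  have e2 : (N : ℂ) ^ ((k : ℂ) + ρ) = (N : ℂ) ^ (k : ℂ) * (N : ℂ) ^ (0 + (ρ : ℂ)) := by
    rw [← cpow_add _ _ hNc, zero_add]
  have e3 : (N : ℂ) ^ (((k : ℂ) + 1 / 2 + ρ) / 2)
      = (N : ℂ) ^ (k : ℂ) * (N : ℂ) ^ (1 / 4 - (k : ℂ) / 2) * (N : ℂ) ^ ((ρ : ℂ) / 2) := by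
    rw [← cpow_add _ _ hNc, ← cpow_add _ _ hNc]
    ring_nf
  have e4 : (Real.pi : ℂ) ^ ((k : ℂ) + ρ) = (Real.pi : ℂ) ^ (k : ℂ) * (Real.pi : ℂ) ^ (ρ : ℂ) :=
    cpow_add _ _ hpi
  have hNk : (N : ℂ) ^ (k : ℂ) ≠ 0 := by simp [cpow_eq_zero_iff, hNc]
  have hpk : (Real.pi : ℂ) ^ (k : ℂ) ≠ 0 := by simp [cpow_eq_zero_iff, hpi]
  have hpr : (Real.pi : ℂ) ^ (ρ : ℂ) ≠ 0 := by simp [cpow_eq_zero_iff, hpi]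
  rw [e1, e2, e3, e4, cpow_neg]
  generalize (Real.pi : ℂ) ^ (1 / 2 : ℂ) = q
  generalize (Real.pi : ℂ) ^ (k : ℂ) = pk at *
  generalize (Real.pi : ℂ) ^ (ρ : ℂ) = pr at *
  generalize (N : ℂ) ^ (k : ℂ) = Nk at *
  generalize (N : ℂ) ^ (1 / 4 - (k : ℂ) / 2) = Nq
  generalize (N : ℂ) ^ (1 / 2 + (ρ : ℂ)) = Nh
  generalize (N : ℂ) ^ (0 + (ρ : ℂ)) = Nr
  generalize (N : ℂ) ^ ((ρ : ℂ) / 2) = Nrh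
  generalize Complex.Gamma ((k : ℂ) + 1 + ρ) = G at *
  -- This Gamma value occurs only through its inverse on both sides, so its non-vanishing plays no
  -- role.
  rw [div_eq_mul_inv _ (Complex.Gamma ((k : ℂ) + 3 / 2 + ρ)),
    div_eq_mul_inv _ (Complex.Gamma ((k : ℂ) + 3 / 2 + ρ))]
  generalize (Complex.Gamma ((k : ℂ) + 3 / 2 + ρ))⁻¹ = G'
  generalize ∑' ℓ : ℕ+, besselTerm ((k : ℂ) + 1 / 2 + ρ) N ℓ = B
  field_simp

/-- The main term, after Poisson summation. -/
lemma sum_posCpow_div_Gamma {k : ℝ} (hk : 1 < k) {N : ℕ} (hN : 1 ≤ N) :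
    (N : ℂ) ^ (-(k : ℂ)) *
      ((∑ m ∈ Finset.Icc 1 N, posCpow ((k : ℂ) + 1) ((N : ℝ) - (m : ℝ) ^ 2)) /
        Complex.Gamma ((k : ℂ) + 2))
      = (Real.pi : ℂ) ^ (1 / 2 : ℂ) / 2 *
          ((N : ℂ) ^ (3 / 2 : ℂ) / Complex.Gamma ((k : ℂ) + 5 / 2))
        - 1 / 2 * ((N : ℂ) / Complex.Gamma ((k : ℂ) + 2))
        + (N : ℂ) ^ (3 / 4 - (k : ℂ) / 2) / (Real.pi : ℂ) ^ ((k : ℂ) + 1) *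
            ∑' ℓ : ℕ+, besselTerm ((k : ℂ) + 3 / 2) N ℓ := by
  have hNc : (N : ℂ) ≠ 0 := by exact_mod_cast (Nat.pos_of_ne_zero (by omega)).ne'
  rw [sum_posCpow (by simp; linarith) hN, show (k : ℂ) + 1 + 1 / 2 = k + 3 / 2 by ring,
    show (k : ℂ) + 1 + 3 / 2 = k + 5 / 2 by ring, show (k : ℂ) + 1 + 1 = k + 2 by ring]
  have hG : Complex.Gamma ((k : ℂ) + 2) ≠ 0 := Complex.Gamma_ne_zero_of_re_pos (by
    rw [add_re, ofReal_re, re_ofNat]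
    linarith)
  have e1 : (N : ℂ) ^ ((k : ℂ) + 3 / 2) = (N : ℂ) ^ (k : ℂ) * (N : ℂ) ^ (3 / 2 : ℂ) :=
    cpow_add _ _ hNc
  have e2 : (N : ℂ) ^ ((k : ℂ) + 1) = (N : ℂ) ^ (k : ℂ) * N := by
    rw [cpow_add _ _ hNc, cpow_one]
  have e3 : (N : ℂ) ^ (((k : ℂ) + 3 / 2) / 2)
      = (N : ℂ) ^ (k : ℂ) * (N : ℂ) ^ (3 / 4 - (k : ℂ) / 2) := by
    rw [← cpow_add _ _ hNc]
    ring_nf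
  have hNk : (N : ℂ) ^ (k : ℂ) ≠ 0 := by simp [cpow_eq_zero_iff, hNc]
  rw [e1, e2, e3, cpow_neg]
  generalize (Real.pi : ℂ) ^ (1 / 2 : ℂ) = q
  rw [div_eq_mul_inv _ ((Real.pi : ℂ) ^ ((k : ℂ) + 1)),
    div_eq_mul_inv _ ((Real.pi : ℂ) ^ ((k : ℂ) + 1)),
    div_eq_mul_inv _ (Complex.Gamma ((k : ℂ) + 5 / 2)),
    div_eq_mul_inv _ (Complex.Gamma ((k : ℂ) + 5 / 2))]
  generalize ((Real.pi : ℂ) ^ ((k : ℂ) + 1))⁻¹ = pk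
  generalize (Complex.Gamma ((k : ℂ) + 5 / 2))⁻¹ = G'
  generalize (N : ℂ) ^ (k : ℂ) = Nk at *
  generalize (N : ℂ) ^ (3 / 4 - (k : ℂ) / 2) = Nq
  generalize (N : ℂ) ^ (3 / 2 : ℂ) = Nh
  generalize Complex.Gamma ((k : ℂ) + 2) = G at *
  generalize ∑' ℓ : ℕ+, besselTerm ((k : ℂ) + 3 / 2) N ℓ = B
  field_simp

/-- By the Poisson identity for each zero, a nonzero constant times the Bessel term is a linear
combination of the terms of three convergent series. No estimate of Bessel functions uniform in ρ is
needed. -/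
lemma summable_besselZeroTerm {k : ℝ} (hk : 1 < k) {N : ℕ} (hN : 1 ≤ N)
    (h1 : Summable (gammaZeroTerm ((k : ℂ) + 3 / 2) (1 / 2) N))
    (h0 : Summable (gammaZeroTerm ((k : ℂ) + 1) 0 N)) : Summable (besselZeroTerm k N) := by
  have hNc : (N : ℂ) ≠ 0 := by exact_mod_cast (Nat.pos_of_ne_zero (by omega)).ne'
  have hpi : (Real.pi : ℂ) ≠ 0 := by exact_mod_cast Real.pi_ne_zero
  have hc : (N : ℂ) ^ (1 / 4 - (k : ℂ) / 2) / (Real.pi : ℂ) ^ (k : ℂ) ≠ 0 :=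
    div_ne_zero (by simp [cpow_eq_zero_iff, hNc]) (by simp [cpow_eq_zero_iff, hpi])
  have hS : Summable fun ρ : zetaZeros => rieszCoeff k ρ *
      ∑ m ∈ Finset.Icc 1 N, posCpow ((k : ℂ) + ρ) ((N : ℝ) - (m : ℝ) ^ 2) := by
    simp only [Finset.mul_sum]
    exact summable_sum fun m _ => summable_rieszCoeff_mul_posCpow hk N m
  refine (summable_mul_left_iff hc).1 ?_
  refine (((hS.mul_left ((N : ℂ) ^ (-(k : ℂ)))).sub
    (h1.mul_left ((Real.pi : ℂ) ^ (1 / 2 : ℂ) / 2))).add (h0.mul_left (1 / 2))).congr fun ρ => ?_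
  rw [rieszCoeff_mul_sum_posCpow hk hN]
  ring

end Assembly

end Preliminaries

theorem theorem3 (k : ℝ) (hk : 1 < k) :
    ∃ C : ℝ, ∀ N : ℕ, 1 ≤ N →
      Summable (gammaZeroTerm ((k : ℂ) + 3 / 2) (1 / 2) N) ∧
      Summable (gammaZeroTerm ((k : ℂ) + 1) 0 N) ∧
      Summable (besselTerm ((k : ℂ) + 3 / 2) N) ∧
      (∀ ρ : zetaZeros, Summable (besselTerm ((k : ℂ) + 1 / 2 + ρ) N)) ∧
      Summable (besselZeroTerm k N) ∧
      ‖(cesaroHL k N : ℂ) -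
          ((Real.pi : ℂ) ^ (1 / 2 : ℂ) / 2 *
              ((N : ℂ) ^ (3 / 2 : ℂ) / Complex.Gamma ((k : ℂ) + 5 / 2))
            - 1 / 2 * ((N : ℂ) / Complex.Gamma ((k : ℂ) + 2))
            - (Real.pi : ℂ) ^ (1 / 2 : ℂ) / 2 *
                ∑' ρ : zetaZeros, gammaZeroTerm ((k : ℂ) + 3 / 2) (1 / 2) N ρ
            + 1 / 2 * ∑' ρ : zetaZeros, gammaZeroTerm ((k : ℂ) + 1) 0 N ρ
            + (N : ℂ) ^ (3 / 4 - (k : ℂ) / 2) / (Real.pi : ℂ) ^ ((k : ℂ) + 1) *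
                ∑' ℓ : ℕ+, besselTerm ((k : ℂ) + 3 / 2) N ℓ
            - (N : ℂ) ^ (1 / 4 - (k : ℂ) / 2) / (Real.pi : ℂ) ^ (k : ℂ) *
                ∑' ρ : zetaZeros, besselZeroTerm k N ρ)‖
        ≤ C * (N : ℝ) ^ (1 / 2 : ℝ) := by
  obtain ⟨C, hC⟩ := exists_cesaroHL_error hk
  refine ⟨C, fun N hN => ?_⟩
  have h1 : Summable (gammaZeroTerm ((k : ℂ) + 3 / 2) (1 / 2) N) := by
    -- The denominators Γ(k + 3/2 + ρ) are those of Riesz means of order k + 1/2.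
    have := summable_gammaZeroTerm (k := k + 1 / 2) (by linarith) (1 / 2) hN
    rwa [show ((k + 1 / 2 : ℝ) : ℂ) + 1 = k + 3 / 2 by push_cast; ring] at this
  have h0 : Summable (gammaZeroTerm ((k : ℂ) + 1) 0 N) := summable_gammaZeroTerm hk 0 hN
  have hb := summable_besselZeroTerm hk hN h1 h0
  refine ⟨h1, h0, summable_besselTerm ?_ hN, fun ρ => summable_besselTerm ?_ hN, hb, ?_⟩
  · norm_num
    linarith
  · have := ρ.2.2.1
    norm_num
    linarith
  · convert hC N hN using 2
    rw [mul_sub, sum_posCpow_div_Gamma hk hN, ← tsum_mul_left (a := (N : ℂ) ^ (-(k : ℂ))),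
      tsum_congr (rieszCoeff_mul_sum_posCpow hk hN), ((h1.mul_left _).sub (h0.mul_left _)).tsum_add (hb.mul_left _),
      (h1.mul_left _).tsum_sub (h0.mul_left _), tsum_mul_left, tsum_mul_left, tsum_mul_left]
    ring
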